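/- All families, maps and germs below are real analytic near the origin; $\lambda\in\mathbb R^m$, $m\ge 0$ arbitrary. A \emph{transformation} is a germ $x'=\phi(x;\lambda)$ with $\phi(0;0)=0$, $\partial_x\phi(0;0)\neq0$; it conjugates the family $X(x;\lambda)\frac{\partial}{\partial x}$ to $X'(x';\lambda)\frac{\partial}{\partial x'}$ if $X'(\phi(x;\lambda);\lambda)=\partial_x\phi(x;\lambda)\,X(x;\lambda)$ near $(0,0)$. In what follows the sign in $(\pm1)^{k+1}$ is a fixed choice of $+$ or $-$ (so that $(\pm1)^{k+1}=1$ if $k$ is odd, and $\pm1$ if $k$ is even). \textbf{Theorem.} (i) (Existence.) Let $k\ge0$ and let $\tilde X(x;\lambda)\frac{\partial}{\partial x}$ be a germ of a real analytic family with $\tilde X(x;0)=x^{k+1}/\omega(x)$, $\omega(0)\ne0$. If $k=0$, it is real analytically conjugate to a family $c(\lambda)\,x\frac{\partial}{\partial x}$ with $c$ real analytic, $c(0)\neq0$. If $k\ge1$, it is, for some choice of the sign, real analytically conjugate to a family $$X(x;\lambda)\frac{\partial}{\partial x}=\frac{x^{k+1}+y_{k-1}(\lambda)x^{k-1}+\dots+y_0(\lambda)}{(\pm1)^{k+1}+\mu(\lambda)x^k}\frac{\partial}{\partial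 x}\qquad(\ast)$$ with $y_j,\mu$ real analytic germs, $y_0(0)=\dots=y_{k-1}(0)=0$, where $\mu(\lambda)=-\mathrm{Res}_{x=\infty}X(x;\lambda)^{-1}$ is the sum of the residues of $\tilde X(x;\lambda)^{-1}$ over its local (complex) polar locus around the origin. (ii) (Uniqueness.) If a transformation $\phi$ conjugates $c(\lambda)x\frac{\partial}{\partial x}$ to $c'(\lambda)x\frac{\partial}{\partial x}$, where $c(0),c'(0)\ne0$, then $c'=c$ and $\phi(x;\lambda)=\pm e^{t(\lambda)}x$ for some sign and some real analytic germ $t$. Let $k\geq1$. If a transformation $\phi$ conjugates a family $X$ of the form $(\ast)$ (with $y_j(0)=0$) to a family $X'$ of the same form, with data $y'_j,\mu'$ and possibly another sign, then the constants $(\pm1)^{k+1}$ of the two families agree, $\mu'=\mu$, and there are a real $k$-th root of unity $\rho$ (so $\rho=1$ if $k$ is odd, $\rho\in\{1,-1\}$ if $k$ is even) and a real analytic germ $t(\lambda)$ such that $$y_j'(\lambda)=\rho^{-(j-1)}y_j(\lambda),\quad j=0,\dots,k-1,\qquad \phi(x;\lambda)=\rho\,\exp(t(\lambda)X)(x;\lambda),$$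 where $\exp(tX)(\cdot\,;\lambda)$ is the time-$t$ flow of $X(\cdot\,;\lambda)\frac{\partial}{\partial x}$. Conversely, for every real $\rho$ with $\rho^k=1$, the map $x\mapsto\rho x$ conjugates the family $(\ast)$ with data $(y_j,\mu)$ to the one with data $(\rho^{-(j-1)}y_j,\mu)$ and the same sign. (iii) (Universality.) Consequently, for every $k\ge1$, $\mu\in\mathbb R$ and each choice of the sign, the family $$X_{3,\mathrm{real}}(x;y)\frac{\partial}{\partial x}=\frac{x^{k+1}+y_{k-1}x^{k-1}+\dots+y_0}{(\pm1)^{k+1}+(\mu+y_{2k+1})x^k}\frac{\partial}{\partial x},\qquad y=(y_0,\dots,y_{k-1},y_{2k+1})\in\mathbb R^{k+1},$$ is a universal real analytic deformation of $X_{3,\mathrm{real}}(x;0)\frac{\partial}{\partial x}$: for every real analytic family $X(x;\lambda)$ with $X(x;0)=X_{3,\mathrm{real}}(x;0)$ there is exactly one germ of real analytic map $\psi:(\mathbb R^m,0)\to(\mathbb R^{k+1},0)$ such that $X(x;\lambda)$ is conjugate to $X_{3,\mathrm{real}}(x;\psi(\lambda))$ by a transformation with $\phi(x;0)\equiv x$.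 -/

import Mathlib

open Filter Topology

noncomputable section

namespace KostovReal

/-- A family of vector fields `X(x;λ) ∂/∂x` on the line with parameter `λ ∈ ℝ^m`, given by its
coefficient function.  Only its germ at `(0, 0)` is ever used. -/
abbrev Family (m : ℕ) : Type := ℝ × (Fin m → ℝ) → ℝ

/-- `φ` is (a representative of) the germ of a real analytic invertible change of coordinate
`x' = φ(x;λ)` with `φ(0;0) = 0`. -/
def IsTransformation {m : ℕ} (φ : ℝ × (Fin m → ℝ) → ℝ) : Prop :=
  AnalyticAt ℝ φ 0 ∧ φ 0 = 0 ∧ deriv (fun x : ℝ => φ (x, 0)) 0 ≠ 0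

/-- `x' = φ(x;λ)` changes the family `X` into the family `X'`, that is `X = φ^* X'`:
`X'(φ(x;λ);λ) = (∂φ/∂x)(x;λ) X(x;λ)` for `(x, λ)` near `(0, 0)`. -/
def Conjugates {m : ℕ} (φ : ℝ × (Fin m → ℝ) → ℝ) (X X' : Family m) : Prop :=
  IsTransformation φ ∧
    ∀ᶠ p : ℝ × (Fin m → ℝ) in 𝓝 0,
      X' (φ p, p.2) = deriv (fun x : ℝ => φ (x, p.2)) p.1 * X p

/-- The two germs of families (with the same parameter) are real analytically conjugate. -/
def AreConjugate {m : ℕ} (X X' : Family m) : Prop := ∃ φ, Conjugates φ X X'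

/-- The two families are equivalent as deformations: conjugate by some `φ` with `φ(x;0) ≡ x`. -/
def AreEquivalent {m : ℕ} (X X' : Family m) : Prop :=
  ∃ φ, Conjugates φ X X' ∧ ∀ᶠ x : ℝ in 𝓝 0, φ (x, 0) = x

/-- The real analytic deformation `Z(x;y)`, `y ∈ ℝ^n`, of `Z(x;0)` is universal: every real analytic
deformation `X(x;λ)` of `Z(x;0)` is equivalent to the family `Z(x;ψ(λ))` induced by some
real analytic map germ `ψ : (ℝ^m, 0) → (ℝ^n, 0)` (versality), and the germ `ψ` is unique. -/
def IsUniversalDeformation {n : ℕ} (Z : Family n) : Prop :=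
  AnalyticAt ℝ Z 0 ∧
  ∀ (m : ℕ) (X : Family m), AnalyticAt ℝ X 0 →
    (∀ᶠ x : ℝ in 𝓝 0, X (x, 0) = Z (x, 0)) →
    (∃ ψ : (Fin m → ℝ) → (Fin n → ℝ), AnalyticAt ℝ ψ 0 ∧ ψ 0 = 0 ∧
      AreEquivalent X (fun p => Z (p.1, ψ p.2))) ∧
    (∀ ψ₁ ψ₂ : (Fin m → ℝ) → (Fin n → ℝ),
      AnalyticAt ℝ ψ₁ 0 → ψ₁ 0 = 0 → AreEquivalent X (fun p => Z (p.1, ψ₁ p.2)) →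
      AnalyticAt ℝ ψ₂ 0 → ψ₂ 0 = 0 → AreEquivalent X (fun p => Z (p.1, ψ₂ p.2)) →
      ψ₁ =ᶠ[𝓝 0] ψ₂)

/-- `X` is a real analytic family unfolding `X(x;0) = x^{k+1} / ω(x)` with `ω` analytic,
`ω(0) ≠ 0`. -/
def IsUnfolding {m : ℕ} (k : ℕ) (X : Family m) : Prop :=
  AnalyticAt ℝ X 0 ∧
  ∃ ω : ℝ → ℝ, AnalyticAt ℝ ω 0 ∧ ω 0 ≠ 0 ∧
    ∀ᶠ x : ℝ in 𝓝 0, X (x, 0) = x ^ (k + 1) * (1 / ω x)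

/-- The rational function `(x^{k+1} + y_{k-1} x^{k-1} + … + y_1 x + y_0) / (c + μ x^k)`. -/
def ratForm {K : Type*} [Field K] (k : ℕ) (c : K) (y : Fin k → K) (μ : K) (x : K) : K :=
  (x ^ (k + 1) + ∑ j : Fin k, y j * x ^ (j : ℕ)) / (c + μ * x ^ k)

/-- The normal form family `(x^{k+1} + y_{k-1}(λ) x^{k-1} + … + y_0(λ)) / (c + μ(λ) x^k)`. -/
def normalForm {m : ℕ} (k : ℕ) (c : ℝ) (y : (Fin m → ℝ) → (Fin k → ℝ)) (μ : (Fin m → ℝ) → ℝ) :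
    Family m :=
  fun p => ratForm k c (y p.2) (μ p.2) p.1

/-- The family `(x^{k+1} + y_{k-1} x^{k-1} + … + y_0) / (c + (μ + y_{2k+1}) x^k)` with parameter
`(y_0, …, y_{k-1}, y_{2k+1}) ∈ ℝ^{k+1}`; the last coordinate is `y_{2k+1}`. -/
def standardDeformation (k : ℕ) (c μ : ℝ) : Family (k + 1) :=
  fun p => ratForm k c (fun j : Fin k => p.2 j.castSucc) (μ + p.2 (Fin.last k)) p.1

/-- The residue at `z` of a function holomorphic in a punctured neighbourhood of `z`: the value of
`(2πi)⁻¹ ∮_{|w - z| = ε} f(w) dw` for small `ε > 0`. -/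
def residue (f : ℂ → ℂ) (z : ℂ) : ℂ :=
  limUnder (𝓝[>] (0 : ℝ)) fun ε =>
    (2 * (Real.pi : ℂ) * Complex.I)⁻¹ * circleIntegral f z ε

/-- The residue at infinity of (the differential form `f(z) dz` of) `f`. -/
def residueAtInfinity (f : ℂ → ℂ) : ℂ :=
  -residue (fun w => f w⁻¹ / w ^ 2) 0

/-- `F` is (a representative of) the complexification of the germ of the real analytic family
`X`. -/
def IsComplexification {m : ℕ} (F : ℂ × (Fin m → ℂ) → ℂ) (X : Family m) : Prop :=
  AnalyticAt ℂ F 0 ∧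
    ∀ᶠ p : ℝ × (Fin m → ℝ) in 𝓝 0, F ((p.1 : ℂ), fun i => (p.2 i : ℂ)) = (X p : ℂ)

/-- `μ(λ)` is the sum of the residues of `X(x;λ)⁻¹` over its local polar locus around the origin:
for every small radius `r` and all `λ` close enough to `0` (depending on `r`), the complex poles of
`X(·;λ)⁻¹` in `|z| < r` are finite in number and the residues there sum to `μ(λ)`. -/
def IsLocalResidueSum {m : ℕ} (X : Family m) (μ : (Fin m → ℝ) → ℝ) : Prop :=
  ∃ F : ℂ × (Fin m → ℂ) → ℂ, IsComplexification F X ∧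
    ∀ᶠ r : ℝ in 𝓝[>] 0, ∀ᶠ l : Fin m → ℝ in 𝓝 0,
      {z : ℂ | ‖z‖ < r ∧ F (z, fun i => (l i : ℂ)) = 0}.Finite ∧
      (μ l : ℂ) = ∑ᶠ z ∈ {z : ℂ | ‖z‖ < r ∧ F (z, fun i => (l i : ℂ)) = 0},
        residue (fun w => (F (w, fun i => (l i : ℂ)))⁻¹) z

/-- `φ(x;λ) = ρ · exp(t(λ) X)(x;λ)` as germs: for `(x, λ)` near `(0, 0)`, `φ(x;λ)` is `ρ` times the
value at time `t(λ)` of the integral curve of `X(·;λ)` starting at `x`; that curve stays in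
any neighbourhood `U` of `0` given beforehand once `(x, λ)` is close enough to `(0, 0)`. -/
def IsScaledFlow {m : ℕ} (φ : ℝ × (Fin m → ℝ) → ℝ) (ρ : ℝ) (t : (Fin m → ℝ) → ℝ)
    (X : Family m) : Prop :=
  ∀ U ∈ 𝓝 (0 : ℝ), ∀ᶠ p : ℝ × (Fin m → ℝ) in 𝓝 0, ∃ γ : ℝ → ℝ,
    γ 0 = p.1 ∧
    IsIntegralCurveOn γ (fun _ x => X (x, p.2)) (Set.uIcc 0 (t p.2)) ∧
    (∀ s ∈ Set.uIcc 0 (t p.2), γ s ∈ U) ∧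
    φ p = ρ * γ (t p.2)

end KostovReal

end

/-! Everything takes place in the Banach algebra `Wiener` of real power series with absolutely
summable coefficients. Power series extend to Banach algebras, so `exists_expansion` turns an
analytic germ `f(x;λ)` into an analytic map from `λ` to `Wiener`, the expansion in `u = x/e`. For a
family of order `k+1`, dividing by `e^(k+1)` gives elements `h e λ` with `h e 0` tending to the
model `u^(k+1)/c` as `e → 0` (`exists_small_expansion`). Questions on germs thus become questions
near one point of a Banach space.

The conjugacy equation is `P_y(φ) = φ' h (c + μ φ^k)` with `P_y` the centred monic polynomial.
Linearised at the model and at `φ = u`, `y = 0`, `μ = 0`, it sends `(q, y, μ)` to `(k+1) u^k q -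
u^(k+1) q' + Σ y_j u^j - (μ/c) u^(2k+1)`. The part in `q` is diagonal, `u^i ↦ (k+1-i) u^(k+i)`: its
kernel is spanned by `u^(k+1)`, and its range misses exactly the degrees below `k` and the degree
`2k+1`, which `y` and `μ` fill. Division by `k+1-i` compensates the derivative, so taking the
right-hand side `w` as the unknown, together with the coefficient `τ` of `u^(k+1)` in `φ`, makes the
equation `F = 0` analytic with partial derivative the identity in `w` (`fderiv_F_model`). The
implicit function theorem yields all solutions near the model as `w = W(h, τ)`; `τ = 0` gives
existence.

The remaining freedom `τ` is the flow of the normal form `N`: if `N(φ) = φ' h`, then the direction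
`N(φ)` lies in the kernel of the linearisation (`fderiv_F_field`). Hence `y` and `μ` do not depend
on `τ` (`exists_slice_const`), which gives uniqueness of the parameters and universality. Applied to
`h = N` itself, the curve in `τ`, reparametrised by time, is the flow, and it contains every
conjugacy near the identity (`exists_flow`). A general conjugacy of normal forms has a linear part
`ρ` with `ρ^k = 1`; a rotation removes it.

For `μ` as a residue, partial fractions show that the residues of `1/N` sum to `lim x/N(x) = μ` and
are preserved by pull-back (`exists_residues`); the coordinate change, a small perturbation of the
identity in a complex disc, puts the local poles in bijection with the roots of `P_y`. -/

noncomputable section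

namespace KostovReal

/-! ### The Banach algebra of absolutely summable power series. -/

/-- The subalgebra of the power series with absolutely summable coefficients. -/
def absSummable : Subalgebra ℝ (PowerSeries ℝ) where
  carrier := {f | Summable fun n => ‖PowerSeries.coeff n f‖}
  mul_mem' {f g} hf hg := by
    have h := summable_norm_sum_mul_antidiagonal_of_summable_norm hf hg
    simpa only [Set.mem_ofPred_eq, PowerSeries.coeff_mul] using h
  add_mem' {f g} hf hg := by
    refine Summable.of_nonneg_of_le (fun n => norm_nonneg _) (fun n => ?_) (hf.add hg)
    simpa only [map_add] using norm_add_le _ _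
  algebraMap_mem' r := by
    refine summable_of_ne_finset_zero (s := {0}) fun n hn => ?_
    have : n ≠ 0 := by simpa using hn
    simp [PowerSeries.coeff_C, this]

/-- The Banach algebra of the power series with absolutely summable coefficients. -/
structure Wiener : Type where
  /-- The underlying element of the subalgebra of power series. -/
  val : absSummable

namespace Wiener

/-- The defining equivalence. -/
def equiv : Wiener ≃ absSummable := ⟨val, mk, fun _ => rfl, fun _ => rfl⟩

/-- The ring structure of `Wiener`. -/
@[reducible] def commRingAux : CommRing Wiener := equiv.commRing

lemma summable_coeff (f : Wiener) : Summable fun n => ‖PowerSeries.coeff n f.val.1‖ := f.val.2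

section

attribute [local instance] commRingAux

/-- The normed group structure of `Wiener`. -/
@[reducible] def normedGroupAux : NormedAddCommGroup Wiener :=
  AddGroupNorm.toNormedAddCommGroup
    { toFun := fun f => ∑' n, ‖PowerSeries.coeff n f.val.1‖
      map_zero' := by
        change (∑' n, ‖PowerSeries.coeff n (0 : PowerSeries ℝ)‖) = 0
        simp
      add_le' := fun f g => by
        rw [← (summable_coeff f).tsum_add (summable_coeff g)]
        refine (summable_coeff _).tsum_le_tsum (fun n => ?_)
          ((summable_coeff f).add (summable_coeff g))
        change ‖PowerSeries.coeff n (f.val.1 + g.val.1)‖ ≤ _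
        simpa only [map_add] using norm_add_le _ _
      neg' := fun f => by
        change (∑' n, ‖PowerSeries.coeff n (-f.val.1)‖) = _
        simp
      eq_zero_of_map_eq_zero' := fun f hf => by
        have h := (hasSum_zero_iff_of_nonneg (fun n => norm_nonneg (PowerSeries.coeff n f.val.1))).1
          (hf ▸ (summable_coeff f).hasSum)
        refine equiv.injective (Subtype.ext (PowerSeries.ext fun n => ?_))
        change PowerSeries.coeff n f.val.1 = PowerSeries.coeff n (0 : PowerSeries ℝ)
        simpa using congrFun h n }

end

instance : NormedCommRing Wiener :=
  { commRingAux, normedGroupAux with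
    norm_mul_le := fun f g => by
      change (∑' n, ‖PowerSeries.coeff n (f.val.1 * g.val.1)‖) ≤
        (∑' n, ‖PowerSeries.coeff n f.val.1‖) * ∑' n, ‖PowerSeries.coeff n g.val.1‖
      rw [tsum_mul_tsum_eq_tsum_sum_antidiagonal_of_summable_norm
        (by simpa using summable_coeff f) (by simpa using summable_coeff g)]
      refine (absSummable.mul_mem f.val.2 g.val.2 : Summable _).tsum_le_tsum (fun n => ?_) ?_
      · rw [PowerSeries.coeff_mul]
        refine (norm_sum_le _ _).trans (le_of_eq ?_)
        simp
      · have := summable_norm_sum_mul_antidiagonal_of_summable_norm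
          (f := fun n => ‖PowerSeries.coeff n f.val.1‖) (g := fun n => ‖PowerSeries.coeff n g.val.1‖)
          (by simpa using summable_coeff f) (by simpa using summable_coeff g)
        exact this.of_norm }

instance : NormedAlgebra ℝ Wiener where
  smul r f := ⟨r • f.val⟩
  algebraMap :=
    { toFun := fun r => ⟨algebraMap ℝ absSummable r⟩
      map_one' := congrArg mk (map_one _)
      map_mul' := fun a b => congrArg mk (map_mul _ a b)
      map_zero' := congrArg mk (map_zero _)
      map_add' := fun a b => congrArg mk (map_add _ a b) }
  commutes' r f := mul_comm _ _
  smul_def' r f := congrArg mk (Algebra.smul_def r f.val)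
  norm_smul_le r f := by
    change (∑' n, ‖PowerSeries.coeff n (r • f.val.1)‖) ≤ ‖r‖ * ∑' n, ‖PowerSeries.coeff n f.val.1‖
    rw [← tsum_mul_left]
    refine le_of_eq (tsum_congr fun n => ?_)
    rw [map_smul, smul_eq_mul, norm_mul]

/-- The underlying power series. -/
def toPS : Wiener →ₐ[ℝ] PowerSeries ℝ where
  toFun f := f.val.1
  map_one' := rfl
  map_mul' _ _ := rfl
  map_zero' := rfl
  map_add' _ _ := rfl
  commutes' _ := rfl

lemma toPS_injective : Function.Injective toPS :=
  fun _ _ h => equiv.injective (Subtype.ext h)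

/-- The `n`-th coefficient. -/
def cf (n : ℕ) : Wiener →ₗ[ℝ] ℝ := (PowerSeries.coeff n).comp toPS.toLinearMap

lemma cf_eq (n : ℕ) (f : Wiener) : cf n f = PowerSeries.coeff n (toPS f) := rfl

lemma ext_cf {f g : Wiener} (h : ∀ n, cf n f = cf n g) : f = g :=
  toPS_injective (PowerSeries.ext h)

lemma summable_cf (f : Wiener) : Summable fun n => ‖cf n f‖ := f.val.2

/-- The element with prescribed summable coefficients. -/
def ofCf (a : ℕ → ℝ) (ha : Summable fun n => ‖a n‖) : Wiener :=
  ⟨⟨PowerSeries.mk a, by simpa [absSummable] using ha⟩⟩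

@[simp] lemma cf_ofCf (a : ℕ → ℝ) (ha : Summable fun n => ‖a n‖) (n : ℕ) : cf n (ofCf a ha) = a n := by
  change PowerSeries.coeff n (PowerSeries.mk a) = a n
  simp

lemma cf_mul (n : ℕ) (f g : Wiener) :
    cf n (f * g) = ∑ p ∈ Finset.HasAntidiagonal.antidiagonal n, cf p.1 f * cf p.2 g := by
  simp [cf_eq, PowerSeries.coeff_mul]

lemma cf_one (n : ℕ) : cf n (1 : Wiener) = if n = 0 then 1 else 0 := by
  simp [cf_eq, PowerSeries.coeff_one]

lemma norm_eq (f : Wiener) : ‖f‖ = ∑' n, ‖cf n f‖ := rfl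

instance : NormOneClass Wiener where
  norm_one := by
    rw [norm_eq, tsum_eq_single 0]
    · simp [cf_one]
    · intro n hn; simp [cf_one, hn]

lemma norm_le_of_cf_le {f : Wiener} {a : ℕ → ℝ} (ha : Summable a) (h : ∀ n, ‖cf n f‖ ≤ a n) :
    ‖f‖ ≤ ∑' n, a n := (summable_cf f).tsum_le_tsum h ha

lemma norm_cf_le (n : ℕ) (f : Wiener) : ‖cf n f‖ ≤ ‖f‖ :=
  (summable_cf f).le_tsum n fun _ _ => norm_nonneg _

instance : CompleteSpace Wiener := by
  let F : Wiener → lp (fun _ : ℕ => ℝ) 1 := fun f =>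
    ⟨fun n => cf n f, memℓp_gen (by simpa using summable_cf f)⟩
  have hF : Isometry F := by
    refine Isometry.of_dist_eq fun f g => ?_
    rw [dist_eq_norm, dist_eq_norm, lp.norm_eq_tsum_rpow (by simp), norm_eq]
    simp only [F, ENNReal.toReal_one, Real.rpow_one, div_one, map_sub]
    rfl
  have hs : Function.Surjective F := by
    intro a
    have ha : Summable fun n => ‖a n‖ := by
      simpa using (lp.memℓp a).summable (by simp)
    exact ⟨ofCf a ha, by ext n; simp [F]⟩
  exact (IsometryEquiv.mk (Equiv.ofBijective F ⟨hF.injective, hs⟩) hF).completeSpace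

/-- The continuous linear coefficient functional. -/
def cfL (n : ℕ) : Wiener →L[ℝ] ℝ :=
  (cf n).mkContinuous 1 fun f => by simpa using norm_cf_le n f

@[simp] lemma cfL_apply (n : ℕ) (f : Wiener) : cfL n f = cf n f := rfl

/-- The continuous linear operator multiplying and permuting coefficients. -/
def cfOp (a : ℕ → ℝ) (σ : ℕ → ℕ) (C : ℝ) (ha : ∀ n, ‖a n‖ ≤ C) (hσ : Function.Injective σ) :
    Wiener →L[ℝ] Wiener :=
  have key : ∀ f : Wiener, Summable fun n => C * ‖cf (σ n) f‖ := fun f =>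
    ((summable_cf f).comp_injective hσ).mul_left C
  have bd : ∀ (f : Wiener) n, ‖a n * cf (σ n) f‖ ≤ C * ‖cf (σ n) f‖ := fun f n => by
    rw [norm_mul]; exact mul_le_mul_of_nonneg_right (ha n) (norm_nonneg _)
  LinearMap.mkContinuous
    { toFun := fun f => ofCf (fun n => a n * cf (σ n) f)
        ((key f).of_nonneg_of_le (fun _ => norm_nonneg _) (bd f))
      map_add' := fun f g => ext_cf fun n => by simp [mul_add]
      map_smul' := fun r f => ext_cf fun n => by simp; ring } C fun f => by
    have hC : 0 ≤ C := (norm_nonneg _).trans (ha 0)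
    refine (norm_le_of_cf_le (key f) fun n => ?_).trans ?_
    · simpa using bd f n
    · rw [tsum_mul_left]
      exact mul_le_mul_of_nonneg_left
        (tsum_comp_le_tsum_of_inj (summable_cf f) (fun _ => norm_nonneg _) hσ) hC

@[simp] lemma cf_cfOp (a : ℕ → ℝ) (σ : ℕ → ℕ) (C : ℝ) (ha hσ) (f : Wiener) (n : ℕ) :
    cf n (cfOp a σ C ha hσ f) = a n * cf (σ n) f := by
  simp [cfOp]

/-- The variable. -/
def U : Wiener := ofCf (fun n => if n = 1 then 1 else 0)
  (summable_of_ne_finset_zero (s := {1}) fun n hn => by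
    have : n ≠ 1 := by simpa using hn
    simp [this])

lemma toPS_U : toPS U = PowerSeries.X := by
  ext n
  rw [← cf_eq, U, cf_ofCf, PowerSeries.coeff_X]

lemma cf_U_pow (N n : ℕ) : cf n (U ^ N) = if n = N then 1 else 0 := by
  rw [cf_eq, map_pow, toPS_U, PowerSeries.coeff_X_pow]

lemma cf_U_pow_mul (N n : ℕ) (f : Wiener) : cf n (U ^ N * f) = if N ≤ n then cf (n - N) f else 0 := by
  rw [cf_eq, map_mul, map_pow, toPS_U, PowerSeries.coeff_X_pow_mul']
  rfl

lemma norm_U_pow (N : ℕ) : ‖U ^ N‖ = 1 := by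
  rw [norm_eq, tsum_eq_single N]
  · simp [cf_U_pow]
  · intro n hn; simp [cf_U_pow, hn]

lemma norm_U : ‖U‖ = 1 := by simpa using norm_U_pow 1

section Evaluation

variable {𝕜 : Type*} [RCLike 𝕜]

lemma summable_eval {u : 𝕜} (hu : ‖u‖ ≤ 1) (f : Wiener) :
    Summable fun n => ‖((cf n f : ℝ) : 𝕜) * u ^ n‖ := by
  refine (summable_cf f).of_nonneg_of_le (fun _ => norm_nonneg _) fun n => ?_
  rw [norm_mul, norm_pow, RCLike.norm_ofReal]
  exact mul_le_of_le_one_right (abs_nonneg _) (pow_le_one₀ (norm_nonneg _) hu)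

/-- Evaluation at a point of the closed unit disc (and zero elsewhere). -/
def eval (u : 𝕜) (f : Wiener) : 𝕜 := ∑' n, ((cf n f : ℝ) : 𝕜) * u ^ n

lemma hasSum_eval {u : 𝕜} (hu : ‖u‖ ≤ 1) (f : Wiener) :
    HasSum (fun n => ((cf n f : ℝ) : 𝕜) * u ^ n) (eval u f) :=
  (summable_eval hu f).of_norm.hasSum

lemma eval_mul {u : 𝕜} (hu : ‖u‖ ≤ 1) (f g : Wiener) :
    eval u (f * g) = eval u f * eval u g := by
  rw [eval, eval, eval, tsum_mul_tsum_eq_tsum_sum_antidiagonal_of_summable_norm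
    (summable_eval hu f) (summable_eval hu g)]
  refine tsum_congr fun n => ?_
  rw [cf_mul, RCLike.ofReal_sum, Finset.sum_mul]
  refine Finset.sum_congr rfl fun p hp => ?_
  rw [← Finset.HasAntidiagonal.mem_antidiagonal.1 hp, pow_add, RCLike.ofReal_mul]
  ring

lemma eval_add {u : 𝕜} (hu : ‖u‖ ≤ 1) (f g : Wiener) :
    eval u (f + g) = eval u f + eval u g := by
  rw [eval, eval, eval, ← (summable_eval hu f).of_norm.tsum_add (summable_eval hu g).of_norm]
  exact tsum_congr fun n => by rw [map_add, RCLike.ofReal_add, add_mul]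

lemma eval_U_pow_smul (u : 𝕜) (r : ℝ) (N : ℕ) : eval u (r • U ^ N) = (r : 𝕜) * u ^ N := by
  rw [eval, tsum_eq_single N]
  · simp [cf_U_pow]
  · intro n hn; simp [cf_U_pow, hn]

/-- Evaluation at a point of the closed unit disc, as an algebra homomorphism. -/
def evalHom (u : 𝕜) (hu : ‖u‖ ≤ 1) : Wiener →ₐ[ℝ] 𝕜 where
  toFun := eval u
  map_one' := by simpa using eval_U_pow_smul u 1 0
  map_mul' := eval_mul hu
  map_zero' := by simp [eval]
  map_add' := eval_add hu
  commutes' r := by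
    rw [Algebra.algebraMap_eq_smul_one, ← pow_zero U, eval_U_pow_smul, pow_zero, mul_one]

@[simp] lemma evalHom_apply (u : 𝕜) (hu : ‖u‖ ≤ 1) (f : Wiener) : evalHom u hu f = eval u f := rfl

lemma norm_eval_le {u : 𝕜} (hu : ‖u‖ ≤ 1) (f : Wiener) : ‖eval u f‖ ≤ ‖f‖ := by
  refine tsum_of_norm_bounded (summable_cf f).hasSum fun n => ?_
  rw [norm_mul, norm_pow, RCLike.norm_ofReal]
  exact mul_le_of_le_one_right (abs_nonneg _) (pow_le_one₀ (norm_nonneg _) hu)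

lemma eval_U (u : 𝕜) : eval u U = u := by simpa using eval_U_pow_smul u 1 1

lemma eval_ofReal (u : ℝ) (f : Wiener) : eval (u : 𝕜) f = ((eval u f : ℝ) : 𝕜) := by
  rw [eval, eval, RCLike.ofReal_tsum]
  exact tsum_congr fun n => by simp

end Evaluation

end Wiener

/-! ### Differentiation, analytic dependence of evaluation, and rescaling. -/

namespace Wiener

/-- `g` is the derivative of `f`. -/
def IsDeriv (f g : Wiener) : Prop := PowerSeries.derivative ℝ (toPS f) = toPS g

lemma isDeriv_iff {f g : Wiener} : IsDeriv f g ↔ ∀ n, cf n g = (n + 1) * cf (n + 1) f := by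
  rw [IsDeriv, PowerSeries.ext_iff]
  refine forall_congr' fun n => ?_
  rw [PowerSeries.coeff_derivative, ← cf_eq, ← cf_eq, mul_comm, eq_comm]

lemma IsDeriv.unique {f g g' : Wiener} (h : IsDeriv f g) (h' : IsDeriv f g') : g = g' :=
  toPS_injective (h.symm.trans h')

lemma IsDeriv.add {f f' g g' : Wiener} (hf : IsDeriv f f') (hg : IsDeriv g g') :
    IsDeriv (f + g) (f' + g') := by
  rw [IsDeriv] at *; rw [map_add, map_add, map_add, hf, hg]

lemma IsDeriv.smul {f f' : Wiener} (r : ℝ) (hf : IsDeriv f f') : IsDeriv (r • f) (r • f') := by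
  rw [isDeriv_iff] at *; intro n; rw [map_smul, map_smul, hf n, smul_eq_mul, smul_eq_mul]; ring

lemma IsDeriv.mul {f f' g g' : Wiener} (hf : IsDeriv f f') (hg : IsDeriv g g') :
    IsDeriv (f * g) (f * g' + g * f') := by
  rw [IsDeriv] at *
  rw [map_mul, Derivation.leibniz, hf, hg]
  simp only [smul_eq_mul, map_add, map_mul]

lemma IsDeriv.pow {f f' : Wiener} (hf : IsDeriv f f') (n : ℕ) :
    IsDeriv (f ^ n) ((n : ℝ) • (f ^ (n - 1) * f')) := by
  rw [IsDeriv] at *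
  rw [map_pow, Derivation.leibniz_pow, hf]
  simp only [smul_eq_mul, map_smul, map_mul, map_pow]
  rw [← Nat.cast_smul_eq_nsmul ℝ]

lemma isDeriv_U : IsDeriv U 1 := by
  rw [IsDeriv, toPS_U]; simp

lemma isDeriv_algebraMap (r : ℝ) : IsDeriv (algebraMap ℝ Wiener r) 0 := by
  rw [isDeriv_iff]
  intro n
  rw [Algebra.algebraMap_eq_smul_one]
  simp [cf_one]

lemma IsDeriv.sum {ι : Type*} (s : Finset ι) {f g : ι → Wiener} (h : ∀ i ∈ s, IsDeriv (f i) (g i)) :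
    IsDeriv (∑ i ∈ s, f i) (∑ i ∈ s, g i) := by
  rw [IsDeriv, map_sum, map_sum, map_sum]
  exact Finset.sum_congr rfl h

/-- The derivative of an inverse. -/
lemma IsDeriv.of_mul_eq_one {f f' g : Wiener} (hf : IsDeriv f f') (h : f * g = 1) :
    IsDeriv g (-(g ^ 2 * f')) := by
  have h1 : toPS f * toPS g = 1 := by rw [← map_mul, h, map_one]
  have h2 := congrArg (PowerSeries.derivative ℝ) h1
  rw [Derivation.leibniz, hf, Derivation.map_one_eq_zero] at h2
  simp only [smul_eq_mul] at h2
  rw [IsDeriv]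
  simp only [map_neg, map_mul, map_pow]
  linear_combination (toPS g) * h2 - PowerSeries.derivative ℝ (toPS g) * h1

section Eval

variable {𝕜 : Type*} [RCLike 𝕜]

/-- Summability of the coefficients of `g` is summability of `n |a_n|`, which dominates the termwise
derivatives uniformly on the unit disc. -/
lemma hasDerivAt_eval {f g : Wiener} (h : IsDeriv f g) {u : 𝕜} (hu : ‖u‖ < 1) :
    HasDerivAt (fun u : 𝕜 => eval u f) (eval u g) u := by
  have hS : Summable fun n : ℕ => (n : ℝ) * ‖cf n f‖ := by
    rw [← summable_nat_add_iff 1]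
    refine (summable_cf g).congr fun n => ?_
    rw [isDeriv_iff.1 h n, norm_mul]
    congr 1
    push_cast
    rw [Real.norm_of_nonneg (by positivity)]
  have hd : ∀ (n : ℕ) (y : 𝕜), y ∈ Metric.ball (0 : 𝕜) 1 →
      HasDerivAt (fun z : 𝕜 => ((cf n f : ℝ) : 𝕜) * z ^ n)
        (((cf n f : ℝ) : 𝕜) * (n * y ^ (n - 1))) y :=
    fun n z _ => (hasDerivAt_pow n z).const_mul _
  have hb : ∀ (n : ℕ) (y : 𝕜), y ∈ Metric.ball (0 : 𝕜) 1 →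
      ‖((cf n f : ℝ) : 𝕜) * (n * y ^ (n - 1))‖ ≤ (n : ℝ) * ‖cf n f‖ := fun n z hz => by
    rw [norm_mul, norm_mul, RCLike.norm_ofReal, RCLike.norm_natCast, norm_pow]
    have hz' : ‖z‖ ≤ 1 := by simpa using (Metric.mem_ball.1 hz).le
    have h1 : ‖z‖ ^ (n - 1) ≤ 1 := pow_le_one₀ (norm_nonneg _) hz'
    have h2 : |cf n f| * (n * ‖z‖ ^ (n - 1)) ≤ |cf n f| * (n * 1) := by gcongr
    rw [Real.norm_eq_abs]; linarith
  have h0 : Summable fun n : ℕ => ((cf n f : ℝ) : 𝕜) * 0 ^ n :=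
    (summable_eval (u := (0 : 𝕜)) (by simp) f).of_norm
  have hu' : u ∈ Metric.ball (0 : 𝕜) 1 := by simpa using hu
  have hpc : IsPreconnected (Metric.ball (0 : 𝕜) 1) := (convex_ball (0 : 𝕜) 1).isPreconnected
  have key := hasDerivAt_tsum_of_isPreconnected (𝕜 := 𝕜) (F := 𝕜)
    (g := fun n (z : 𝕜) => ((cf n f : ℝ) : 𝕜) * z ^ n)
    (g' := fun n (y : 𝕜) => ((cf n f : ℝ) : 𝕜) * (n * y ^ (n - 1))) hS Metric.isOpen_ball
    hpc hd hb (Metric.mem_ball_self one_pos) h0 hu'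
  have e : (∑' n : ℕ, ((cf n f : ℝ) : 𝕜) * (n * u ^ (n - 1))) = eval u g := by
    have e1 : ∀ n : ℕ, ((cf (n + 1) f : ℝ) : 𝕜) * ((n + 1 : ℕ) * u ^ (n + 1 - 1)) =
        ((cf n g : ℝ) : 𝕜) * u ^ n := fun n => by
      rw [isDeriv_iff.1 h n, Nat.add_sub_cancel]
      push_cast; ring
    have h1 : Summable fun n : ℕ => ((cf n f : ℝ) : 𝕜) * (n * u ^ (n - 1)) := by
      rw [← summable_nat_add_iff 1]
      exact (summable_eval hu.le g).of_norm.congr fun n => (e1 n).symm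
    rw [h1.tsum_eq_zero_add, eval]
    simp only [Nat.cast_zero, zero_mul, mul_zero, zero_add]
    exact tsum_congr e1
  rw [← e]
  exact key

/-- Evaluation as a power series with values in the dual space. -/
def evalSeries : FormalMultilinearSeries ℝ ℝ (Wiener →L[ℝ] ℝ) := fun n =>
  ContinuousMultilinearMap.mkPiRing ℝ (Fin n) (cfL n)

lemma norm_cfL_le (n : ℕ) : ‖cfL n‖ ≤ 1 := LinearMap.mkContinuous_norm_le _ zero_le_one _

/-- Evaluation at a point as an element of the dual space. -/
def evalL (u : ℝ) : Wiener →L[ℝ] ℝ := ∑' n, u ^ n • cfL n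

lemma hasSum_evalL {u : ℝ} (hu : ‖u‖ < 1) : HasSum (fun n => u ^ n • cfL n) (evalL u) := by
  refine Summable.hasSum (Summable.of_norm ?_)
  refine (summable_geometric_of_lt_one (norm_nonneg u) hu).of_nonneg_of_le
    (fun _ => norm_nonneg _) fun n => ?_
  rw [norm_smul, norm_pow]
  exact mul_le_of_le_one_right (by positivity) (norm_cfL_le n)

lemma evalL_apply {u : ℝ} (hu : ‖u‖ < 1) (f : Wiener) : evalL u f = eval u f := by
  have h := (hasSum_evalL hu).mapL (ContinuousLinearMap.apply ℝ ℝ f)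
  have h2 := hasSum_eval hu.le f
  refine h.unique ?_
  simpa [mul_comm] using h2

/-- The coefficient functionals have norm at most one, so the series is dominated by a geometric one
in the dual space. Analyticity in operator norm is what makes evaluation analytic jointly in the
point and the function. -/
lemma hasFPowerSeriesOnBall_evalL : HasFPowerSeriesOnBall evalL evalSeries 0 1 where
  r_le := by
    have hb : ∀ n, ‖evalSeries n‖ * ((1 : NNReal) : ℝ) ^ n ≤ 1 := fun n => by
      rw [evalSeries, ContinuousMultilinearMap.norm_mkPiRing, NNReal.coe_one, one_pow, mul_one]
      exact norm_cfL_le n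
    simpa using FormalMultilinearSeries.le_radius_of_bound evalSeries 1 hb
  r_pos := zero_lt_one
  hasSum {y} hy := by
    have hy' : ‖y‖ < 1 := by
      rw [Metric.mem_eball, edist_zero_right, enorm_eq_nnnorm] at hy
      exact_mod_cast hy
    simpa [evalSeries] using hasSum_evalL hy'

lemma analyticAt_evalL {u : ℝ} (hu : ‖u‖ < 1) : AnalyticAt ℝ evalL u :=
  hasFPowerSeriesOnBall_evalL.analyticAt_of_mem (by
    rw [Metric.mem_eball, edist_zero_right, enorm_eq_nnnorm]; exact_mod_cast hu)

/-- Evaluation is jointly analytic. -/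
lemma _root_.AnalyticAt.wienerEval {E : Type*} [NormedAddCommGroup E] [NormedSpace ℝ E]
    {f : E → Wiener} {u : E → ℝ} {x : E} (hf : AnalyticAt ℝ f x) (hu : AnalyticAt ℝ u x)
    (hx : ‖u x‖ < 1) : AnalyticAt ℝ (fun y => eval (u y) (f y)) x := by
  have h1 : AnalyticAt ℝ (fun y => evalL (u y)) x := (analyticAt_evalL hx).comp hu
  have h2 : AnalyticAt ℝ (fun y => evalL (u y) (f y)) x :=
    AnalyticAt.fun_comp (g := fun q : (Wiener →L[ℝ] ℝ) × Wiener => q.1 q.2)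
      (f := fun y => (evalL (u y), f y)) (x := x)
      ((ContinuousLinearMap.id ℝ (Wiener →L[ℝ] ℝ)).analyticAt_bilinear (evalL (u x), f x))
      (h1.prod hf)
  refine h2.congr ?_
  filter_upwards [hu.continuousAt.norm.eventually_lt_const hx] with y hy
  simp [evalL_apply hy]

/-- The one variable power series with the coefficients of an element. -/
def series (f : Wiener) : FormalMultilinearSeries ℝ ℝ ℝ := fun n =>
  ContinuousMultilinearMap.mkPiRing ℝ (Fin n) (cf n f)

lemma coeff_series (f : Wiener) (n : ℕ) : (series f).coeff n = cf n f := by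
  simp [FormalMultilinearSeries.coeff, series]

lemma hasFPowerSeriesAt_eval (f : Wiener) :
    HasFPowerSeriesAt (fun u : ℝ => eval u f) (series f) 0 := by
  rw [hasFPowerSeriesAt_iff]
  filter_upwards [Metric.ball_mem_nhds (0 : ℝ) one_pos] with z hz
  have hz' : ‖z‖ ≤ 1 := by simpa using (Metric.mem_ball.1 hz).le
  have h2 := hasSum_eval hz' f
  simpa [coeff_series, mul_comm] using h2

lemma eq_of_eventually_eval_eq {f g : Wiener} (h : ∀ᶠ u : ℝ in 𝓝 0, eval u f = eval u g) : f = g := by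
  have h1 := ((hasFPowerSeriesAt_eval f).congr h).eq_formalMultilinearSeries
    (hasFPowerSeriesAt_eval g)
  exact ext_cf fun n => by rw [← coeff_series, ← coeff_series, h1]

end Eval

/-- The substitution `u ↦ δ u`. -/
def scale (δ : ℝ) (hδ : |δ| ≤ 1) : Wiener →L[ℝ] Wiener :=
  cfOp (fun n => δ ^ n) id 1 (fun n => by
    rw [norm_pow]; exact pow_le_one₀ (norm_nonneg _) hδ) Function.injective_id

lemma cf_scale (δ : ℝ) (hδ : |δ| ≤ 1) (f : Wiener) (n : ℕ) : cf n (scale δ hδ f) = δ ^ n * cf n f := by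
  simp [scale]

lemma eval_scale {𝕜 : Type*} [RCLike 𝕜] (δ : ℝ) (hδ : |δ| ≤ 1) (f : Wiener) (u : 𝕜) :
    eval u (scale δ hδ f) = eval (δ * u) f := by
  rw [eval, eval]
  refine tsum_congr fun n => ?_
  rw [cf_scale, mul_pow]; push_cast; ring

lemma IsDeriv.scale {f g : Wiener} (h : IsDeriv f g) (δ : ℝ) (hδ : |δ| ≤ 1) :
    IsDeriv (scale δ hδ f) (δ • scale δ hδ g) := by
  rw [isDeriv_iff] at *
  intro n
  rw [map_smul, cf_scale, cf_scale, h n, smul_eq_mul]; ring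

/-- After division by `δ^N` every term of degree above `N` keeps a factor `δ`: zooming in at the
origin leaves only the leading monomial. -/
lemma norm_scale_sub_le {N : ℕ} {f : Wiener} (h : ∀ n < N, cf n f = 0) {δ : ℝ} (hδ0 : 0 < δ)
    (hδ : |δ| ≤ 1) : ‖(δ ^ N)⁻¹ • scale δ hδ f - cf N f • U ^ N‖ ≤ δ * ‖f‖ := by
  rw [norm_eq f, ← tsum_mul_left]
  refine norm_le_of_cf_le ((summable_cf f).mul_left δ) fun n => ?_
  rw [map_sub, map_smul, map_smul, cf_scale, cf_U_pow, smul_eq_mul, smul_eq_mul]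
  have hδ1 : δ ≤ 1 := (le_abs_self δ).trans hδ
  rcases lt_trichotomy n N with hn | rfl | hn
  · simp [h n hn, hn.ne]
  · have : (δ ^ n)⁻¹ * (δ ^ n * cf n f) - cf n f * (if n = n then 1 else 0) = 0 := by
      rw [inv_mul_cancel_left₀ (pow_ne_zero _ hδ0.ne')]; simp
    rw [this, norm_zero]; positivity
  · obtain ⟨j, rfl⟩ := Nat.exists_eq_add_of_lt hn
    rw [if_neg hn.ne', mul_zero, sub_zero, norm_mul, norm_mul, ← mul_assoc, ← norm_mul]
    have e : (δ ^ N)⁻¹ * δ ^ (N + j + 1) = δ * δ ^ j := by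
      rw [show N + j + 1 = N + (j + 1) by ring, pow_add,
        inv_mul_cancel_left₀ (pow_ne_zero _ hδ0.ne'), pow_succ']
    rw [e, norm_mul, Real.norm_of_nonneg hδ0.le, Real.norm_of_nonneg (by positivity : 0 ≤ δ ^ j)]
    gcongr
    exact mul_le_of_le_one_right hδ0.le (pow_le_one₀ hδ0.le hδ1)

end Wiener

/-! ### Power series in several variables with arguments in a Banach algebra. -/

section Lift

variable {ι : Type} [Fintype ι]

/-- The coefficients of a real power series in several variables on the coordinate vectors. -/
def basisCoeff [DecidableEq ι] (p : FormalMultilinearSeries ℝ (ι → ℝ) ℝ) (n : ℕ) (σ : Fin n → ι) : ℝ :=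
  p n fun i => Pi.single (σ i) 1

variable [DecidableEq ι] (p : FormalMultilinearSeries ℝ (ι → ℝ) ℝ)

lemma abs_basisCoeff_le (n : ℕ) (σ : Fin n → ι) : |basisCoeff p n σ| ≤ ‖p n‖ := by
  refine ((p n).le_opNorm _).trans ?_
  refine mul_le_of_le_one_right (norm_nonneg _) (Finset.prod_le_one (fun _ _ => norm_nonneg _) ?_)
  intro i _
  rw [Pi.norm_single]; simp

variable (𝕜 : Type) [NontriviallyNormedField 𝕜] (B : Type) [NormedCommRing B] [NormedAlgebra ℝ B]
  [NormedAlgebra 𝕜 B]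

/-- The base change of a real power series in several variables to a Banach algebra. -/
def liftSeries : FormalMultilinearSeries 𝕜 (ι → B) B := fun n =>
  ∑ σ : Fin n → ι, algebraMap ℝ B (basisCoeff p n σ) •
    (ContinuousMultilinearMap.mkPiAlgebra 𝕜 (Fin n) B).compContinuousLinearMap
      fun i => ContinuousLinearMap.proj (R := 𝕜) (φ := fun _ : ι => B) (σ i)

variable {B} in
/-- The `n`-th homogeneous term of the base change. -/
def liftTerm (n : ℕ) (v : ι → B) : B :=
  ∑ σ : Fin n → ι, algebraMap ℝ B (basisCoeff p n σ) * ∏ i, v (σ i)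

variable {B} in
/-- The sum of the base change of a real power series. -/
def liftSum (v : ι → B) : B := ∑' n, liftTerm p n v

lemma liftSeries_apply (n : ℕ) (v : Fin n → ι → B) : liftSeries p 𝕜 B n v =
    ∑ σ : Fin n → ι, algebraMap ℝ B (basisCoeff p n σ) * ∏ i, v i (σ i) := by
  simp [liftSeries]

variable [NormOneClass B]

/-- There are `(card ι)^n` words `σ`, and each coefficient is at most `‖p n‖` because the coordinate
vectors have norm one. -/
lemma norm_liftSeries_le (n : ℕ) : ‖liftSeries p 𝕜 B n‖ ≤ (Fintype.card ι : ℝ) ^ n * ‖p n‖ := by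
  refine ContinuousMultilinearMap.opNorm_le_bound (by positivity) fun v => ?_
  rw [liftSeries_apply]
  refine (norm_sum_le _ _).trans ?_
  have : ∀ σ ∈ (Finset.univ : Finset (Fin n → ι)),
      ‖algebraMap ℝ B (basisCoeff p n σ) * ∏ i, v i (σ i)‖ ≤ ‖p n‖ * ∏ i, ‖v i‖ := fun σ _ => by
    refine (norm_mul_le _ _).trans ?_
    rw [norm_algebraMap']
    refine mul_le_mul (abs_basisCoeff_le p n σ) ?_ (norm_nonneg _) (norm_nonneg _)
    exact (Finset.norm_prod_le _ _).trans (Finset.prod_le_prod (fun _ _ => norm_nonneg _)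
      fun i _ => norm_le_pi_norm (v i) (σ i))
  refine (Finset.sum_le_card_nsmul _ _ _ this).trans (le_of_eq ?_)
  simp [Finset.card_univ, mul_assoc]

variable {p} {C : ℝ} {R : NNReal}

lemma hasFPowerSeriesOnBall_liftSum [CompleteSpace B] (hR : 0 < R)
    (h : ∀ n, (Fintype.card ι : ℝ) ^ n * ‖p n‖ * (R : ℝ) ^ n ≤ C) :
    HasFPowerSeriesOnBall (liftSum p : (ι → B) → B) (liftSeries p 𝕜 B) 0 R := by
  have hr : (R : ENNReal) ≤ (liftSeries p 𝕜 B).radius :=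
    FormalMultilinearSeries.le_radius_of_bound _ C fun n =>
      (mul_le_mul_of_nonneg_right (norm_liftSeries_le p 𝕜 B n) (by positivity)).trans (h n)
  have h0 := (liftSeries p 𝕜 B).hasFPowerSeriesOnBall (lt_of_lt_of_le (by exact_mod_cast hR) hr)
  have h1 := h0.mono (by exact_mod_cast hR) hr
  have e : (liftSeries p 𝕜 B).sum = liftSum p := by
    ext v
    rw [FormalMultilinearSeries.sum, liftSum]
    exact tsum_congr fun n => liftSeries_apply p 𝕜 B n _
  rwa [e] at h1

variable {B}

lemma hasSum_liftTerm [CompleteSpace B] (hR : 0 < R)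
    (h : ∀ n, (Fintype.card ι : ℝ) ^ n * ‖p n‖ * (R : ℝ) ^ n ≤ C) {v : ι → B} (hv : ‖v‖ < R) :
    HasSum (fun n => liftTerm p n v) (liftSum p v) := by
  have := (hasFPowerSeriesOnBall_liftSum ℝ B hR h).hasSum (y := v) (by
    rw [Metric.mem_eball, edist_zero_right, enorm_eq_nnnorm]; exact_mod_cast hv)
  simp only [zero_add, liftSeries_apply] at this
  exact this

lemma analyticAt_liftSum [CompleteSpace B] (hR : 0 < R)
    (h : ∀ n, (Fintype.card ι : ℝ) ^ n * ‖p n‖ * (R : ℝ) ^ n ≤ C) {v : ι → B} (hv : ‖v‖ < R) :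
    AnalyticAt 𝕜 (liftSum p : (ι → B) → B) v :=
  (hasFPowerSeriesOnBall_liftSum 𝕜 B hR h).analyticAt_of_mem (by
    rw [Metric.mem_eball, edist_zero_right, enorm_eq_nnnorm]; exact_mod_cast hv)

/-- Continuous algebra homomorphisms commute with convergent power series. Applied to evaluation at
a point and to `ℝ → ℂ`, this identifies the values of the expansion and of the complexification. -/
lemma map_liftSum [CompleteSpace B] {B' : Type} [NormedCommRing B'] [NormedAlgebra ℝ B'] (hR : 0 < R)
    (h : ∀ n, (Fintype.card ι : ℝ) ^ n * ‖p n‖ * (R : ℝ) ^ n ≤ C) {v : ι → B} (hv : ‖v‖ < R)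
    (χ : B →ₐ[ℝ] B') (hχ : Continuous χ) : χ (liftSum p v) = liftSum p fun i => χ (v i) := by
  have h1 := (hasSum_liftTerm hR h hv).map χ hχ
  rw [← h1.tsum_eq, liftSum]
  refine tsum_congr fun n => ?_
  simp only [liftTerm, Function.comp, map_sum, map_mul, map_prod, AlgHom.commutes]

lemma liftSum_real (v : ι → ℝ) : liftSum p v = p.sum v := by
  rw [liftSum, FormalMultilinearSeries.sum]
  refine tsum_congr fun n => ?_
  have hv : v = ∑ j, v j • (Pi.single j 1 : ι → ℝ) := by
    ext i; simp [Finset.sum_apply, Pi.single_apply]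
  conv_rhs => rw [hv]
  rw [ContinuousMultilinearMap.map_sum, liftTerm]
  refine Finset.sum_congr rfl fun σ _ => ?_
  rw [ContinuousMultilinearMap.map_smul_univ, smul_eq_mul, mul_comm]
  rfl

end Lift

/-! ### Expansion of an analytic family in its first variable. -/

section Expansion

open Wiener

variable {m : ℕ}

/-- Reassembling the coordinates. -/
def joinL (𝕜 B : Type) [NontriviallyNormedField 𝕜] [NormedCommRing B] [NormedAlgebra 𝕜 B] (m : ℕ) :
    (B × (Fin m → B)) →L[𝕜] (Option (Fin m) → B) :=
  ContinuousLinearMap.pi fun o => o.elim (ContinuousLinearMap.fst 𝕜 B (Fin m → B))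
    fun i => (ContinuousLinearMap.proj i).comp (ContinuousLinearMap.snd 𝕜 B (Fin m → B))

@[simp] lemma joinL_none (𝕜 B : Type) [NontriviallyNormedField 𝕜] [NormedCommRing B]
    [NormedAlgebra 𝕜 B] (q : B × (Fin m → B)) : joinL 𝕜 B m q none = q.1 := rfl

@[simp] lemma joinL_some (𝕜 B : Type) [NontriviallyNormedField 𝕜] [NormedCommRing B]
    [NormedAlgebra 𝕜 B] (q : B × (Fin m → B)) (i : Fin m) : joinL 𝕜 B m q (some i) = q.2 i := rfl

lemma norm_joinL_le (𝕜 B : Type) [NontriviallyNormedField 𝕜] [NormedCommRing B]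
    [NormedAlgebra 𝕜 B] (q : B × (Fin m → B)) : ‖joinL 𝕜 B m q‖ ≤ ‖q‖ := by
  rw [pi_norm_le_iff_of_nonneg (norm_nonneg _)]
  rintro (_ | i)
  · exact norm_fst_le q
  · exact (norm_le_pi_norm q.2 i).trans (norm_snd_le q)

/-- A real analytic germ has a complexification, and its expansion in the first variable is an
analytic map with values in the Banach algebra `Wiener`. -/
theorem exists_expansion {f : ℝ × (Fin m → ℝ) → ℝ} (hf : AnalyticAt ℝ f 0) :
    ∃ F : ℂ × (Fin m → ℂ) → ℂ, IsComplexification F f ∧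
      ∃ e : ℝ, 0 < e ∧ ∃ Φ : (Fin m → ℝ) → Wiener, AnalyticAt ℝ Φ 0 ∧
        ∀ᶠ l in 𝓝 0, (∀ u : ℂ, ‖u‖ ≤ 1 → F (e * u, fun i => (l i : ℂ)) = eval u (Φ l)) ∧
          ∀ u : ℝ, ‖u‖ ≤ 1 → f (e * u, l) = eval u (Φ l) := by
  let split : (Option (Fin m) → ℝ) →L[ℝ] ℝ × (Fin m → ℝ) :=
    (ContinuousLinearMap.proj none).prod (ContinuousLinearMap.pi fun i =>
      ContinuousLinearMap.proj (some i))
  have hsj : ∀ q, split (joinL ℝ ℝ m q) = q := fun q => rfl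
  have hg : AnalyticAt ℝ (fun v => f (split v)) 0 :=
    AnalyticAt.fun_comp (g := f) (by simpa using hf) (split.analyticAt 0)
  obtain ⟨p, ρ, hp⟩ := hg
  obtain ⟨r, hr0, hrρ⟩ := ENNReal.lt_iff_exists_nnreal_btwn.1 hp.r_pos
  have hr0' : 0 < r := by exact_mod_cast hr0
  obtain ⟨C, hC0, hC⟩ := p.norm_mul_pow_le_of_lt_radius (hrρ.trans_le hp.r_le)
  obtain ⟨N, hN⟩ : ∃ N : NNReal, N = (Fintype.card (Option (Fin m)) : ℕ) := ⟨_, rfl⟩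
  have hN1 : 1 ≤ N := by simp [hN]
  have hN0 : 0 < N := lt_of_lt_of_le one_pos hN1
  -- Dividing by the number `N` of variables absorbs the factor `N^n` of `norm_liftSeries_le`.
  obtain ⟨R, hRdef⟩ : ∃ R : NNReal, R = r / N := ⟨_, rfl⟩
  have hR : 0 < R := hRdef ▸ div_pos hr0' hN0
  have hRr : R ≤ r := hRdef ▸ div_le_self (zero_le) hN1
  have h : ∀ n, (Fintype.card (Option (Fin m)) : ℝ) ^ n * ‖p n‖ * (R : ℝ) ^ n ≤ C := fun n => by
    refine le_trans (le_of_eq ?_) (hC n)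
    have : (N : ℝ) ≠ 0 := by exact_mod_cast hN0.ne'
    have e : (R : ℝ) = r / N := by simp [hRdef]
    have e2 : (Fintype.card (Option (Fin m)) : ℝ) = N := by simp [hN]
    rw [e, e2, div_pow]; field_simp
  have hval : ∀ v : Option (Fin m) → ℝ, ‖v‖ < R → liftSum p v = f (split v) := fun v hv => by
    rw [liftSum_real]
    have := hp.sum (y := v) (by
      rw [Metric.mem_eball, edist_zero_right, enorm_eq_nnnorm]
      refine lt_trans ?_ hrρ
      have : ‖v‖ < r := hv.trans_le (by exact_mod_cast hRr)
      exact_mod_cast this)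
    rw [← this, zero_add]
  have hRR : (0 : ℝ) < R := by exact_mod_cast hR
  -- The same series is summed twice: over `ℂ` for the complexification, and over `Wiener` at the
  -- point `((R/2) U, λ)` for the expansion. Evaluating `U` at `u` replaces the first argument by
  -- `(R/2) u`, whence the radius `R/2`.
  refine ⟨fun q => liftSum p (joinL ℂ ℂ m q), ⟨?_, ?_⟩, (R : ℝ) / 2, by positivity,
    fun l => liftSum p (joinL ℝ Wiener m (((R : ℝ) / 2) • U, fun i => algebraMap ℝ Wiener (l i))),
    ?_, ?_⟩
  · refine AnalyticAt.fun_comp (g := liftSum p) ?_ ((joinL ℂ ℂ m).analyticAt 0)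
    exact analyticAt_liftSum ℂ hR h (by simpa using hRR)
  · have hev : ∀ᶠ q : ℝ × (Fin m → ℝ) in 𝓝 0, ‖q‖ < R :=
      (continuous_norm.tendsto' _ _ norm_zero).eventually_lt_const hRR
    filter_upwards [hev] with q hq
    have hv : ‖joinL ℝ ℝ m q‖ < R := (norm_joinL_le ℝ ℝ q).trans_lt hq
    have := map_liftSum hR h hv (Algebra.ofId ℝ ℂ) Complex.continuous_ofReal
    rw [hval _ hv, hsj] at this
    refine Eq.trans ?_ this.symm
    congr 1
    funext o; cases o <;> rfl
  · refine AnalyticAt.fun_comp (g := liftSum p) ?_ ?_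
    · refine analyticAt_liftSum ℝ hR h ((norm_joinL_le ℝ Wiener _).trans_lt ?_)
      rw [Prod.norm_def, max_lt_iff]
      constructor
      · rw [norm_smul, norm_U, Real.norm_of_nonneg (by positivity)]; simp [hRR]
      · simpa [← Pi.zero_def] using hRR
    · refine AnalyticAt.fun_comp (g := joinL ℝ Wiener m) ((joinL ℝ Wiener m).analyticAt _) ?_
      refine analyticAt_const.prod ?_
      rw [analyticAt_pi_iff]
      intro i
      exact ((Algebra.linearMap ℝ Wiener).toContinuousLinearMap.comp
        (ContinuousLinearMap.proj (R := ℝ) (φ := fun _ : Fin m => ℝ) i)).analyticAt 0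
  · have hev : ∀ᶠ q : Fin m → ℝ in 𝓝 0, ‖q‖ < R :=
      (continuous_norm.tendsto' _ _ norm_zero).eventually_lt_const hRR
    filter_upwards [hev] with l hl
    have hW : ‖joinL ℝ Wiener m (((R : ℝ) / 2) • U, fun i => algebraMap ℝ Wiener (l i))‖ < R := by
      refine (norm_joinL_le ℝ Wiener _).trans_lt ?_
      rw [Prod.norm_def, max_lt_iff]
      constructor
      · rw [norm_smul, norm_U, Real.norm_of_nonneg (by positivity)]; simp [hRR]
      · rw [pi_norm_lt_iff hRR] at hl ⊢
        intro i
        rw [norm_algebraMap']; exact hl i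
    constructor
    · intro u hu
      have := map_liftSum hR h hW (evalHom u hu)
        (AddMonoidHomClass.continuous_of_bound (evalHom u hu) 1 fun f => by
          simpa using norm_eval_le hu f)
      rw [evalHom_apply] at this
      rw [this]
      congr 1
      funext o
      cases o
      · simp [eval_U]
      · simp
    · intro u hu
      have := map_liftSum hR h hW (evalHom u hu)
        (AddMonoidHomClass.continuous_of_bound (evalHom u hu) 1 fun f => by
          simpa using norm_eval_le hu f)
      rw [evalHom_apply] at this
      have hv : ‖joinL ℝ ℝ m ((R : ℝ) / 2 * u, l)‖ < R := by
        refine (norm_joinL_le ℝ ℝ _).trans_lt ?_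
        rw [Prod.norm_def, max_lt_iff]
        refine ⟨?_, hl⟩
        rw [norm_mul, Real.norm_of_nonneg (by positivity)]
        nlinarith
      rw [this, ← hsj ((R : ℝ) / 2 * u, l), ← hval _ hv]
      congr 1
      funext o
      cases o
      · simp [eval_U]
      · simp

end Expansion

open Wiener

/-! ### The conjugacy equation and its linearisation. -/

section Equation

variable (k : ℕ) (c : ℝ)

/-- The right inverse of `ξ ↦ (k+1) u^k ξ - u^{k+1} ξ'` with values in the series without
`u^{k+1}`-term. -/
def xi : Wiener →L[ℝ] Wiener :=
  cfOp (fun i => if i = k + 1 then 0 else 1 / ((k : ℝ) + 1 - i)) (fun i => k + i) 1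
    (fun i => by
      split_ifs with h
      · simp
      · rw [norm_div, norm_one, div_le_one]
        · have : ((k : ℤ) + 1 - i) ≠ 0 := by omega
          have h1 : (1 : ℤ) ≤ |(k : ℤ) + 1 - i| := Int.one_le_abs this
          rw [Real.norm_eq_abs]
          exact_mod_cast h1
        · rw [norm_pos_iff, sub_ne_zero]
          exact_mod_cast Ne.symm h)
    (add_right_injective k)

/-- The derivative of `xi`. -/
def dxi : Wiener →L[ℝ] Wiener :=
  cfOp (fun i => if i = k then 0 else ((i : ℝ) + 1) / ((k : ℝ) - i)) (fun i => k + 1 + i) (k + 2)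
    (fun i => by
      split_ifs with h
      · simp; positivity
      -- The factor `i+1` from differentiation is at most `|k-i| + k+1`, hence at most `(k+2)
      -- |k-i|`. This is why no derivative is lost.
      · have h0 : (k : ℤ) - i ≠ 0 := by omega
        have h1 : (1 : ℤ) ≤ |(k : ℤ) - i| := Int.one_le_abs h0
        have h1' : (1 : ℝ) ≤ |(k : ℝ) - i| := by exact_mod_cast h1
        have h2 : (i : ℝ) - k ≤ |(k : ℝ) - i| := by
          rw [abs_sub_comm]; exact le_abs_self _
        rw [norm_div, Real.norm_of_nonneg (by positivity), Real.norm_eq_abs,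
          div_le_iff₀ (by linarith)]
        have h3 : (0 : ℝ) ≤ k := by positivity
        nlinarith)
    (add_right_injective (k + 1))

lemma cf_xi (w : Wiener) (i : ℕ) :
    cf i (xi k w) = (if i = k + 1 then 0 else 1 / ((k : ℝ) + 1 - i)) * cf (k + i) w := by
  simp [xi]

lemma cf_dxi (w : Wiener) (i : ℕ) :
    cf i (dxi k w) = (if i = k then 0 else ((i : ℝ) + 1) / ((k : ℝ) - i)) * cf (k + 1 + i) w := by
  simp [dxi]

lemma isDeriv_xi (w : Wiener) : IsDeriv (xi k w) (dxi k w) := by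
  rw [isDeriv_iff]
  intro n
  rw [cf_xi, cf_dxi, show k + 1 + n = k + (n + 1) by ring]
  by_cases h : n = k
  · simp [h]
  · rw [if_neg h, if_neg (by omega)]
    push_cast
    rw [show (k : ℝ) + 1 - (n + 1) = k - n by ring]
    ring

/-- The coordinate change of the slice. -/
def phi (τ : ℝ) (w : Wiener) : Wiener := U + xi k w + τ • U ^ (k + 1)

/-- The derivative of `phi`. -/
def dphi (τ : ℝ) (w : Wiener) : Wiener := 1 + dxi k w + (((k : ℝ) + 1) * τ) • U ^ k

lemma isDeriv_phi (τ : ℝ) (w : Wiener) : IsDeriv (phi k τ w) (dphi k τ w) := by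
  have h := (isDeriv_U.add (isDeriv_xi k w)).add ((isDeriv_U.pow (k + 1)).smul τ)
  rw [phi, dphi]
  convert h using 2
  rw [smul_smul, mul_one, Nat.add_sub_cancel]
  push_cast
  rw [mul_comm]

/-- The lower coefficients of the numerator. -/
def lowCf (w : Wiener) : Fin k → ℝ := fun j => cf j w

/-- The residue parameter. -/
def resCf (w : Wiener) : ℝ := -c * cf (2 * k + 1) w

variable {k}

/-- The polynomial `x^{k+1} + y_{k-1} x^{k-1} + … + y_0` on the Banach algebra. -/
def pol (y : Fin k → ℝ) (x : Wiener) : Wiener := x ^ (k + 1) + ∑ j : Fin k, y j • x ^ (j : ℕ)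

variable (k) in
/-- The denominator `c + μ x^k` on the Banach algebra. -/
def den (μ : ℝ) (x : Wiener) : Wiener := algebraMap ℝ Wiener c + μ • x ^ k

/-- The derivative of the polynomial. -/
def dpol (y : Fin k → ℝ) (x : Wiener) : Wiener :=
  (((k + 1 : ℕ) : ℝ)) • x ^ k + ∑ j : Fin k, y j • (((j : ℕ) : ℝ) • x ^ ((j : ℕ) - 1))

variable (k) in
/-- The derivative of the denominator. -/
def dden (μ : ℝ) (x : Wiener) : Wiener := μ • ((k : ℝ) • x ^ (k - 1))

/-- The defect of the conjugacy equation, multiplied by the denominator. -/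
def defect (φ φ' : Wiener) (y : Fin k → ℝ) (μ : ℝ) (h : Wiener) : Wiener :=
  pol y φ - φ' * h * den k c μ φ

lemma isDeriv_pol {f f' : Wiener} (hf : IsDeriv f f') (y : Fin k → ℝ) :
    IsDeriv (pol y f) (dpol y f * f') := by
  have h := (hf.pow (k + 1)).add (IsDeriv.sum Finset.univ
    (f := fun j : Fin k => y j • f ^ (j : ℕ)) fun j _ => (hf.pow j).smul (y j))
  rw [pol, dpol]
  convert h using 1
  rw [add_mul, Finset.sum_mul, Nat.add_sub_cancel]
  simp only [smul_mul_assoc]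

lemma isDeriv_den {f f' : Wiener} (hf : IsDeriv f f') (μ : ℝ) :
    IsDeriv (den k c μ f) (dden k μ f * f') := by
  have h := (isDeriv_algebraMap c).add ((hf.pow k).smul μ)
  rw [den, dden]
  convert h using 1
  rw [zero_add]
  simp only [smul_mul_assoc]

lemma hasDerivAt_pow_wiener {f : ℝ → Wiener} {f' : Wiener} {t : ℝ} (hf : HasDerivAt f f' t) (n : ℕ) :
    HasDerivAt (fun t => f t ^ n) ((n : ℝ) • (f t ^ (n - 1) * f')) t := by
  have := hf.fun_pow n
  convert this using 1
  rw [Algebra.smul_def]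
  push_cast
  simp [mul_assoc]

lemma hasDerivAt_defect (φ φ' δφ δφ' h : Wiener) (y δy : Fin k → ℝ) (μ δμ : ℝ) :
    HasDerivAt (fun t : ℝ => defect c (φ + t • δφ) (φ' + t • δφ') (y + t • δy) (μ + t * δμ) h)
      (dpol y φ * δφ + ∑ j : Fin k, δy j • φ ^ (j : ℕ) - δφ' * h * den k c μ φ -
        φ' * h * (dden k μ φ * δφ + δμ • φ ^ k)) 0 := by
  have lin : ∀ a b : Wiener, HasDerivAt (fun t : ℝ => a + t • b) b 0 := fun a b => by
    simpa using ((hasDerivAt_id (0 : ℝ)).smul_const b).const_add a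
  have linR : ∀ a b : ℝ, HasDerivAt (fun t : ℝ => a + t * b) b 0 := fun a b => by
    simpa using ((hasDerivAt_id (0 : ℝ)).mul_const b).const_add a
  have hφ := lin φ δφ
  have hpow := fun n => hasDerivAt_pow_wiener hφ n
  have h1 := (hpow (k + 1)).fun_add (HasDerivAt.fun_sum (u := Finset.univ)
    fun (j : Fin k) _ => (linR (y j) (δy j)).fun_smul (hpow j))
  have h2 := (((lin φ' δφ').mul_const h).fun_mul
    (((linR μ δμ).fun_smul (hpow k)).const_add (algebraMap ℝ Wiener c)))
  have h3 := h1.fun_sub h2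
  have h4 : HasDerivAt (fun t : ℝ => defect c (φ + t • δφ) (φ' + t • δφ') (y + t • δy)
    (μ + t * δμ) h) _ 0 := h3
  refine h4.congr_deriv ?_
  simp only [zero_smul, zero_mul, add_zero, Nat.add_sub_cancel, dpol, dden, den,
    Finset.sum_add_distrib, add_mul, Finset.sum_mul, smul_mul_assoc]
  simp only [Algebra.smul_def]
  ring

variable (k) in
/-- The slice parameter of the infinitesimal data `(q, y, μ)`, where `q'` is the derivative
of `q`. -/
def repr (q q' : Wiener) (y : Fin k → ℝ) (μ : ℝ) : Wiener :=
  ((k : ℝ) + 1) • (U ^ k * q) - U ^ (k + 1) * q' + ∑ j : Fin k, y j • U ^ (j : ℕ) -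
    (μ / c) • U ^ (2 * k + 1)

lemma cf_sum_smul_U_pow (y : Fin k → ℝ) (n : ℕ) :
    cf n (∑ j : Fin k, y j • U ^ (j : ℕ)) = if h : n < k then y ⟨n, h⟩ else 0 := by
  rw [map_sum]
  simp only [map_smul, cf_U_pow, smul_eq_mul, mul_ite, mul_one, mul_zero]
  split_ifs with h
  · rw [Finset.sum_eq_single ⟨n, h⟩]
    · simp
    · intro j _ hj
      rw [if_neg]; rintro rfl; exact hj rfl
    · simp
  · refine Finset.sum_eq_zero fun j _ => if_neg ?_
    have := j.2
    omega

lemma cf_repr_of_lt (q q' : Wiener) (y : Fin k → ℝ) (μ : ℝ) (j : Fin k) :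
    cf j (repr k c q q' y μ) = y j := by
  have hj := j.2
  rw [repr, map_sub, map_add, map_sub, map_smul, cf_U_pow_mul, cf_U_pow_mul, cf_sum_smul_U_pow,
    map_smul, cf_U_pow, if_neg (by omega), if_neg (by omega), dif_pos hj, if_neg (by omega)]
  simp

/-- The operator in `q` is diagonal on monomials, `u^i ↦ (k+1-i) u^(k+i)`. At the resonance `i =
k+1` only the residue term survives. -/
lemma cf_repr_add {q q' : Wiener} (hq : IsDeriv q q') (y : Fin k → ℝ) (μ : ℝ) (i : ℕ) :
    cf (k + i) (repr k c q q' y μ) =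
      ((k : ℝ) + 1 - i) * cf i q - if i = k + 1 then μ / c else 0 := by
  rw [repr, map_sub, map_add, map_sub, map_smul, cf_U_pow_mul, cf_U_pow_mul, cf_sum_smul_U_pow,
    map_smul, cf_U_pow, if_pos (by omega), dif_neg (by omega), Nat.add_sub_cancel_left]
  have e : (k + i = 2 * k + 1) ↔ (i = k + 1) := by omega
  simp only [e, smul_eq_mul, mul_ite, mul_one, mul_zero]
  rcases i with _ | i
  · rw [if_neg (by omega)]; simp
  · rw [if_pos (by omega), show k + (i + 1) - (k + 1) = i by omega, isDeriv_iff.1 hq i]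
    push_cast; ring

lemma lowCf_repr (q q' : Wiener) (y : Fin k → ℝ) (μ : ℝ) : lowCf k (repr k c q q' y μ) = y :=
  funext fun j => cf_repr_of_lt c q q' y μ j

variable {c}

lemma resCf_repr (hc : c ≠ 0) {q q' : Wiener} (hq : IsDeriv q q') (y : Fin k → ℝ) (μ : ℝ) :
    resCf k c (repr k c q q' y μ) = μ := by
  rw [resCf, show 2 * k + 1 = k + (k + 1) by ring, cf_repr_add c hq, if_pos rfl]
  push_cast
  field_simp
  ring

/-- `xi` divides by the nonzero eigenvalues `k+1-i`, so it recovers `q` up to the kernel, which is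
the coefficient of `u^(k+1)`. -/
lemma xi_repr {q q' : Wiener} (hq : IsDeriv q q') (y : Fin k → ℝ) (μ : ℝ) :
    xi k (repr k c q q' y μ) + cf (k + 1) q • U ^ (k + 1) = q := by
  refine ext_cf fun i => ?_
  rw [map_add, map_smul, cf_U_pow, cf_xi, cf_repr_add c hq]
  split_ifs with h
  · subst h; simp
  · have : (k : ℝ) + 1 - i ≠ 0 := by
      rw [sub_ne_zero]; exact_mod_cast Ne.symm h
    field_simp
    simp

lemma dxi_repr {q q' : Wiener} (hq : IsDeriv q q') (y : Fin k → ℝ) (μ : ℝ) :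
    dxi k (repr k c q q' y μ) + (((k : ℝ) + 1) * cf (k + 1) q) • U ^ k = q' := by
  have h1 := (isDeriv_xi k (repr k c q q' y μ)).add ((isDeriv_U.pow (k + 1)).smul (cf (k + 1) q))
  rw [xi_repr hq] at h1
  refine Eq.trans ?_ (h1.unique hq)
  rw [smul_smul, mul_one, Nat.add_sub_cancel]
  push_cast
  rw [mul_comm (cf (k + 1) q)]

/-- The degrees split: those below `k` come from `y`, the degree `2k+1` from `μ`, and all others
from the invertible part of the diagonal operator. -/
lemma repr_self (hc : c ≠ 0) (w : Wiener) :
    repr k c (xi k w) (dxi k w) (lowCf k w) (resCf k c w) = w := by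
  refine ext_cf fun n => ?_
  by_cases hn : n < k
  · exact cf_repr_of_lt c _ _ _ _ ⟨n, hn⟩
  · obtain ⟨i, rfl⟩ := Nat.exists_eq_add_of_le (not_lt.1 hn)
    rw [cf_repr_add c (isDeriv_xi k w), cf_xi, resCf]
    split_ifs with h
    · subst h
      rw [show 2 * k + 1 = k + (k + 1) by ring]
      field_simp
      simp
    · have : (k : ℝ) + 1 - i ≠ 0 := by
        rw [sub_ne_zero]; exact_mod_cast Ne.symm h
      field_simp
      simp

/-- The model vector field `u^{k+1} / c`. -/
def model (k : ℕ) (c : ℝ) : Wiener := c⁻¹ • U ^ (k + 1)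

/-- The defect as a function of `((h, τ), w)`. -/
def F (k : ℕ) (c : ℝ) (z : (Wiener × ℝ) × Wiener) : Wiener :=
  defect c (phi k z.1.2 z.2) (dphi k z.1.2 z.2) (lowCf k z.2) (resCf k c z.2) z.1.1

section Analytic

variable {E : Type*} [NormedAddCommGroup E] [NormedSpace ℝ E] {x : E} {w f : E → Wiener}
  {τ μ : E → ℝ}

lemma analyticAt_cf (n : ℕ) (hw : AnalyticAt ℝ w x) : AnalyticAt ℝ (fun e => cf n (w e)) x :=
  ((cfL n).analyticAt (w x)).fun_comp hw

lemma analyticAt_phi (hτ : AnalyticAt ℝ τ x) (hw : AnalyticAt ℝ w x) :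
    AnalyticAt ℝ (fun e => phi k (τ e) (w e)) x := by
  have hxi : AnalyticAt ℝ (fun e => xi k (w e)) x := ((xi k).analyticAt (w x)).fun_comp hw
  unfold phi
  exact (analyticAt_const.fun_add hxi).fun_add (hτ.fun_smul analyticAt_const)

lemma analyticAt_dphi (hτ : AnalyticAt ℝ τ x) (hw : AnalyticAt ℝ w x) :
    AnalyticAt ℝ (fun e => dphi k (τ e) (w e)) x := by
  have hxi : AnalyticAt ℝ (fun e => dxi k (w e)) x := ((dxi k).analyticAt (w x)).fun_comp hw
  unfold dphi
  exact (analyticAt_const.fun_add hxi).fun_add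
    ((analyticAt_const.fun_mul hτ).fun_smul analyticAt_const)

lemma analyticAt_resCf (hw : AnalyticAt ℝ w x) : AnalyticAt ℝ (fun e => resCf k c (w e)) x :=
  analyticAt_const.fun_mul (analyticAt_cf _ hw)

lemma analyticAt_pol {y : E → Fin k → ℝ} (hy : ∀ j, AnalyticAt ℝ (fun e => y e j) x)
    (hf : AnalyticAt ℝ f x) : AnalyticAt ℝ (fun e => pol (y e) (f e)) x := by
  unfold pol
  exact (hf.fun_pow _).fun_add
    (Finset.analyticAt_fun_sum _ fun j _ => (hy j).fun_smul (hf.fun_pow _))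

lemma analyticAt_den (hμ : AnalyticAt ℝ μ x) (hf : AnalyticAt ℝ f x) :
    AnalyticAt ℝ (fun e => den k c (μ e) (f e)) x := by
  unfold den
  exact analyticAt_const.fun_add (hμ.fun_smul (hf.fun_pow _))

end Analytic

lemma analyticAt_F (z : (Wiener × ℝ) × Wiener) : AnalyticAt ℝ (F k c) z := by
  have hw : AnalyticAt ℝ (fun z : (Wiener × ℝ) × Wiener => z.2) z := analyticAt_snd
  have hp : AnalyticAt ℝ (fun z : (Wiener × ℝ) × Wiener => z.1) z := analyticAt_fst
  have hh : AnalyticAt ℝ (fun z : (Wiener × ℝ) × Wiener => z.1.1) z :=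
    AnalyticAt.fun_comp (g := fun p : Wiener × ℝ => p.1) analyticAt_fst hp
  have hτ : AnalyticAt ℝ (fun z : (Wiener × ℝ) × Wiener => z.1.2) z :=
    AnalyticAt.fun_comp (g := fun p : Wiener × ℝ => p.2) analyticAt_snd hp
  have hphi := analyticAt_phi (k := k) hτ hw
  unfold F defect
  exact (analyticAt_pol (fun j => analyticAt_cf j hw) hphi).fun_sub
    (((analyticAt_dphi hτ hw).fun_mul hh).fun_mul (analyticAt_den (analyticAt_resCf hw) hphi))

/-- `F` is analytic, so its derivative may be computed along lines, where `phi`, `dphi` and both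
parameters vary affinely. -/
lemma fderiv_F (h : Wiener) (τ δτ : ℝ) (w δw : Wiener) :
    fderiv ℝ (F k c) ((h, τ), w) ((0, δτ), δw) =
      dpol (lowCf k w) (phi k τ w) * (xi k δw + δτ • U ^ (k + 1)) +
        ∑ j : Fin k, lowCf k δw j • phi k τ w ^ (j : ℕ) -
        (dxi k δw + (((k : ℝ) + 1) * δτ) • U ^ k) * h * den k c (resCf k c w) (phi k τ w) -
        dphi k τ w * h * (dden k (resCf k c w) (phi k τ w) * (xi k δw + δτ • U ^ (k + 1)) +
          resCf k c δw • phi k τ w ^ k) := by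
  have h1 := hasDerivAt_defect c (phi k τ w) (dphi k τ w) (xi k δw + δτ • U ^ (k + 1))
    (dxi k δw + (((k : ℝ) + 1) * δτ) • U ^ k) h (lowCf k w) (lowCf k δw) (resCf k c w) (resCf k c δw)
  have hl : HasDerivAt (fun t : ℝ => (((h, τ), w) : (Wiener × ℝ) × Wiener) + t • ((0, δτ), δw))
      ((0, δτ), δw) 0 := by
    simpa using ((hasDerivAt_id (0 : ℝ)).smul_const (((0, δτ), δw) : (Wiener × ℝ) × Wiener)).const_add
      (((h, τ), w) : (Wiener × ℝ) × Wiener)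
  have h2 : HasFDerivAt (F k c) (fderiv ℝ (F k c) ((h, τ), w))
      ((((h, τ), w) : (Wiener × ℝ) × Wiener) + (0 : ℝ) • ((0, δτ), δw)) := by
    rw [zero_smul, add_zero]
    exact (analyticAt_F _).differentiableAt.hasFDerivAt
  have h3 := h2.comp_hasDerivAt (0 : ℝ) hl
  refine h3.unique (h1.congr_of_eventuallyEq (Filter.Eventually.of_forall fun t => ?_))
  have e1 : phi k (τ + t * δτ) (w + t • δw) =
      phi k τ w + t • (xi k δw + δτ • U ^ (k + 1)) := by
    simp only [phi, map_add, map_smul]; module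
  have e2 : dphi k (τ + t * δτ) (w + t • δw) =
      dphi k τ w + t • (dxi k δw + (((k : ℝ) + 1) * δτ) • U ^ k) := by
    simp only [dphi, map_add, map_smul]; module
  have e3 : lowCf k (w + t • δw) = lowCf k w + t • lowCf k δw := by
    ext j; simp [lowCf]
  have e4 : resCf k c (w + t • δw) = resCf k c w + t * resCf k c δw := by
    simp [resCf]; ring
  simp only [Function.comp, F, Prod.fst_add, Prod.snd_add, Prod.smul_fst, Prod.smul_snd, smul_zero,
    add_zero, smul_eq_mul, e1, e2, e3, e4]

end Equation

/-! ### The implicit function theorem at the model. -/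

section Slice

variable {k : ℕ} {c : ℝ}

lemma phi_zero : phi k 0 0 = U := by simp [phi]

lemma dphi_zero : dphi k 0 0 = 1 := by simp [dphi]

lemma lowCf_zero : lowCf k 0 = 0 := by ext j; simp [lowCf]

lemma resCf_zero : resCf k c 0 = 0 := by simp [resCf]

lemma pol_zero (x : Wiener) : pol (0 : Fin k → ℝ) x = x ^ (k + 1) := by simp [pol]

lemma den_zero (x : Wiener) : den k c 0 x = algebraMap ℝ Wiener c := by simp [den]

lemma model_mul (hc : c ≠ 0) : model k c * algebraMap ℝ Wiener c = U ^ (k + 1) := by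
  rw [model, mul_comm, ← Algebra.smul_def, smul_smul, mul_inv_cancel₀ hc, one_smul]

lemma F_model (hc : c ≠ 0) : F k c ((model k c, 0), 0) = 0 := by
  simp only [F, defect, phi_zero, dphi_zero, lowCf_zero, resCf_zero, pol_zero, den_zero, one_mul,
    model_mul hc, sub_self]

/-- At the model the derivative is the linearised operator `repr` applied to the data extracted from
`w`, so `repr_self` applies. -/
lemma fderiv_F_model (hc : c ≠ 0) (w : Wiener) :
    fderiv ℝ (F k c) ((model k c, 0), 0) (0, w) = w := by
  have h := fderiv_F (k := k) (c := c) (model k c) 0 0 0 w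
  have e0 : ((0 : Wiener × ℝ), w) = ((0, 0), w) := rfl
  rw [e0, h, phi_zero, dphi_zero, lowCf_zero, resCf_zero, den_zero]
  conv_rhs => rw [← repr_self (k := k) hc w]
  rw [mul_assoc _ (model k c), model_mul hc]
  have e1 : dpol (0 : Fin k → ℝ) U = ((k : ℝ) + 1) • U ^ k := by simp [dpol]
  have e2 : dden k 0 U = 0 := by simp [dden]
  rw [e1, e2, repr, zero_smul, mul_zero, zero_smul, add_zero, add_zero, zero_mul, zero_add, one_mul,
    model]
  have e3 : U ^ (2 * k + 1) = U ^ (k + 1) * U ^ k := by rw [← pow_add]; congr 1; ring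
  have e4 : resCf k c w / c = c⁻¹ * resCf k c w := by rw [div_eq_inv_mul]
  rw [e3, e4]
  simp only [Algebra.smul_def, map_mul, map_add]
  ring

/-- The vector field `N(φ)` along the coordinate change `φ`, where `N` is the normal form. -/
def field (k : ℕ) (c τ : ℝ) (w : Wiener) : Wiener :=
  pol (lowCf k w) (phi k τ w) * Ring.inverse (den k c (resCf k c w) (phi k τ w))

/-- Infinitesimal form of the fact that the flow of `N` preserves `N(φ) = φ' h`. For `q = N(φ)` the
linearised equation is `N'(φ) q = q' h`, and both sides equal `N'(φ) φ' h`. Since neither `y` nor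
`μ` moves, their increments are zero. -/
lemma fderiv_F_field (hc : c ≠ 0) {h w : Wiener} {τ : ℝ} (hF : F k c ((h, τ), w) = 0)
    (hu : IsUnit (den k c (resCf k c w) (phi k τ w))) :
    ∃ q' : Wiener, IsDeriv (field k c τ w) q' ∧
      fderiv ℝ (F k c) ((h, τ), w)
        ((0, cf (k + 1) (field k c τ w)), repr k c (field k c τ w) q' 0 0) = 0 := by
  have hinv := Ring.mul_inverse_cancel _ hu
  have hdP := isDeriv_pol (isDeriv_phi k τ w) (lowCf k w)
  have hdQ := isDeriv_den (k := k) c (isDeriv_phi k τ w) (resCf k c w)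
  have hq := hdP.mul (hdQ.of_mul_eq_one hinv)
  change IsDeriv (field k c τ w) _ at hq
  refine ⟨_, hq, ?_⟩
  rw [fderiv_F, xi_repr hq, dxi_repr hq, lowCf_repr, resCf_repr hc hq, field]
  rw [F, defect] at hF
  set P := pol (lowCf k w) (phi k τ w)
  set Q := den k c (resCf k c w) (phi k τ w)
  set Qi := Ring.inverse Q
  set dP := dpol (lowCf k w) (phi k τ w)
  set dQ := dden k (resCf k c w) (phi k τ w)
  set φ' := dphi k τ w
  simp only [Pi.zero_apply, zero_smul, Finset.sum_const_zero, add_zero]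
  have hF' : P = φ' * h * Q := sub_eq_zero.1 hF
  have h1 : φ' * h = P * Qi := by rw [hF', mul_assoc, hinv, mul_one]
  linear_combination (-dP * P * Qi + dQ * P * Qi * φ' * h) * hinv - Qi * Q * dP * h1

lemma analyticAt_field {E : Type*} [NormedAddCommGroup E] [NormedSpace ℝ E] {x : E}
    {w : E → Wiener} {τ : E → ℝ} (hτ : AnalyticAt ℝ τ x) (hw : AnalyticAt ℝ w x)
    (hu : IsUnit (den k c (resCf k c (w x)) (phi k (τ x) (w x)))) :
    AnalyticAt ℝ (fun e => field k c (τ e) (w e)) x := by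
  have hphi := analyticAt_phi (k := k) hτ hw
  have hden := analyticAt_den (k := k) (c := c) (analyticAt_resCf (k := k) (c := c) hw) hphi
  unfold field
  refine (analyticAt_pol (fun j => analyticAt_cf j hw) hphi).fun_mul ?_
  obtain ⟨v, hv⟩ := hu
  refine AnalyticAt.fun_comp (g := Ring.inverse) ?_ hden
  rw [← hv]
  exact analyticAt_inverse v

lemma isUnit_algebraMap (hc : c ≠ 0) : IsUnit (algebraMap ℝ Wiener c) :=
  (IsUnit.mk0 c hc).map (algebraMap ℝ Wiener)

lemma inverse_algebraMap (hc : c ≠ 0) :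
    Ring.inverse (algebraMap ℝ Wiener c) = algebraMap ℝ Wiener c⁻¹ := by
  have h1 : algebraMap ℝ Wiener c * algebraMap ℝ Wiener c⁻¹ = 1 := by
    rw [← map_mul, mul_inv_cancel₀ hc, map_one]
  rw [← one_mul (algebraMap ℝ Wiener c⁻¹), ← Ring.inverse_mul_cancel _ (isUnit_algebraMap hc),
    mul_assoc, h1, mul_one]

/-- The solutions of the conjugacy equation near the model are parametrized by the vector field
`h` and by the coefficient `τ` of `u^{k+1}` in the coordinate change; moving `τ` amounts to
composing with the flow of the normal form. -/
theorem exists_slice (k : ℕ) (hc : c ≠ 0) : ∃ W : Wiener × ℝ → Wiener,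
    W (model k c, 0) = 0 ∧ AnalyticAt ℝ W (model k c, 0) ∧
    (∀ᶠ z in 𝓝 ((model k c, (0 : ℝ)), (0 : Wiener)), F k c z = 0 → W z.1 = z.2) ∧
    (∀ᶠ p in 𝓝 (model k c, (0 : ℝ)), F k c (p, W p) = 0) ∧
    (∀ᶠ p in 𝓝 (model k c, (0 : ℝ)),
      IsUnit (den k c (resCf k c (W p)) (phi k p.2 (W p))) ∧
      cf (k + 1) (field k c p.2 (W p)) ≠ 0 ∧
      ∃ w' : Wiener, HasDerivAt (fun τ => W (p.1, τ)) w' p.2 ∧ lowCf k w' = 0 ∧ resCf k c w' = 0 ∧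
        cf (k + 1) (field k c p.2 (W p)) • (xi k w' + U ^ (k + 1)) = field k c p.2 (W p)) := by
  set z₀ : (Wiener × ℝ) × Wiener := ((model k c, 0), 0) with hz₀
  have hA : ContDiffAt ℝ ⊤ (F k c) z₀ := (analyticAt_F z₀).contDiffAt
  have hid : fderiv ℝ (F k c) z₀ ∘L .inr ℝ (Wiener × ℝ) Wiener = ContinuousLinearMap.id ℝ Wiener :=
    ContinuousLinearMap.ext fun w => fderiv_F_model hc w
  have hinv : (fderiv ℝ (F k c) z₀ ∘L .inr ℝ (Wiener × ℝ) Wiener).IsInvertible := by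
    rw [hid]; exact ⟨ContinuousLinearEquiv.refl ℝ Wiener, rfl⟩
  -- The top element of `WithTop ℕ∞` stands for analyticity, so the implicit function is analytic.
  have hn : (⊤ : WithTop ℕ∞) ≠ 0 := by simp
  set W : Wiener × ℝ → Wiener := hA.implicitFunction hn hinv with hW
  have hW0 : W (model k c, 0) = 0 := hA.implicitFunction_apply_self hn hinv
  have hWan : AnalyticAt ℝ W (model k c, 0) := (hA.contDiffAt_implicitFunction hn hinv).analyticAt
  have hF0 : F k c z₀ = 0 := F_model hc
  have hiff := hA.eventually_apply_eq_iff_implicitFunction hn hinv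
  have hsol := hA.eventually_apply_implicitFunction hn hinv
  rw [hF0] at hiff hsol
  refine ⟨W, hW0, hWan, hiff.mono fun z hz => hz.1, hsol, ?_⟩
  have hgraph : AnalyticAt ℝ (fun p : Wiener × ℝ => (p, W p)) (model k c, 0) :=
    analyticAt_id.prod hWan
  have hsnd : AnalyticAt ℝ (fun p : Wiener × ℝ => p.2) (model k c, 0) := analyticAt_snd
  have hunit0 : IsUnit (den k c (resCf k c (W (model k c, 0))) (phi k 0 (W (model k c, 0)))) := by
    rw [hW0, resCf_zero, den_zero]; exact isUnit_algebraMap hc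
  have hfield : AnalyticAt ℝ (fun p : Wiener × ℝ => field k c p.2 (W p)) (model k c, 0) :=
    analyticAt_field hsnd hWan hunit0
  have hunit : ∀ᶠ p in 𝓝 (model k c, (0 : ℝ)),
      IsUnit (den k c (resCf k c (W p)) (phi k p.2 (W p))) := by
    have hden := analyticAt_den (k := k) (c := c) (analyticAt_resCf (k := k) (c := c) hWan)
      (analyticAt_phi (k := k) hsnd hWan)
    exact hden.continuousAt.eventually_mem (Units.isOpen.mem_nhds hunit0)
  -- At the model the field is `u^(k+1)/c`, so `τ` moves with speed `1/c`.
  have hvel : ∀ᶠ p in 𝓝 (model k c, (0 : ℝ)), cf (k + 1) (field k c p.2 (W p)) ≠ 0 := by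
    refine (analyticAt_cf (k + 1) hfield).continuousAt.eventually_ne ?_
    rw [hW0, field, lowCf_zero, phi_zero, resCf_zero, pol_zero, den_zero]
    rw [inverse_algebraMap hc, mul_comm, ← Algebra.smul_def, map_smul, cf_U_pow, if_pos rfl]
    simpa using hc
  -- An operator at distance less than one from the identity is injective.
  have hinj : ∀ᶠ p in 𝓝 (model k c, (0 : ℝ)), ∀ v : Wiener,
      fderiv ℝ (F k c) (p, W p) (0, v) = 0 → v = 0 := by
    have hcont : ContinuousAt (fun p : Wiener × ℝ =>
        fderiv ℝ (F k c) (p, W p) ∘L .inr ℝ (Wiener × ℝ) Wiener) (model k c, 0) := by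
      have h1 : ContinuousAt (fun p : Wiener × ℝ => fderiv ℝ (F k c) (p, W p)) (model k c, 0) :=
        ((analyticAt_F _).fderiv.continuousAt).comp hgraph.continuousAt
      exact h1.clm_comp continuousAt_const
    have hlt : ∀ᶠ p in 𝓝 (model k c, (0 : ℝ)),
        dist (fderiv ℝ (F k c) (p, W p) ∘L .inr ℝ (Wiener × ℝ) Wiener)
          (ContinuousLinearMap.id ℝ Wiener) < 1 := by
      have e : fderiv ℝ (F k c) ((model k c, 0), W (model k c, 0)) ∘L .inr ℝ (Wiener × ℝ) Wiener =
          ContinuousLinearMap.id ℝ Wiener := by rw [hW0]; exact hid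
      rw [← e]
      exact hcont.eventually (Metric.ball_mem_nhds _ one_pos)
    filter_upwards [hlt] with p hp v hv
    by_contra hv0
    have h1 := (fderiv ℝ (F k c) (p, W p) ∘L .inr ℝ (Wiener × ℝ) Wiener -
      ContinuousLinearMap.id ℝ Wiener).le_opNorm v
    have h2 : (fderiv ℝ (F k c) (p, W p) ∘L .inr ℝ (Wiener × ℝ) Wiener -
      ContinuousLinearMap.id ℝ Wiener) v = -v := by
      simp [hv]
    rw [dist_eq_norm] at hp
    rw [h2, norm_neg] at h1
    have := norm_pos_iff.2 hv0
    nlinarith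
  filter_upwards [hsol.eventually_nhds, hunit, hvel, hinj, hWan.eventually_analyticAt]
    with p hp hu hv hi hWp
  refine ⟨hu, hv, ?_⟩
  obtain ⟨h, τ⟩ := p
  obtain ⟨q', hq', hker⟩ := fderiv_F_field hc hp.self_of_nhds hu
  set q := field k c τ (W (h, τ)) with hq
  set v := cf (k + 1) q with hvdef
  have hline : HasDerivAt (fun s : ℝ => (h, s)) ((0 : Wiener), (1 : ℝ)) τ :=
    (hasDerivAt_const τ h).prodMk (hasDerivAt_id τ)
  have hw' := hWp.differentiableAt.hasFDerivAt.comp_hasDerivAt τ hline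
  set w' := fderiv ℝ W (h, τ) (0, 1) with hw'def
  have hzero : fderiv ℝ (F k c) ((h, τ), W (h, τ)) ((0, 1), w') = 0 := by
    have h1 : HasDerivAt (fun s : ℝ => ((h, s), W (h, s))) (((0 : Wiener), (1 : ℝ)), w') τ :=
      hline.prodMk hw'
    have h2 := (analyticAt_F (k := k) (c := c)
      ((h, τ), W (h, τ))).differentiableAt.hasFDerivAt.comp_hasDerivAt τ h1
    refine h2.unique ((hasDerivAt_const τ (0 : Wiener)).congr_of_eventuallyEq ?_)
    exact (hline.continuousAt.tendsto.eventually hp)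
  -- Both `(1, w')`, tangent to the solution curve, and the flow direction `(v, repr ..)` are in the
  -- kernel. After matching the `τ`-components their difference lies in the `w`-direction, where the
  -- derivative is injective.
  have hdiff : fderiv ℝ (F k c) ((h, τ), W (h, τ)) (0, v • w' - repr k c q q' 0 0) = 0 := by
    have e : ((0 : Wiener × ℝ), v • w' - repr k c q q' 0 0) =
        v • (((0 : Wiener), (1 : ℝ)), w') - ((0, v), repr k c q q' 0 0) := by
      ext <;> simp
    rw [e, map_sub, map_smul, hzero, hker, smul_zero, sub_zero]
  have hrep : v • w' = repr k c q q' 0 0 := sub_eq_zero.1 (hi _ hdiff)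
  have hw'' : w' = v⁻¹ • repr k c q q' 0 0 := by rw [← hrep, smul_smul, inv_mul_cancel₀ hv, one_smul]
  refine ⟨w', hw', ?_, ?_, ?_⟩
  · ext j
    have := congrFun (lowCf_repr c q q' (0 : Fin k → ℝ) 0) j
    rw [lowCf] at this
    rw [hw'', lowCf, map_smul, this]; simp
  · have := resCf_repr (k := k) hc hq' 0 0
    rw [hw'']
    simp only [resCf, map_smul, smul_eq_mul] at this ⊢
    linear_combination v⁻¹ * this
  · rw [smul_add, ← map_smul, hrep, xi_repr hq']

end Slice

/-! ### The flow of the normal forms. -/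

/-- The antiderivative vanishing at the origin. -/
def antideriv (f : Wiener) : Wiener :=
  U * cfOp (fun n => 1 / ((n : ℝ) + 1)) id 1 (fun n => by
    rw [Real.norm_of_nonneg (by positivity), div_le_one (by positivity)]
    linarith [(Nat.cast_nonneg n : (0 : ℝ) ≤ n)]) Function.injective_id f

lemma isDeriv_antideriv (f : Wiener) : IsDeriv (antideriv f) f := by
  rw [isDeriv_iff]
  intro n
  have := cf_U_pow_mul 1 (n + 1) (cfOp (fun n => 1 / ((n : ℝ) + 1)) id 1 (fun n => by
    rw [Real.norm_of_nonneg (by positivity), div_le_one (by positivity)]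
    linarith [(Nat.cast_nonneg n : (0 : ℝ) ≤ n)]) Function.injective_id f)
  rw [pow_one, if_pos (by omega), Nat.add_sub_cancel, cf_cfOp] at this
  rw [antideriv, this]
  field_simp
  rfl

lemma eval_zero_antideriv (f : Wiener) : eval (0 : ℝ) (antideriv f) = 0 := by
  rw [antideriv, eval_mul (by simp), eval_U, zero_mul]

/-- An analytic germ has an analytic primitive with respect to the first variable. -/
lemma exists_primitive {m : ℕ} {f : ℝ × (Fin m → ℝ) → ℝ} (hf : AnalyticAt ℝ f 0) :
    ∃ g : ℝ × (Fin m → ℝ) → ℝ, AnalyticAt ℝ g 0 ∧ (∀ l, g (0, l) = 0) ∧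
      ∀ᶠ p in 𝓝 (0 : ℝ × (Fin m → ℝ)), HasDerivAt (fun x => g (x, p.2)) (f p) p.1 := by
  obtain ⟨_, _, e, he, Φ, hΦ, hev⟩ := exists_expansion hf
  refine ⟨fun p => e * eval (e⁻¹ * p.1) (antideriv (Φ p.2)), ?_, ?_, ?_⟩
  · have hfst : AnalyticAt ℝ (fun p : ℝ × (Fin m → ℝ) => p.1) 0 := analyticAt_fst
    have hsnd : AnalyticAt ℝ (fun p : ℝ × (Fin m → ℝ) => Φ p.2) 0 :=
      AnalyticAt.fun_comp (g := Φ) (f := fun p : ℝ × (Fin m → ℝ) => p.2) (by simpa using hΦ)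
        analyticAt_snd
    have hI : AnalyticAt ℝ (fun p : ℝ × (Fin m → ℝ) => antideriv (Φ p.2)) 0 := by
      unfold antideriv
      exact analyticAt_const.fun_mul ((ContinuousLinearMap.analyticAt _ _).fun_comp hsnd)
    exact analyticAt_const.fun_mul (hI.wienerEval (analyticAt_const.fun_mul hfst) (by simp))
  · intro l
    simp [eval_zero_antideriv]
  · have h1 : ∀ᶠ p in 𝓝 (0 : ℝ × (Fin m → ℝ)), |p.1| < e := by
      have : ContinuousAt (fun p : ℝ × (Fin m → ℝ) => |p.1|) 0 := by fun_prop
      exact this.eventually_lt_const (by simpa using he)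
    have h2 := (continuous_snd.tendsto (0 : ℝ × (Fin m → ℝ))).eventually hev
    filter_upwards [h1, h2] with p hp hp2
    have hu : ‖e⁻¹ * p.1‖ < 1 := by
      rw [norm_mul, norm_inv, Real.norm_of_nonneg he.le, Real.norm_eq_abs, inv_mul_lt_iff₀ he,
        mul_one]
      exact hp
    have h3 := (hasDerivAt_eval (isDeriv_antideriv (Φ p.2)) hu).comp p.1
      ((hasDerivAt_id p.1).const_mul e⁻¹)
    have h4 := h3.const_mul e
    have h5 := hp2.2 (e⁻¹ * p.1) hu.le
    rw [← mul_assoc, mul_inv_cancel₀ he.ne', one_mul] at h5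
    refine h4.congr_deriv ?_
    rw [← h5, mul_one, mul_comm, mul_assoc, inv_mul_cancel₀ he.ne', mul_one]

section Flow

variable {k : ℕ} {c : ℝ}

/-- Nearby solutions of the conjugacy equation for the same vector field share their normal
form. -/
theorem exists_slice_const (k : ℕ) (hc : c ≠ 0) : ∃ W : Wiener × ℝ → Wiener,
    W (model k c, 0) = 0 ∧
    (∀ᶠ z in 𝓝 ((model k c, (0 : ℝ)), (0 : Wiener)), F k c z = 0 → W z.1 = z.2) ∧
    (∀ᶠ p in 𝓝 (model k c, (0 : ℝ)), AnalyticAt ℝ W p ∧ F k c (p, W p) = 0 ∧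
      lowCf k (W p) = lowCf k (W (p.1, 0)) ∧ resCf k c (W p) = resCf k c (W (p.1, 0)) ∧
      IsUnit (den k c (resCf k c (W p)) (phi k p.2 (W p))) ∧
      cf (k + 1) (field k c p.2 (W p)) ≠ 0 ∧
      ∃ w' : Wiener, HasDerivAt (fun τ => W (p.1, τ)) w' p.2 ∧
        cf (k + 1) (field k c p.2 (W p)) • (xi k w' + U ^ (k + 1)) = field k c p.2 (W p)) := by
  obtain ⟨W, hW0, hWan, huniq, hsol, hder⟩ := exists_slice k hc
  refine ⟨W, hW0, huniq, ?_⟩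
  -- The `τ`-derivatives of these coefficients vanish, and a ball in `τ` containing `0` is
  -- connected.
  have hconst : ∀ᶠ p in 𝓝 (model k c, (0 : ℝ)), ∀ n, (n < k ∨ n = 2 * k + 1) →
      cf n (W p) = cf n (W (p.1, 0)) := by
    obtain ⟨V, hV, T, hT, hVT⟩ := mem_nhds_prod_iff.1 hder
    obtain ⟨r, hr, hrT⟩ := Metric.mem_nhds_iff.1 hT
    filter_upwards [prod_mem_nhds hV (Metric.ball_mem_nhds (0 : ℝ) hr)] with p hp n hn
    have hd : ∀ τ ∈ Metric.ball (0 : ℝ) r, HasDerivAt (fun τ => cf n (W (p.1, τ))) 0 τ :=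
        fun τ hτ => by
      obtain ⟨-, -, w', hw', hlow, hres, -⟩ := hVT (Set.mk_mem_prod hp.1 (hrT hτ))
      have h1 := (cfL n).hasFDerivAt.comp_hasDerivAt τ hw'
      refine h1.congr_deriv ?_
      rw [cfL_apply]
      rcases hn with hn | rfl
      · exact congrFun hlow ⟨n, hn⟩
      · simpa [resCf, hc] using hres
    exact Metric.isOpen_ball.is_const_of_deriv_eq_zero (convex_ball (0 : ℝ) r).isPreconnected
      (fun τ hτ => (hd τ hτ).differentiableAt.differentiableWithinAt)
      (fun τ hτ => (hd τ hτ).deriv) hp.2 (Metric.mem_ball_self hr)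
  filter_upwards [hWan.eventually_analyticAt, hsol, hder, hconst] with p h1 h2 h3 h4
  obtain ⟨hu, hv, w', hw', -, -, hf⟩ := h3
  refine ⟨h1, h2, funext fun j => h4 j (Or.inl j.2), ?_, hu, hv, w', hw', hf⟩
  rw [resCf, resCf, h4 _ (Or.inr rfl)]

/-- The normal form with parameters `Y = (y, μ)` as an element of the Banach algebra. -/
def nf (k : ℕ) (c : ℝ) (Y : Fin (k + 1) → ℝ) : Wiener :=
  pol (fun j : Fin k => Y j.castSucc) U * Ring.inverse (den k c (Y (Fin.last k)) U)

lemma eventually_isUnit_den_U (k : ℕ) (hc : c ≠ 0) :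
    ∀ᶠ Y : Fin (k + 1) → ℝ in 𝓝 0, IsUnit (den k c (Y (Fin.last k)) U) := by
  have h1 : AnalyticAt ℝ (fun Y : Fin (k + 1) → ℝ => Y (Fin.last k)) 0 :=
    (ContinuousLinearMap.proj (R := ℝ) (φ := fun _ : Fin (k + 1) => ℝ) (Fin.last k)).analyticAt 0
  have h2 := analyticAt_den (k := k) (c := c) h1 (analyticAt_const (v := U))
  refine h2.continuousAt.eventually_mem (Units.isOpen.mem_nhds ?_)
  rw [Pi.zero_apply, den_zero]
  exact isUnit_algebraMap hc

lemma analyticAt_nf (k : ℕ) (hc : c ≠ 0) : AnalyticAt ℝ (nf k c) 0 := by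
  have hproj : ∀ j, AnalyticAt ℝ (fun Y : Fin (k + 1) → ℝ => Y j) 0 := fun j =>
    (ContinuousLinearMap.proj (R := ℝ) (φ := fun _ : Fin (k + 1) => ℝ) j).analyticAt 0
  have hden := analyticAt_den (k := k) (c := c) (hproj (Fin.last k)) (analyticAt_const (v := U))
  unfold nf
  refine (analyticAt_pol (fun j => hproj _) analyticAt_const).fun_mul ?_
  obtain ⟨v, hv⟩ := (eventually_isUnit_den_U k hc).self_of_nhds
  refine AnalyticAt.fun_comp (g := Ring.inverse) ?_ hden
  rw [← hv]
  exact analyticAt_inverse v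

lemma nf_zero (hc : c ≠ 0) : nf k c 0 = model k c := by
  have : (fun j : Fin k => (0 : Fin (k + 1) → ℝ) j.castSucc) = 0 := rfl
  rw [nf, this, pol_zero, Pi.zero_apply, den_zero, inverse_algebraMap hc, mul_comm,
    ← Algebra.smul_def, model]

lemma isDeriv_zero : IsDeriv 0 0 := by simpa using isDeriv_algebraMap 0

lemma phi_repr {q q' : Wiener} (hq : IsDeriv q q') (y : Fin k → ℝ) (μ : ℝ) :
    phi k (cf (k + 1) q) (repr k c q q' y μ) = U + q := by
  rw [phi, add_assoc, xi_repr hq]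

lemma dphi_repr {q q' : Wiener} (hq : IsDeriv q q') (y : Fin k → ℝ) (μ : ℝ) :
    dphi k (cf (k + 1) q) (repr k c q q' y μ) = 1 + q' := by
  rw [dphi, add_assoc, dxi_repr hq]

/-- Any near-identity change `U + q` with any parameters lies in the chart `(τ, w)`: `τ` is the
`u^(k+1)`-coefficient of `q`. Thus the implicit function theorem sees every small solution. -/
lemma F_repr (hc : c ≠ 0) {q q' : Wiener} (hq : IsDeriv q q') (y : Fin k → ℝ) (μ : ℝ) (h : Wiener) :
    F k c ((h, cf (k + 1) q), repr k c q q' y μ) = defect c (U + q) (1 + q') y μ h := by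
  rw [F, phi_repr hq, dphi_repr hq, lowCf_repr, resCf_repr hc hq]

lemma tendsto_repr {α : Type*} {l : Filter α} {q q' : α → Wiener} {y : α → Fin k → ℝ} {μ : α → ℝ}
    (hq : Tendsto q l (𝓝 0)) (hq' : Tendsto q' l (𝓝 0)) (hy : Tendsto y l (𝓝 0))
    (hμ : Tendsto μ l (𝓝 0)) :
    Tendsto (fun a => repr k c (q a) (q' a) (y a) (μ a)) l (𝓝 0) := by
  have hcont : Continuous fun z : Wiener × Wiener × (Fin k → ℝ) × ℝ =>
      repr k c z.1 z.2.1 z.2.2.1 z.2.2.2 := by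
    unfold repr; fun_prop
  have := (hcont.tendsto 0).comp (hq.prodMk_nhds (hq'.prodMk_nhds (hy.prodMk_nhds hμ)))
  simpa [repr, Function.comp_def] using this

end Flow

/-- The flow of the normal forms: it is analytic in time and in the parameters, and every solution
near the identity of the equation for the self-conjugacies of a normal form comes from it. -/
theorem exists_flow {c : ℝ} (k : ℕ) (hc : c ≠ 0) :
    ∃ (g : ℝ × (Fin (k + 1) → ℝ) → ℝ) (Fl : ℝ × (Fin (k + 1) → ℝ) → Wiener),
      AnalyticAt ℝ g 0 ∧ g 0 = 0 ∧
      (∀ᶠ p in 𝓝 (0 : ℝ × (Fin (k + 1) → ℝ)), AnalyticAt ℝ Fl p ∧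
        IsUnit (den k c (p.2 (Fin.last k)) (Fl p)) ∧
        HasDerivAt (fun s => Fl (s, p.2)) (pol (fun j : Fin k => p.2 j.castSucc) (Fl p) *
          Ring.inverse (den k c (p.2 (Fin.last k)) (Fl p))) p.1 ∧
        ((∀ j : Fin k, p.2 j.castSucc = 0) → eval (0 : ℝ) (Fl p) = 0)) ∧
      (∀ᶠ Y in 𝓝 (0 : Fin (k + 1) → ℝ), Fl (0, Y) = U) ∧
      ∀ᶠ z in 𝓝 (0 : (ℝ × (Fin (k + 1) → ℝ)) × Wiener),
        F k c ((nf k c z.1.2, z.1.1), z.2) = 0 →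
          (lowCf k z.2 = fun j => z.1.2 j.castSucc) ∧ resCf k c z.2 = z.1.2 (Fin.last k) ∧
          Fl (g z.1, z.1.2) = phi k z.1.1 z.2 := by
  obtain ⟨W, hW0, huniq, hall⟩ := exists_slice_const k hc
  have hnf := analyticAt_nf k hc
  have hfst : AnalyticAt ℝ (fun p : ℝ × (Fin (k + 1) → ℝ) => p.1) 0 := analyticAt_fst
  have hnf' : AnalyticAt ℝ (fun p : ℝ × (Fin (k + 1) → ℝ) => nf k c p.2) 0 :=
    AnalyticAt.fun_comp (g := nf k c) (f := fun p : ℝ × (Fin (k + 1) → ℝ) => p.2)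
      (by simpa using hnf) analyticAt_snd
  have hι : AnalyticAt ℝ (fun p : ℝ × (Fin (k + 1) → ℝ) => (nf k c p.2, p.1)) 0 := hnf'.prod hfst
  have hιt : Tendsto (fun p : ℝ × (Fin (k + 1) → ℝ) => (nf k c p.2, p.1)) (𝓝 0)
      (𝓝 (model k c, 0)) := by
    have := hι.continuousAt.tendsto
    simpa [nf_zero hc] using this
  have hWι : AnalyticAt ℝ (fun p : ℝ × (Fin (k + 1) → ℝ) => W (nf k c p.2, p.1)) 0 := by
    refine AnalyticAt.fun_comp (g := W) (f := fun p : ℝ × (Fin (k + 1) → ℝ) => (nf k c p.2, p.1))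
      ?_ hι
    simpa [nf_zero hc] using hall.self_of_nhds.1
  have hall' := hιt.eventually hall
  -- the solution at time zero
  have hY0 : ∀ᶠ Y in 𝓝 (0 : Fin (k + 1) → ℝ),
      W (nf k c Y, 0) = repr k c 0 0 (fun j => Y j.castSucc) (Y (Fin.last k)) := by
    have ht : Tendsto (fun Y : Fin (k + 1) → ℝ =>
        repr k c 0 0 (fun j => Y j.castSucc) (Y (Fin.last k))) (𝓝 0) (𝓝 0) :=
      tendsto_repr tendsto_const_nhds tendsto_const_nhds
        (Continuous.tendsto' (by fun_prop) _ _ rfl) (Continuous.tendsto' (by fun_prop) _ _ rfl)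
    have hnft : Tendsto (nf k c) (𝓝 0) (𝓝 (model k c)) := by
      simpa [nf_zero hc] using hnf.continuousAt.tendsto
    have ht2 := (hnft.prodMk_nhds (tendsto_const_nhds (x := (0 : ℝ)))).prodMk_nhds ht
    filter_upwards [ht2.eventually huniq, eventually_isUnit_den_U k hc] with Y h1 h2
    refine h1 ?_
    have h3 := F_repr hc isDeriv_zero (fun j => Y j.castSucc) (Y (Fin.last k)) (nf k c Y)
    rw [map_zero] at h3
    rw [h3, defect, add_zero, add_zero, one_mul, nf, mul_assoc, Ring.inverse_mul_cancel _ h2,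
      mul_one, sub_self]
  have hY0' := (continuous_snd.tendsto (0 : ℝ × (Fin (k + 1) → ℝ))).eventually hY0
  -- The identity conjugates `nf k c Y` to itself, so its parameters at `τ = 0` are `Y`; they stay
  -- constant in `τ`.
  have hpar : ∀ᶠ p in 𝓝 (0 : ℝ × (Fin (k + 1) → ℝ)),
      (lowCf k (W (nf k c p.2, p.1)) = fun j => p.2 j.castSucc) ∧
        resCf k c (W (nf k c p.2, p.1)) = p.2 (Fin.last k) := by
    filter_upwards [hall', hY0'] with p h1 h2
    obtain ⟨-, -, h3, h4, -⟩ := h1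
    rw [h3, h4]
    simp only [h2]
    exact ⟨lowCf_repr c _ _ _ _, resCf_repr hc isDeriv_zero _ _⟩
  -- the time function
  set vel : ℝ × (Fin (k + 1) → ℝ) → ℝ := fun p =>
    cf (k + 1) (field k c p.1 (W (nf k c p.2, p.1))) with hvel
  have hvel0 : ∀ᶠ p in 𝓝 (0 : ℝ × (Fin (k + 1) → ℝ)), vel p ≠ 0 :=
    hall'.mono fun p hp => hp.2.2.2.2.2.1
  have hvelan : AnalyticAt ℝ (fun p => (vel p)⁻¹) 0 :=
    (analyticAt_cf _ (analyticAt_field hfst hWι hall'.self_of_nhds.2.2.2.2.1)).fun_inv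
      hvel0.self_of_nhds
  -- The coordinate change moves by `N/vel` per unit of `τ`, so the time needed to reach `τ` is the
  -- integral of `1/vel`.
  obtain ⟨g, hgan, hg0, hgd⟩ := exists_primitive hvelan
  -- the inverse of the time function
  set f : (ℝ × (Fin (k + 1) → ℝ)) × ℝ → ℝ := fun z => g (z.2, z.1.2) - z.1.1 with hf
  have hfan : AnalyticAt ℝ f 0 := by
    have h1 : AnalyticAt ℝ (fun z : (ℝ × (Fin (k + 1) → ℝ)) × ℝ => z.1) 0 := analyticAt_fst
    have h2 : AnalyticAt ℝ (fun z : (ℝ × (Fin (k + 1) → ℝ)) × ℝ => z.2) 0 := analyticAt_snd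
    have h3 : AnalyticAt ℝ (fun z : (ℝ × (Fin (k + 1) → ℝ)) × ℝ => z.1.1) 0 :=
      AnalyticAt.fun_comp (g := fun p : ℝ × (Fin (k + 1) → ℝ) => p.1) analyticAt_fst h1
    have h4 : AnalyticAt ℝ (fun z : (ℝ × (Fin (k + 1) → ℝ)) × ℝ => z.1.2) 0 :=
      AnalyticAt.fun_comp (g := fun p : ℝ × (Fin (k + 1) → ℝ) => p.2) analyticAt_snd h1
    exact (AnalyticAt.fun_comp (g := g) (f := fun z : (ℝ × (Fin (k + 1) → ℝ)) × ℝ => (z.2, z.1.2))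
      hgan (h2.prod h4)).fun_sub h3
  have hfC : ContDiffAt ℝ ⊤ f 0 := hfan.contDiffAt
  have hfd : (fderiv ℝ f 0 ∘L .inr ℝ (ℝ × (Fin (k + 1) → ℝ)) ℝ) 1 = (vel 0)⁻¹ := by
    have h1 : HasDerivAt (fun t : ℝ => ((0 : ℝ × (Fin (k + 1) → ℝ)), t)) (0, 1) 0 :=
      (hasDerivAt_const _ _).prodMk (hasDerivAt_id _)
    have h2 : HasFDerivAt f (fderiv ℝ f 0) ((0 : ℝ × (Fin (k + 1) → ℝ)), (0 : ℝ)) :=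
      hfan.differentiableAt.hasFDerivAt
    have h3 := h2.comp_hasDerivAt (0 : ℝ) h1
    have h4 := hgd.self_of_nhds.sub_const 0
    exact h3.unique h4
  have hinv : (fderiv ℝ f 0 ∘L .inr ℝ (ℝ × (Fin (k + 1) → ℝ)) ℝ).IsInvertible := by
    have h0 : (vel 0)⁻¹ ≠ 0 := inv_ne_zero hvel0.self_of_nhds
    refine ⟨ContinuousLinearEquiv.unitsEquivAut ℝ (Units.mk0 _ h0), ?_⟩
    refine ContinuousLinearMap.ext_ring ?_
    rw [hfd]
    simp
  have hn : (⊤ : WithTop ℕ∞) ≠ 0 := by simp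
  set θ := hfC.implicitFunction hn hinv with hθ
  have hθ0 : θ 0 = 0 := hfC.implicitFunction_apply_self hn hinv
  have hθan : AnalyticAt ℝ θ 0 := (hfC.contDiffAt_implicitFunction hn hinv).analyticAt
  have hf0 : f 0 = 0 := by simp only [hf, Prod.fst_zero, Prod.snd_zero, hg0, sub_self]
  have hθiff := hfC.eventually_apply_eq_iff_implicitFunction hn hinv
  have hθsol := hfC.eventually_apply_implicitFunction hn hinv
  rw [hf0] at hθiff hθsol
  have hjan : AnalyticAt ℝ (fun p : ℝ × (Fin (k + 1) → ℝ) => (θ p, p.2)) 0 :=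
    hθan.prod analyticAt_snd
  have hjt : Tendsto (fun p : ℝ × (Fin (k + 1) → ℝ) => (θ p, p.2)) (𝓝 0) (𝓝 0) := by
    have := hjan.continuousAt.tendsto
    simpa only [hθ0, Prod.snd_zero, Prod.mk_zero_zero] using this
  set Ψ : ℝ × (Fin (k + 1) → ℝ) → Wiener := fun p => phi k p.1 (W (nf k c p.2, p.1)) with hΨ
  have hΨan : AnalyticAt ℝ Ψ 0 := analyticAt_phi hfst hWι
  have hFlan : AnalyticAt ℝ (fun p => Ψ (θ p, p.2)) 0 :=
    AnalyticAt.fun_comp (g := Ψ) (f := fun p : ℝ × (Fin (k + 1) → ℝ) => (θ p, p.2))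
      (by simpa only [hθ0, Prod.snd_zero, Prod.mk_zero_zero] using hΨan) hjan
  have hθzero : ∀ᶠ Y in 𝓝 (0 : Fin (k + 1) → ℝ), θ (0, Y) = 0 := by
    have ht : Tendsto (fun Y : Fin (k + 1) → ℝ => (((0 : ℝ), Y), (0 : ℝ))) (𝓝 0) (𝓝 0) :=
      Continuous.tendsto' (by fun_prop) _ _ rfl
    filter_upwards [ht.eventually hθiff] with Y hY
    exact hY.1 (by simp only [hf, hg0, sub_self])
  refine ⟨g, fun p => Ψ (θ p, p.2), hgan, hg0 0, ?_, ?_, ?_⟩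
  · have hsolN := hθsol.eventually_nhds
    filter_upwards [hFlan.eventually_analyticAt, hsolN, hθan.eventually_analyticAt,
      hjt.eventually hall', hjt.eventually hpar, hjt.eventually hgd, hjt.eventually hvel0]
      with p h1 h2 h3 h4 h5 h6 h7
    obtain ⟨-, hFz, -, -, hu, hv, w', hw', hfl⟩ := h4
    obtain ⟨s, Y⟩ := p
    simp only at hFz hu hv hw' hfl h5 h6 ⊢
    refine ⟨h1, by rw [← h5.2]; exact hu, ?_, ?_⟩
    · -- the derivative in time
      have hline : HasDerivAt (fun s : ℝ => (s, Y)) (1, 0) s :=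
        (hasDerivAt_id s).prodMk (hasDerivAt_const s Y)
      have hθd : HasDerivAt (fun s => θ (s, Y)) (fderiv ℝ θ (s, Y) (1, 0)) s :=
        h3.differentiableAt.hasFDerivAt.comp_hasDerivAt s hline
      set θ' := fderiv ℝ θ (s, Y) (1, 0)
      have hone : (vel (θ (s, Y), Y))⁻¹ * θ' = 1 := by
        have e1 := h6.comp s hθd
        refine e1.unique ((hasDerivAt_id s).congr_of_eventuallyEq ?_)
        filter_upwards [hline.continuousAt.tendsto.eventually h2] with s' hs'
        exact sub_eq_zero.1 hs'
      have hθ' : θ' = vel (θ (s, Y), Y) := by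
        field_simp at hone
        exact hone
      have hphi : HasDerivAt (fun τ => Ψ (τ, Y)) (xi k w' + (1 : ℝ) • U ^ (k + 1)) (θ (s, Y)) := by
        have e1 := ((xi k).hasFDerivAt.comp_hasDerivAt _ hw').const_add U
        exact e1.fun_add ((hasDerivAt_id _).smul_const _)
      have e2 := hphi.scomp s hθd
      refine e2.congr_deriv ?_
      rw [one_smul, hθ']
      refine hfl.trans ?_
      rw [field, h5.1, h5.2]
    -- When `y = 0` the vector field vanishes at `u = 0`, and the conjugacy equation there reads
    -- `φ(0)^(k+1) = 0`.
    · intro hY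
      rw [F, defect, h5.1] at hFz
      have hy : (fun j : Fin k => Y j.castSucc) = 0 := funext hY
      rw [hy, pol_zero] at hFz
      have h0 : ‖(0 : ℝ)‖ ≤ 1 := by simp
      have hr0 : eval (0 : ℝ) (nf k c Y) = 0 := by
        rw [nf, hy, pol_zero, pow_succ', mul_assoc, eval_mul h0, eval_U, zero_mul]
      have hz := congrArg (evalHom (0 : ℝ) h0) (sub_eq_zero.1 hFz)
      simp only [map_pow, map_mul, evalHom_apply, hr0, zero_mul, mul_zero] at hz
      exact pow_eq_zero_iff (Nat.succ_ne_zero k) |>.1 hz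
  · filter_upwards [hY0, hθzero] with Y h1 h2
    have h3 := phi_repr (c := c) isDeriv_zero (fun j : Fin k => Y j.castSucc) (Y (Fin.last k))
    rw [map_zero, add_zero] at h3
    simp only [hΨ, h2, h1, h3]
  · have ht1 : Tendsto (fun z : (ℝ × (Fin (k + 1) → ℝ)) × Wiener => ((nf k c z.1.2, z.1.1), z.2))
        (𝓝 0) (𝓝 ((model k c, 0), 0)) :=
      (hιt.comp (continuous_fst.tendsto' (0 : (ℝ × (Fin (k + 1) → ℝ)) × Wiener) 0 rfl)).prodMk_nhds
        (continuous_snd.tendsto' _ _ rfl)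
    have ht2 : Tendsto (fun z : (ℝ × (Fin (k + 1) → ℝ)) × Wiener => z.1) (𝓝 0) (𝓝 0) :=
      continuous_fst.tendsto' _ _ rfl
    have ht3 : Tendsto (fun z : (ℝ × (Fin (k + 1) → ℝ)) × Wiener => ((g z.1, z.1.2), z.1.1)) (𝓝 0)
        (𝓝 0) := by
      have e1 : Tendsto (fun z : (ℝ × (Fin (k + 1) → ℝ)) × Wiener => g z.1) (𝓝 0) (𝓝 0) := by
        have := hgan.continuousAt.tendsto
        have h00 : g 0 = 0 := hg0 0
        rw [h00] at this
        exact this.comp ht2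
      exact (e1.prodMk_nhds (Continuous.tendsto' (by fun_prop) _ _ rfl)).prodMk_nhds
        (Continuous.tendsto' (by fun_prop) _ _ rfl)
    filter_upwards [ht1.eventually huniq, ht2.eventually hpar, ht3.eventually hθiff]
      with z h1 h2 h3 hz
    have hw := h1 hz
    have hτ : θ (g z.1, z.1.2) = z.1.1 := h3.1 (by simp only [hf, sub_self])
    rw [hw] at h2
    refine ⟨h2.1, h2.2, ?_⟩
    simp only [hΨ, hτ, hw]

/-! ### Blowing up a germ at the origin. -/

namespace Wiener

/-- Division by the variable. -/
def shift : Wiener →L[ℝ] Wiener :=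
  cfOp (fun _ => 1) (fun n => n + 1) 1 (fun _ => by simp) (add_left_injective 1)

lemma cf_shift (f : Wiener) (n : ℕ) : cf n (shift f) = cf (n + 1) f := by simp [shift]

lemma eval_eq_add_shift {u : ℝ} (hu : ‖u‖ ≤ 1) (f : Wiener) :
    eval u f = cf 0 f + u * eval u (shift f) := by
  have h : f = algebraMap ℝ Wiener (cf 0 f) + U * shift f := by
    refine ext_cf fun n => ?_
    have := cf_U_pow_mul 1 n (shift f)
    rw [pow_one] at this
    rw [map_add, this, Algebra.algebraMap_eq_smul_one, map_smul, cf_one, cf_shift]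
    rcases n with _ | n <;> simp
  conv_lhs => rw [h]
  rw [eval_add hu, eval_mul hu, eval_U]
  congr 1
  exact (evalHom u hu).commutes _

lemma eval_zero (f : Wiener) : eval (0 : ℝ) f = cf 0 f := by
  rw [eval_eq_add_shift (by simp), zero_mul, add_zero]

lemma continuousAt_eval (f : Wiener) : ContinuousAt (fun u : ℝ => eval u f) 0 :=
  (hasFPowerSeriesAt_eval f).continuousAt

lemma eventually_norm_le_one (E : Type*) [NormedAddCommGroup E] : ∀ᶠ u in 𝓝 (0 : E), ‖u‖ ≤ 1 := by
  filter_upwards [Metric.closedBall_mem_nhds (0 : E) one_pos] with u hu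
  exact mem_closedBall_zero_iff.1 hu

/-- The punctured neighbourhood lets each induction step cancel one factor `u`. -/
lemma cf_of_eval_eq_pow_mul {r : ℝ → ℝ} (hr : ContinuousAt r 0) (N : ℕ) :
    ∀ {f : Wiener}, (∀ᶠ u in 𝓝[≠] (0 : ℝ), eval u f = u ^ N * r u) →
      (∀ n < N, cf n f = 0) ∧ cf N f = r 0 := by
  induction N with
  | zero =>
    intro f hf
    refine ⟨fun n hn => absurd hn (Nat.not_lt_zero n), ?_⟩
    rw [← eval_zero]
    refine tendsto_nhds_unique ((continuousAt_eval f).tendsto.mono_left nhdsWithin_le_nhds)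
      ((hr.tendsto.mono_left nhdsWithin_le_nhds).congr' (hf.mono fun u hu => ?_))
    simp only [hu, pow_zero, one_mul]
  | succ N ih =>
    intro f hf
    have h0 : cf 0 f = 0 := by
      rw [← eval_zero]
      have h1 : Tendsto (fun u : ℝ => u ^ (N + 1) * r u) (𝓝[≠] 0) (𝓝 0) := by
        have : ContinuousAt (fun u : ℝ => u ^ (N + 1) * r u) 0 := by fun_prop
        have h2 := this.tendsto.mono_left (nhdsWithin_le_nhds (s := {0}ᶜ))
        simpa using h2
      exact tendsto_nhds_unique ((continuousAt_eval f).tendsto.mono_left nhdsWithin_le_nhds)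
        (h1.congr' (hf.mono fun u hu => hu.symm))
    have hs : ∀ᶠ u in 𝓝[≠] (0 : ℝ), eval u (shift f) = u ^ N * r u := by
      have hb : ∀ᶠ u in 𝓝[≠] (0 : ℝ), ‖u‖ ≤ 1 :=
        nhdsWithin_le_nhds (eventually_norm_le_one ℝ)
      filter_upwards [hf, hb, self_mem_nhdsWithin] with u hu hu1 hu0
      rw [eval_eq_add_shift hu1, h0, zero_add, pow_succ'] at hu
      have hu0' : u ≠ 0 := hu0
      exact mul_left_cancel₀ hu0' (by rw [hu, mul_assoc])
    obtain ⟨h1, h2⟩ := ih hs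
    refine ⟨fun n hn => ?_, by rw [← cf_shift, h2]⟩
    rcases n with _ | n
    · exact h0
    · rw [← cf_shift]; exact h1 n (by omega)

/-- The derivative after the substitution `u ↦ u / 2`. -/
def halfDeriv : Wiener →L[ℝ] Wiener :=
  cfOp (fun n => ((n : ℝ) + 1) * (1 / 2) ^ (n + 1)) (fun n => n + 1) 1 (fun n => by
    rw [Real.norm_of_nonneg (by positivity)]
    have h : ((n : ℝ) + 1) ≤ 2 ^ (n + 1) := by exact_mod_cast (Nat.lt_two_pow_self (n := n + 1)).le
    rw [one_div, inv_pow, ← div_eq_mul_inv, div_le_one (by positivity)]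
    exact h) (add_left_injective 1)

lemma isDeriv_halfDeriv (f : Wiener) (h : |(1 / 2 : ℝ)| ≤ 1) :
    IsDeriv (scale (1 / 2) h f) (halfDeriv f) := by
  rw [isDeriv_iff]
  intro n
  rw [cf_scale, halfDeriv, cf_cfOp]
  ring

lemma eval_smul {𝕜 : Type*} [RCLike 𝕜] (r : ℝ) (f : Wiener) (u : 𝕜) :
    eval u (r • f) = (r : 𝕜) * eval u f := by
  rw [eval, eval, ← tsum_mul_left]
  exact tsum_congr fun n => by rw [map_smul, smul_eq_mul, RCLike.ofReal_mul, mul_assoc]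

lemma tendsto_scale {N : ℕ} {f : Wiener} (h : ∀ n < N, cf n f = 0) (D : ℝ → Wiener →L[ℝ] Wiener)
    (hD : ∀ δ (hδ : |δ| ≤ 1), D δ = scale δ hδ) :
    Tendsto (fun δ : ℝ => (δ ^ N)⁻¹ • D δ f) (𝓝[>] 0) (𝓝 (cf N f • U ^ N)) := by
  rw [tendsto_iff_norm_sub_tendsto_zero]
  have h1 : Tendsto (fun δ : ℝ => δ * ‖f‖) (𝓝[>] 0) (𝓝 0) := by
    have : Tendsto (fun δ : ℝ => δ * ‖f‖) (𝓝 0) (𝓝 (0 * ‖f‖)) := by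
      exact (tendsto_id.mul_const _)
    rw [zero_mul] at this
    exact this.mono_left nhdsWithin_le_nhds
  refine tendsto_of_tendsto_of_tendsto_of_le_of_le' tendsto_const_nhds h1
    (Eventually.of_forall fun _ => norm_nonneg _) ?_
  filter_upwards [Ioc_mem_nhdsGT (zero_lt_one' ℝ)] with δ hδ
  have hδ1 : |δ| ≤ 1 := by rw [abs_of_pos hδ.1]; exact hδ.2
  rw [hD δ hδ1]
  exact norm_scale_sub_le h hδ.1 hδ1

end Wiener

/-- The expansion of a real analytic germ in small discs, rescaled by the order `N` of its
restriction to `l = 0`. -/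
theorem exists_small_expansion {m : ℕ} {f : ℝ × (Fin m → ℝ) → ℝ} (hf : AnalyticAt ℝ f 0) :
    ∃ F : ℂ × (Fin m → ℂ) → ℂ, IsComplexification F f ∧
      ∀ (N : ℕ) (r : ℝ → ℝ), ContinuousAt r 0 → (∀ᶠ x in 𝓝 0, f (x, 0) = x ^ (N + 1) * r x) →
        ∃ h h' : ℝ → (Fin m → ℝ) → Wiener,
          (∀ᶠ e in 𝓝[>] (0 : ℝ), AnalyticAt ℝ (h e) 0 ∧ AnalyticAt ℝ (h' e) 0 ∧
            (∀ l, IsDeriv (h e l) (h' e l)) ∧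
            ∀ᶠ l in 𝓝 0,
              (∀ u : ℂ, ‖u‖ ≤ 1 →
                F (e * u, fun i => (l i : ℂ)) = (e : ℂ) ^ (N + 1) * eval u (h e l)) ∧
              ∀ u : ℝ, ‖u‖ ≤ 1 → f (e * u, l) = e ^ (N + 1) * eval u (h e l)) ∧
          Tendsto (fun e => h e 0) (𝓝[>] 0) (𝓝 (r 0 • U ^ (N + 1))) ∧
          Tendsto (fun e => h' e 0) (𝓝[>] 0) (𝓝 ((((N : ℝ) + 1) * r 0) • U ^ N)) := by
  obtain ⟨F, hF, e₀, he₀, Φ₀, hΦ₀, hev₀⟩ := exists_expansion hf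
  refine ⟨F, hF, fun N r hr hord => ?_⟩
  have hhalf : |(1 / 2 : ℝ)| ≤ 1 := by rw [abs_of_pos] <;> norm_num
  -- On half the radius differentiation is a bounded operator, since `(n+1) / 2^(n+1) ≤ 1`; hence
  -- the derivative is again analytic in `λ`.
  set e₁ : ℝ := e₀ * (1 / 2) with he₁def
  have he₁ : 0 < e₁ := by positivity
  set Φ : (Fin m → ℝ) → Wiener := fun l => scale (1 / 2) hhalf (Φ₀ l) with hΦdef
  set Φ' : (Fin m → ℝ) → Wiener := fun l => halfDeriv (Φ₀ l) with hΦ'def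
  have hΦ : AnalyticAt ℝ Φ 0 := (ContinuousLinearMap.analyticAt _ _).fun_comp hΦ₀
  have hΦ' : AnalyticAt ℝ Φ' 0 := (ContinuousLinearMap.analyticAt _ _).fun_comp hΦ₀
  have hder : ∀ l, IsDeriv (Φ l) (Φ' l) := fun l => isDeriv_halfDeriv _ _
  have hev : ∀ᶠ l in 𝓝 0,
      (∀ u : ℂ, ‖u‖ ≤ 1 → F (e₁ * u, fun i => (l i : ℂ)) = eval u (Φ l)) ∧
      ∀ u : ℝ, ‖u‖ ≤ 1 → f (e₁ * u, l) = eval u (Φ l) := by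
    filter_upwards [hev₀] with l hl
    constructor
    · intro u hu
      rw [hΦdef, eval_scale, ← hl.1]
      · congr 2
        rw [he₁def]; push_cast; ring
      · rw [norm_mul]
        have : ‖(((1 / 2 : ℝ) : ℝ) : ℂ)‖ = 1 / 2 := by simp
        change ‖(((1 / 2 : ℝ) : ℝ) : ℂ)‖ * ‖u‖ ≤ 1
        rw [this]; linarith
    · intro u hu
      rw [hΦdef, eval_scale, ← hl.2]
      · congr 2
        rw [he₁def, mul_assoc]; rfl
      · rw [norm_mul]
        change ‖(1 / 2 : ℝ)‖ * ‖u‖ ≤ 1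
        rw [Real.norm_of_nonneg (by norm_num)]; linarith
  have hcf : (∀ n < N + 1, cf n (Φ 0) = 0) ∧ cf (N + 1) (Φ 0) = e₁ ^ (N + 1) * r 0 := by
    have hr' : ContinuousAt (fun u => e₁ ^ (N + 1) * r (e₁ * u)) 0 := by
      have : ContinuousAt (fun u => r (e₁ * u)) 0 :=
        ContinuousAt.comp (g := r) (by simpa using hr) (by fun_prop)
      exact this.const_mul _
    have := cf_of_eval_eq_pow_mul hr' (N + 1) (f := Φ 0) ?_
    · simpa using this
    have ht : Tendsto (fun u : ℝ => e₁ * u) (𝓝 0) (𝓝 0) :=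
      Continuous.tendsto' (by fun_prop) _ _ (by simp)
    have hb := eventually_norm_le_one ℝ
    refine nhdsWithin_le_nhds ?_
    filter_upwards [ht.eventually hord, hb] with u hu hu1
    rw [← hev.self_of_nhds.2 u hu1, hu]
    ring
  have hcf' : (∀ n < N, cf n (Φ' 0) = 0) ∧ cf N (Φ' 0) = ((N : ℝ) + 1) * (e₁ ^ (N + 1) * r 0) := by
    constructor
    · intro n hn
      rw [isDeriv_iff.1 (hder 0), hcf.1 _ (by omega), mul_zero]
    · rw [isDeriv_iff.1 (hder 0), hcf.2]
  -- `scale` requires `|δ| ≤ 1`; the default value is irrelevant because `δ = e / e₁` tends to zero.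
  set D : ℝ → Wiener →L[ℝ] Wiener := fun δ => if hδ : |δ| ≤ 1 then scale δ hδ else 0 with hD
  have hDs : ∀ δ (hδ : |δ| ≤ 1), D δ = scale δ hδ := fun δ hδ => by rw [hD]; exact dif_pos hδ
  have hδt : Tendsto (fun e : ℝ => e / e₁) (𝓝[>] 0) (𝓝[>] 0) := by
    refine tendsto_nhdsWithin_iff.2 ⟨?_, ?_⟩
    · exact (Continuous.tendsto' (by fun_prop) _ _ (by simp)).mono_left nhdsWithin_le_nhds
    · filter_upwards [self_mem_nhdsWithin] with e he
      exact div_pos he he₁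
  refine ⟨fun e l => (e ^ (N + 1))⁻¹ • D (e / e₁) (Φ l),
    fun e l => (e ^ (N + 1))⁻¹ • ((e / e₁) • D (e / e₁) (Φ' l)), ?_, ?_, ?_⟩
  · filter_upwards [hδt.eventually (Ioc_mem_nhdsGT (zero_lt_one' ℝ)), self_mem_nhdsWithin]
      with e hδ he
    have he0 : (0 : ℝ) < e := he
    have hδ1 : |e / e₁| ≤ 1 := by rw [abs_of_pos hδ.1]; exact hδ.2
    have hmul : e₁ * (e / e₁) = e := by field_simp
    rw [hDs _ hδ1]
    refine ⟨?_, ?_, fun l => ((hder l).scale _ hδ1).smul _, ?_⟩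
    · exact analyticAt_const.fun_smul ((ContinuousLinearMap.analyticAt _ _).fun_comp hΦ)
    · exact analyticAt_const.fun_smul
        (analyticAt_const.fun_smul ((ContinuousLinearMap.analyticAt _ _).fun_comp hΦ'))
    · filter_upwards [hev] with l hl
      constructor
      · intro u hu
        have hu' : ‖((e / e₁ : ℝ) : ℂ) * u‖ ≤ 1 := by
          rw [norm_mul, Complex.norm_real, Real.norm_eq_abs]
          exact mul_le_one₀ hδ1 (norm_nonneg _) hu
        have h1 := hl.1 _ hu'
        rw [← mul_assoc, ← Complex.ofReal_mul, hmul] at h1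
        rw [eval_smul, eval_scale, h1]
        have h2 : ((e : ℂ) ^ (N + 1)) ≠ 0 := pow_ne_zero _ (by exact_mod_cast he0.ne')
        have h3 : (((e ^ (N + 1))⁻¹ : ℝ) : ℂ) = ((e : ℂ) ^ (N + 1))⁻¹ := by push_cast; rfl
        exact ((congrArg (fun z => (e : ℂ) ^ (N + 1) * (z * _)) h3).trans
          (mul_inv_cancel_left₀ h2 _)).symm
      · intro u hu
        have hu' : ‖(e / e₁) * u‖ ≤ 1 := by
          rw [norm_mul, Real.norm_eq_abs]
          exact mul_le_one₀ hδ1 (norm_nonneg _) hu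
        have h1 := hl.2 _ hu'
        rw [← mul_assoc, hmul] at h1
        rw [eval_smul, eval_scale, h1]
        simp only [RCLike.ofReal_real_eq_id, id]
        rw [mul_inv_cancel_left₀ (pow_ne_zero _ he0.ne')]
  · have h1 := ((tendsto_scale hcf.1 D hDs).comp hδt).const_smul ((e₁ ^ (N + 1))⁻¹)
    have e2 : (e₁ ^ (N + 1))⁻¹ • cf (N + 1) (Φ 0) • U ^ (N + 1) = r 0 • U ^ (N + 1) := by
      rw [hcf.2, smul_smul, inv_mul_cancel_left₀ (pow_ne_zero _ he₁.ne')]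
    rw [e2] at h1
    refine h1.congr' ?_
    filter_upwards [self_mem_nhdsWithin] with e he
    have he0 : (0 : ℝ) < e := he
    simp only [Function.comp, smul_smul]
    congr 1
    rw [div_pow]; field_simp
  · have h1 := ((tendsto_scale hcf'.1 D hDs).comp hδt).const_smul ((e₁ ^ (N + 1))⁻¹)
    have e2 : (e₁ ^ (N + 1))⁻¹ • cf N (Φ' 0) • U ^ N = (((N : ℝ) + 1) * r 0) • U ^ N := by
      rw [hcf'.2, smul_smul]
      congr 1
      field_simp
    rw [e2] at h1
    refine h1.congr' ?_
    filter_upwards [self_mem_nhdsWithin] with e he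
    have he0 : (0 : ℝ) < e := he
    simp only [Function.comp, smul_smul]
    congr 1
    rw [div_pow]; field_simp; ring

/-! ### Centred polynomials and pointwise evaluation of the equation. -/

section NumPoly

variable {K : Type*} [Field K] {k : ℕ}

open Polynomial in
/-- The polynomial `x^{k+1} + y_{k-1} x^{k-1} + … + y_0`. -/
def numPoly (y : Fin k → K) : Polynomial K := X ^ (k + 1) + ∑ j : Fin k, C (y j) * X ^ (j : ℕ)

open Polynomial

lemma eval_numPoly (y : Fin k → K) (x : K) :
    (numPoly y).eval x = x ^ (k + 1) + ∑ j : Fin k, y j * x ^ (j : ℕ) := by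
  simp [numPoly, eval_finsetSum]

lemma degree_sum_lt (y : Fin k → K) :
    (∑ j : Fin k, C (y j) * X ^ (j : ℕ)).degree < ((k + 1 : ℕ) : WithBot ℕ) :=
  (degree_sum_fin_lt y).trans (by exact_mod_cast Nat.lt_succ_self k)

lemma monic_numPoly (y : Fin k → K) : (numPoly y).Monic :=
  monic_X_pow_add (degree_sum_fin_lt y |>.trans (by exact_mod_cast Nat.lt_succ_self k))

lemma natDegree_numPoly (y : Fin k → K) : (numPoly y).natDegree = k + 1 := by
  refine natDegree_eq_of_degree_eq_some ?_
  rw [numPoly, degree_add_eq_left_of_degree_lt]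
  · exact degree_X_pow _
  · rw [degree_X_pow]; exact degree_sum_lt y

lemma coeff_numPoly_self (y : Fin k → K) : (numPoly y).coeff k = 0 := by
  rw [numPoly, coeff_add, coeff_X_pow, if_neg (by omega), zero_add]
  exact coeff_eq_zero_of_degree_lt (degree_sum_fin_lt y)

lemma coeff_numPoly (y : Fin k → K) (j : Fin k) : (numPoly y).coeff j = y j := by
  have hj := j.2
  rw [numPoly, coeff_add, coeff_X_pow, if_neg (by omega), zero_add, finsetSum_coeff]
  simp only [coeff_C_mul, coeff_X_pow, mul_ite, mul_one, mul_zero]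
  rw [Finset.sum_eq_single j]
  · simp
  · intro i _ hi
    rw [if_neg]
    exact fun h => hi (Fin.ext h.symm)
  · simp

/-- A centred monic polynomial of degree `k + 1` which vanishes to order `k + 1` along an
immersed germ is `x^{k+1}`, and the germ is centred at the origin. -/
lemma eq_X_pow_of_eval_comp {φ R : ℝ → ℝ} {v : ℝ} (hφ : HasDerivAt φ v 0) (hv : v ≠ 0)
    (hR : ContinuousAt R 0) {p : ℝ[X]} (hp : p.Monic) (hdeg : p.natDegree = k + 1)
    (hcoeff : p.coeff k = 0) (h : ∀ᶠ u in 𝓝 0, p.eval (φ u) = u ^ (k + 1) * R u) :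
    φ 0 = 0 ∧ p = X ^ (k + 1) := by
  have hdvd : ∀ i ≤ k + 1, (X - C (φ 0)) ^ i ∣ p := by
    intro i
    induction i with
    | zero => intro _; simp
    | succ i ih =>
      intro hi
      obtain ⟨q, hq⟩ := ih (by omega)
      -- Dividing `p(φ(u)) = u^(k+1) R(u)` by `u^i` with `i ≤ k` makes the right side tend to zero,
      -- while the left side tends to `v^i q(φ(0))`.
      have hslope : Tendsto (fun u => slope φ 0 u ^ i * q.eval (φ u)) (𝓝[≠] 0)
          (𝓝 (v ^ i * q.eval (φ 0))) :=
        (hφ.tendsto_slope.pow i).mul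
          (((q.continuous.tendsto _).comp hφ.continuousAt.tendsto).mono_left nhdsWithin_le_nhds)
      have hzero : Tendsto (fun u => u ^ (k + 1 - i) * R u) (𝓝[≠] 0) (𝓝 0) := by
        have h1 : ContinuousAt (fun u => u ^ (k + 1 - i) * R u) 0 := by fun_prop
        have h2 := h1.tendsto.mono_left (nhdsWithin_le_nhds (s := {0}ᶜ))
        simpa [show k + 1 - i ≠ 0 by omega] using h2
      have heq : v ^ i * q.eval (φ 0) = 0 := by
        refine tendsto_nhds_unique hslope (hzero.congr' ?_)
        filter_upwards [nhdsWithin_le_nhds h, self_mem_nhdsWithin] with u hu hu0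
        have hu0' : u ≠ 0 := hu0
        rw [hq, Polynomial.eval_mul, Polynomial.eval_pow, eval_sub, eval_X, eval_C,
          show k + 1 = i + (k + 1 - i) by omega, pow_add, mul_assoc] at hu
        rw [slope_def_field, sub_zero, div_pow, div_mul_eq_mul_div, hu]
        field_simp
      have hroot : q.IsRoot (φ 0) := by
        simpa [pow_ne_zero i hv] using heq
      rw [hq, pow_succ]
      exact mul_dvd_mul_left _ (dvd_iff_isRoot.2 hroot)
  obtain ⟨q, hq⟩ := hdvd (k + 1) le_rfl
  have hm : ((X - C (φ 0)) ^ (k + 1)).Monic := (monic_X_sub_C _).pow _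
  have hq1 : q = 1 := by
    have hqm : q.Monic := hm.of_mul_monic_left (hq ▸ hp)
    have := hm.natDegree_mul hqm
    rw [← hq, hdeg, natDegree_pow, natDegree_X_sub_C] at this
    exact hqm.natDegree_eq_zero.1 (by omega)
  rw [hq1, mul_one] at hq
  -- The coefficient of `x^k` in `(x - a)^(k+1)` is `-(k+1) a`, and it vanishes by centring.
  have h0 : φ 0 = 0 := by
    rw [hq, sub_eq_add_neg, ← C_neg, coeff_X_add_C_pow, Nat.add_sub_cancel_left, pow_one, Nat.choose_succ_self_right] at hcoeff
    have : ((k + 1 : ℕ) : ℝ) ≠ 0 := by positivity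
    simpa using (mul_eq_zero.1 hcoeff).resolve_right this
  refine ⟨h0, ?_⟩
  rw [hq, h0, C_0, sub_zero]

end NumPoly

section Evaluation

variable {𝕜 : Type*} [RCLike 𝕜] {k : ℕ} {c : ℝ} {u : 𝕜}

lemma eval_pow (hu : ‖u‖ ≤ 1) (f : Wiener) (n : ℕ) : eval u (f ^ n) = eval u f ^ n := by
  have := map_pow (evalHom u hu) f n
  simpa only [evalHom_apply] using this

lemma eval_algebraMap (hu : ‖u‖ ≤ 1) (a : ℝ) : eval u (algebraMap ℝ Wiener a) = (a : 𝕜) := by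
  have := (evalHom u hu).commutes a
  rwa [evalHom_apply] at this

lemma eval_pol (hu : ‖u‖ ≤ 1) (y : Fin k → ℝ) (x : Wiener) :
    eval u (pol y x) = eval u x ^ (k + 1) + ∑ j : Fin k, (y j : 𝕜) * eval u x ^ (j : ℕ) := by
  have h := map_sum (evalHom u hu) (fun j : Fin k => y j • x ^ (j : ℕ)) Finset.univ
  simp only [evalHom_apply] at h
  rw [pol, eval_add hu, eval_pow hu, h]
  exact congrArg _ (Finset.sum_congr rfl fun j _ => by rw [eval_smul, eval_pow hu])

lemma eval_den (hu : ‖u‖ ≤ 1) (μ : ℝ) (x : Wiener) :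
    eval u (den k c μ x) = (c : 𝕜) + (μ : 𝕜) * eval u x ^ k := by
  rw [den, eval_add hu, eval_algebraMap hu, eval_smul, eval_pow hu]

lemma eval_ne_zero_of_isUnit (hu : ‖u‖ ≤ 1) {f : Wiener} (hf : IsUnit f) : eval u f ≠ 0 := by
  have := hf.map (evalHom u hu)
  rw [evalHom_apply] at this
  exact this.ne_zero

/-- The conjugacy equation, evaluated at a point. -/
lemma ratForm_eval_of_defect {φ φ' h : Wiener} {y : Fin k → ℝ} {μ : ℝ}
    (hd : defect c φ φ' y μ h = 0) (hden : IsUnit (den k c μ φ)) (hu : ‖u‖ ≤ 1) :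
    ratForm k (c : 𝕜) (fun j => (y j : 𝕜)) (μ : 𝕜) (eval u φ) = eval u φ' * eval u h := by
  have h1 := eval_ne_zero_of_isUnit hu hden
  rw [eval_den hu] at h1
  rw [ratForm, div_eq_iff h1, ← eval_pol hu, ← eval_den hu, ← eval_mul hu, ← eval_mul hu]
  exact congrArg _ (sub_eq_zero.1 hd)

end Evaluation

/-! ### Reduction to normal form, and passage between germs and the Banach algebra. -/

/-- The solution of the conjugacy equation with `τ = 0`. -/
theorem exists_normal_slice (k : ℕ) {c : ℝ} (hc : c ≠ 0) : ∃ W : Wiener → Wiener,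
    W (model k c) = 0 ∧
    (∀ᶠ z in 𝓝 ((model k c, (0 : ℝ)), (0 : Wiener)), F k c z = 0 →
      lowCf k (W z.1.1) = lowCf k z.2 ∧ resCf k c (W z.1.1) = resCf k c z.2 ∧
      (z.1.2 = 0 → W z.1.1 = z.2)) ∧
    (∀ᶠ h in 𝓝 (model k c), AnalyticAt ℝ W h ∧ F k c ((h, 0), W h) = 0 ∧
      IsUnit (den k c (resCf k c (W h)) (phi k 0 (W h)))) := by
  obtain ⟨W, hW0, huniq, hsol⟩ := exists_slice_const k hc
  refine ⟨fun h => W (h, 0), hW0, ?_, ?_⟩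
  · have h1 : Tendsto (fun z : (Wiener × ℝ) × Wiener => z.1)
        (𝓝 ((model k c, (0 : ℝ)), (0 : Wiener))) (𝓝 (model k c, 0)) := continuous_fst.tendsto _
    filter_upwards [huniq, h1.eventually hsol] with z hz hz1 hF
    obtain ⟨-, -, hl, hr, -⟩ := hz1
    rw [hz hF] at hl hr
    refine ⟨hl.symm, hr.symm, fun h0 => ?_⟩
    rw [← hz hF, ← h0]
  · have h2 : Tendsto (fun h : Wiener => (h, (0 : ℝ))) (𝓝 (model k c)) (𝓝 (model k c, 0)) :=
      Continuous.tendsto (by fun_prop) _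
    filter_upwards [h2.eventually hsol] with h hh
    obtain ⟨h1, h2, -, -, h3, -⟩ := hh
    exact ⟨AnalyticAt.fun_comp (g := W) (f := fun h : Wiener => (h, (0 : ℝ))) h1
      (analyticAt_id.prod analyticAt_const), h2, h3⟩

lemma eval_dphi_ne_zero {𝕜 : Type*} [RCLike 𝕜] {k : ℕ} {w : Wiener} (hw : ‖dxi k w‖ < 1 / 2)
    {u : 𝕜} (hu : ‖u‖ ≤ 1) : eval u (dphi k 0 w) ≠ 0 := by
  have h1 : eval u (dphi k 0 w) = 1 + eval u (dxi k w) := by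
    rw [dphi, mul_zero, zero_smul, add_zero, eval_add hu]
    congr 1
    have := eval_algebraMap hu 1
    simpa using this
  have h2 : ‖eval u (dxi k w)‖ < 1 / 2 := (norm_eval_le hu _).trans_lt hw
  intro h0
  rw [h1] at h0
  rw [← neg_eq_of_add_eq_zero_right h0, norm_neg, norm_one] at h2
  norm_num at h2

/-- The reduction to normal form of a family unfolding `x^{k+1} / c`, in the Banach algebra. -/
theorem exists_reduction {m k : ℕ} {c : ℝ} (hc : c ≠ 0) {X : Family m} (hX : AnalyticAt ℝ X 0)
    {r : ℝ → ℝ} (hr : ContinuousAt r 0) (hr0 : r 0 = c⁻¹)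
    (hord : ∀ᶠ x in 𝓝 0, X (x, 0) = x ^ (k + 1) * r x) :
    ∃ Fc, IsComplexification Fc X ∧ ∃ (h : ℝ → (Fin m → ℝ) → Wiener) (W : Wiener → Wiener),
      Tendsto (fun e => h e 0) (𝓝[>] 0) (𝓝 (model k c)) ∧
      (∀ᶠ z in 𝓝 ((model k c, (0 : ℝ)), (0 : Wiener)), F k c z = 0 →
        lowCf k (W z.1.1) = lowCf k z.2 ∧ resCf k c (W z.1.1) = resCf k c z.2 ∧
        (z.1.2 = 0 → W z.1.1 = z.2)) ∧
      ∀ᶠ e in 𝓝[>] (0 : ℝ), AnalyticAt ℝ (h e) 0 ∧ AnalyticAt ℝ (fun l => W (h e l)) 0 ∧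
        lowCf k (W (h e 0)) = 0 ∧ eval (0 : ℝ) (phi k 0 (W (h e 0))) = 0 ∧
        ∀ᶠ l in 𝓝 0, ‖dxi k (W (h e l))‖ < 1 / 2 ∧ F k c ((h e l, 0), W (h e l)) = 0 ∧
          IsUnit (den k c (resCf k c (W (h e l))) (phi k 0 (W (h e l)))) ∧
          (∀ u : ℂ, ‖u‖ ≤ 1 →
            Fc (e * u, fun i => (l i : ℂ)) = (e : ℂ) ^ (k + 1) * eval u (h e l)) ∧
          ∀ u : ℝ, ‖u‖ ≤ 1 → X (e * u, l) = e ^ (k + 1) * eval u (h e l) := by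
  obtain ⟨Fc, hFc, hexp⟩ := exists_small_expansion hX
  obtain ⟨h, _, hev, hlim, -⟩ := hexp k r hr hord
  rw [hr0] at hlim
  change Tendsto _ _ (𝓝 (model k c)) at hlim
  obtain ⟨W, hW0, huniq, hsol⟩ := exists_normal_slice k hc
  refine ⟨Fc, hFc, h, W, hlim, huniq, ?_⟩
  have hsmall : ∀ᶠ g in 𝓝 (model k c), ‖dxi k (W g)‖ < 1 / 2 := by
    have hcont : ContinuousAt W (model k c) := hsol.self_of_nhds.1.continuousAt
    have h1 : ContinuousAt (fun g => ‖dxi k (W g)‖) (model k c) :=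
      ((dxi k).continuous.continuousAt.comp hcont).norm
    exact h1.eventually_lt_const (by simp [hW0])
  have hnear := hlim.eventually (eventually_eventually_nhds.2 (hsol.and hsmall))
  filter_upwards [hev, hnear, self_mem_nhdsWithin] with e he hne he0
  have he0 : (0 : ℝ) < e := he0
  obtain ⟨hhan, -, -, hl⟩ := he
  obtain ⟨⟨hWan, hF0, hU0⟩, hd0⟩ := hne.self_of_nhds
  have hall := hhan.continuousAt.eventually hne
  -- At `λ = 0` the field has a zero of order `k+1`, so the numerator composed with `φ` does too. A
  -- centred polynomial with this property is `x^(k+1)`, which forces `y(0) = 0` and `φ(0) = 0`.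
  suffices hkey : eval (0 : ℝ) (phi k 0 (W (h e 0))) = 0 ∧
      numPoly (lowCf k (W (h e 0))) = Polynomial.X ^ (k + 1) by
    refine ⟨hhan, hWan.fun_comp hhan, funext fun j => ?_, hkey.1, ?_⟩
    · have hj := j.2
      rw [← coeff_numPoly (lowCf k (W (h e 0))) j, hkey.2, Polynomial.coeff_X_pow, if_neg (by omega)]
      rfl
    · filter_upwards [hall, hl] with l h1 h2
      exact ⟨h1.2, h1.1.2.1, h1.1.2.2, h2.1, h2.2⟩
  set w := W (h e 0)
  have hcomp : ContinuousAt (fun u : ℝ => r (e * u)) 0 :=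
    ContinuousAt.comp (g := r) (by simpa using hr) (by fun_prop)
  refine eq_X_pow_of_eval_comp (φ := fun u => eval u (phi k 0 w))
    (R := fun u => eval u (dphi k 0 w) * r (e * u) * eval u (den k c (resCf k c w) (phi k 0 w)))
    (hasDerivAt_eval (isDeriv_phi k 0 w) (by simp)) (eval_dphi_ne_zero hd0 (by simp))
    (((continuousAt_eval _).mul hcomp).mul (continuousAt_eval _)) (monic_numPoly _)
    (natDegree_numPoly _) (coeff_numPoly_self _) ?_
  have ht : Tendsto (fun u : ℝ => e * u) (𝓝 0) (𝓝 0) :=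
    Continuous.tendsto' (by fun_prop) _ _ (by simp)
  filter_upwards [ht.eventually hord, eventually_norm_le_one ℝ] with u hu hu1
  have h1 : pol (lowCf k w) (phi k 0 w) =
      dphi k 0 w * h e 0 * den k c (resCf k c w) (phi k 0 w) := sub_eq_zero.1 hF0
  have h2 := congrArg (eval u) h1
  rw [eval_pol hu1, eval_mul hu1, eval_mul hu1] at h2
  have h3 := hl.self_of_nhds.2 u hu1
  rw [hu, mul_pow, mul_assoc] at h3
  have h4 := mul_left_cancel₀ (pow_ne_zero _ he0.ne') h3
  rw [eval_numPoly]
  refine h2.trans ?_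
  rw [← h4]
  ring

/-- A solution of the conjugacy equation in the Banach algebra yields, after scaling, a conjugacy
to a normal form. -/
theorem conjugates_of_slice {m k : ℕ} {c e β : ℝ} (he : 0 < e) (hβ : β ≠ 0) {X : Family m}
    {h w : (Fin m → ℝ) → Wiener} (hw : AnalyticAt ℝ w 0)
    (h0 : eval (0 : ℝ) (phi k 0 (w 0)) = 0)
    (hl : ∀ᶠ l in 𝓝 0, ‖dxi k (w l)‖ < 1 / 2 ∧ F k c ((h l, 0), w l) = 0 ∧
      IsUnit (den k c (resCf k c (w l)) (phi k 0 (w l))) ∧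
      ∀ u : ℝ, ‖u‖ ≤ 1 → X (e * u, l) = e ^ (k + 1) * eval u (h l)) :
    Conjugates (fun p => β * eval (e⁻¹ * p.1) (phi k 0 (w p.2))) X
      (normalForm k (c * (β / e) ^ k) (fun l j => β ^ (k + 1 - (j : ℕ)) * lowCf k (w l) j)
        (fun l => resCf k c (w l) / e ^ k)) := by
  have hder : ∀ l, ∀ x : ℝ, ‖e⁻¹ * x‖ < 1 →
      HasDerivAt (fun x => β * eval (e⁻¹ * x) (phi k 0 (w l)))
        (β * (eval (e⁻¹ * x) (dphi k 0 (w l)) * e⁻¹)) x := fun l x hx => by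
    have h1 := (hasDerivAt_eval (isDeriv_phi k 0 (w l)) hx).comp x
      ((hasDerivAt_id x).const_mul e⁻¹)
    rw [mul_one] at h1
    exact h1.const_mul β
  refine ⟨⟨?_, ?_, ?_⟩, ?_⟩
  · have hfst : AnalyticAt ℝ (fun p : ℝ × (Fin m → ℝ) => p.1) 0 := analyticAt_fst
    have hsnd : AnalyticAt ℝ (fun p : ℝ × (Fin m → ℝ) => w p.2) 0 :=
      AnalyticAt.fun_comp (g := w) (f := fun p : ℝ × (Fin m → ℝ) => p.2) (by simpa using hw)
        analyticAt_snd
    exact analyticAt_const.fun_mul ((analyticAt_phi analyticAt_const hsnd).wienerEval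
      (analyticAt_const.fun_mul hfst) (by simp))
  · change β * eval (e⁻¹ * (0 : ℝ)) (phi k 0 (w 0)) = 0
    rw [mul_zero, h0, mul_zero]
  · rw [(hder 0 0 (by simp)).deriv, mul_zero]
    exact mul_ne_zero hβ (mul_ne_zero (eval_dphi_ne_zero hl.self_of_nhds.1 (by simp))
      (inv_ne_zero he.ne'))
  · have hsnd : Tendsto (fun p : ℝ × (Fin m → ℝ) => p.2) (𝓝 0) (𝓝 0) :=
      Continuous.tendsto' (by fun_prop) _ _ rfl
    have hfst : ∀ᶠ p : ℝ × (Fin m → ℝ) in 𝓝 0, ‖e⁻¹ * p.1‖ < 1 := by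
      have : ContinuousAt (fun p : ℝ × (Fin m → ℝ) => ‖e⁻¹ * p.1‖) 0 := by fun_prop
      exact this.eventually_lt_const (by simp)
    filter_upwards [hsnd.eventually hl, hfst] with p hp hp1
    obtain ⟨-, hF, hu, hX⟩ := hp
    rw [(hder p.2 p.1 hp1).deriv]
    have h1 := ratForm_eval_of_defect (𝕜 := ℝ) hF hu hp1.le
    have h2 := hX _ hp1.le
    rw [mul_inv_cancel_left₀ he.ne'] at h2
    have h3 := eval_ne_zero_of_isUnit hp1.le hu
    rw [eval_den hp1.le] at h3
    simp only [RCLike.ofReal_real_eq_id, id] at h1 h3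
    rw [show X p = X (p.1, p.2) from rfl, h2]
    set v := eval (e⁻¹ * p.1) (phi k 0 (w p.2))
    -- The factor `β` is left free: the constant becomes `c (β/e)^k`, which can be normalised to a
    -- sign or kept equal to `c`.
    have h4 : ratForm k (c * (β / e) ^ k) (fun j : Fin k => β ^ (k + 1 - (j : ℕ)) *
        lowCf k (w p.2) j) (resCf k c (w p.2) / e ^ k) (β * v) =
        β * e ^ k * ratForm k c (fun j => lowCf k (w p.2) j) (resCf k c (w p.2)) v := by
      have e1 : ∀ j : Fin k, β ^ (k + 1 - (j : ℕ)) * lowCf k (w p.2) j * (β * v) ^ (j : ℕ) =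
          β ^ (k + 1) * (lowCf k (w p.2) j * v ^ (j : ℕ)) := fun j => by
        have hj := j.2
        rw [mul_pow, show k + 1 = (k + 1 - (j : ℕ)) + j by omega, pow_add, Nat.add_sub_cancel]
        ring
      have e2 : c * (β / e) ^ k + resCf k c (w p.2) / e ^ k * (β * v) ^ k =
          (β / e) ^ k * (c + resCf k c (w p.2) * v ^ k) := by
        rw [div_pow, mul_pow]; ring
      simp only [ratForm, e1, ← Finset.mul_sum, e2]
      rw [mul_pow, ← mul_add, div_pow, pow_succ β]
      field_simp
    change ratForm k (c * (β / e) ^ k) (fun j : Fin k => β ^ (k + 1 - (j : ℕ)) *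
        lowCf k (w p.2) j) (resCf k c (w p.2) / e ^ k) (β * v) = _
    rw [h4, h1, pow_succ]
    field_simp

/-- The numerator parameters after the substitution `x = e u`. -/
def scaleLow (k : ℕ) (e : ℝ) (y : Fin k → ℝ) : Fin k → ℝ := fun j => y j / e ^ (k + 1 - (j : ℕ))

/-- Quasi-homogeneity. Zooming in shrinks `μ` but magnifies `y_j`; this is harmless since `y`
vanishes at `λ = 0` and `λ` is restricted after `e` is fixed. -/
lemma ratForm_scale {k : ℕ} {c e : ℝ} (he : e ≠ 0) (y : Fin k → ℝ) (μ v : ℝ) :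
    ratForm k c y μ (e * v) = e ^ (k + 1) * ratForm k c (scaleLow k e y) (e ^ k * μ) v := by
  have e1 : ∀ j : Fin k, y j * (e * v) ^ (j : ℕ) =
      e ^ (k + 1) * (scaleLow k e y j * v ^ (j : ℕ)) := fun j => by
    have hj := j.2
    rw [scaleLow, mul_pow, show e ^ (k + 1) = e ^ (k + 1 - (j : ℕ)) * e ^ (j : ℕ) by
      rw [← pow_add]; congr 1; omega]
    field_simp
  simp only [ratForm, e1, ← Finset.mul_sum]
  rw [mul_pow, ← mul_add, mul_div_assoc, mul_pow]
  congr 3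
  ring

lemma hasDerivAt_of_eval {e : ℝ} (he : 0 < e) {f : ℝ → ℝ} {g g' : Wiener} (hg : IsDeriv g g')
    (hf : ∀ u : ℝ, ‖u‖ ≤ 1 → f (e * u) = e * eval u g) {u : ℝ} (hu : ‖u‖ < 1) :
    HasDerivAt f (eval u g') (e * u) := by
  have h3 : HasDerivAt (fun x => e * eval (e⁻¹ * x) g) (eval u g') (e * u) := by
    have h4 : HasDerivAt (fun v : ℝ => eval v g) (eval u g') (e⁻¹ * (e * u)) := by
      rw [inv_mul_cancel_left₀ he.ne']; exact hasDerivAt_eval hg hu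
    have h5 := (h4.comp (e * u) ((hasDerivAt_id (e * u)).const_mul e⁻¹)).const_mul e
    refine h5.congr_deriv ?_
    field_simp
  refine h3.congr_of_eventuallyEq ?_
  have h6 : ∀ᶠ x in 𝓝 (e * u), ‖e⁻¹ * x‖ < 1 := by
    have : ContinuousAt (fun x => ‖e⁻¹ * x‖) (e * u) := by fun_prop
    refine this.eventually_lt_const ?_
    simpa only [inv_mul_cancel_left₀ he.ne'] using hu
  filter_upwards [h6] with x hx
  rw [← hf _ hx.le, mul_inv_cancel_left₀ he.ne']

lemma eventually_eventually_mul {m : ℕ} (e : ℝ) {P : ℝ × (Fin m → ℝ) → Prop}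
    (h : ∀ᶠ p in 𝓝 0, P p) : ∀ᶠ l in 𝓝 0, ∀ᶠ u : ℝ in 𝓝 0, P (e * u, l) := by
  have ht : Tendsto (fun p : (Fin m → ℝ) × ℝ => (e * p.2, p.1)) (𝓝 (0, 0)) (𝓝 0) :=
    Continuous.tendsto' (by fun_prop) _ _ (by simp)
  exact (ht.eventually h).curry_nhds

lemma exists_eq_mul {m : ℕ} {φ : ℝ × (Fin m → ℝ) → ℝ} (hφ : AnalyticAt ℝ φ 0) (hφ0 : φ 0 = 0) :
    ∃ r : ℝ → ℝ, ContinuousAt r 0 ∧ r 0 = deriv (fun x => φ (x, 0)) 0 ∧ ∀ x, φ (x, 0) = x * r x := by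
  have h1 : AnalyticAt ℝ (fun x : ℝ => φ (x, 0)) 0 :=
    AnalyticAt.fun_comp (g := φ) (f := fun x : ℝ => (x, (0 : Fin m → ℝ))) hφ
      (analyticAt_id.prod analyticAt_const)
  refine ⟨dslope (fun x => φ (x, 0)) 0, continuousAt_dslope_same.2 h1.differentiableAt,
    dslope_same _ _, fun x => ?_⟩
  have := sub_smul_dslope (fun x => φ (x, 0)) 0 x
  rw [sub_zero, smul_eq_mul] at this
  rw [this]
  change _ = φ (x, 0) - φ 0
  rw [hφ0, sub_zero]

/-- A conjugacy to a normal form satisfies the equation in the Banach algebra. -/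
lemma defect_eq_zero_of_conj {m k : ℕ} {c e : ℝ} (hk : 1 ≤ k) (hc : c ≠ 0) (he : 0 < e)
    {φ : ℝ × (Fin m → ℝ) → ℝ} {X : Family m} {y : (Fin m → ℝ) → (Fin k → ℝ)}
    {μ : (Fin m → ℝ) → ℝ} (hφ : ContinuousAt φ 0) (hφ0 : φ 0 = 0) (hμ : ContinuousAt μ 0)
    (hconj : ∀ᶠ p in 𝓝 0, normalForm k c y μ (φ p, p.2) =
      deriv (fun x => φ (x, p.2)) p.1 * X p)
    {g g' h : (Fin m → ℝ) → Wiener} (hg : ∀ l, IsDeriv (g l) (g' l))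
    (hgev : ∀ᶠ l in 𝓝 0, ∀ u : ℝ, ‖u‖ ≤ 1 → φ (e * u, l) = e * eval u (g l))
    (hhev : ∀ᶠ l in 𝓝 0, ∀ u : ℝ, ‖u‖ ≤ 1 → X (e * u, l) = e ^ (k + 1) * eval u (h l)) :
    ∀ᶠ l in 𝓝 0, defect c (g l) (g' l) (scaleLow k e (y l)) (e ^ k * μ l) (h l) = 0 := by
  have hden : ∀ᶠ p in 𝓝 (0 : ℝ × (Fin m → ℝ)), c + μ p.2 * φ p ^ k ≠ 0 := by
    have h1 : ContinuousAt (fun p : ℝ × (Fin m → ℝ) => μ p.2) 0 :=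
      ContinuousAt.comp (g := μ) hμ continuousAt_snd
    have h2 : ContinuousAt (fun p : ℝ × (Fin m → ℝ) => c + μ p.2 * φ p ^ k) 0 :=
      continuousAt_const.add (h1.mul (hφ.pow k))
    refine h2.eventually_ne ?_
    rw [hφ0, zero_pow (by omega), mul_zero, add_zero]
    exact hc
  have hboth : ∀ᶠ p in 𝓝 0, normalForm k c y μ (φ p, p.2) =
      deriv (fun x => φ (x, p.2)) p.1 * X p ∧ c + μ p.2 * φ p ^ k ≠ 0 := hconj.and hden
  filter_upwards [eventually_eventually_mul e hboth, hgev, hhev] with l hl hgl hhl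
  refine sub_eq_zero.2 (eq_of_eventually_eval_eq ?_)
  filter_upwards [hl, Metric.ball_mem_nhds (0 : ℝ) one_pos] with u hu hu1
  have hu1 : ‖u‖ < 1 := mem_ball_zero_iff.1 hu1
  obtain ⟨h1, h2⟩ := hu
  rw [hgl u hu1.le] at h1 h2
  have hd : deriv (fun x => φ (x, l)) (e * u) = eval u (g' l) :=
    (hasDerivAt_of_eval he (f := fun x => φ (x, l)) (hg l) hgl hu1).deriv
  rw [hd, hhl u hu1.le, normalForm, ratForm_scale he.ne', mul_left_comm] at h1
  have h3 := mul_left_cancel₀ (pow_ne_zero _ he.ne') h1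
  have h4 : c + e ^ k * μ l * eval u (g l) ^ k ≠ 0 := by
    rw [mul_pow] at h2
    convert h2 using 2; ring
  rw [ratForm, div_eq_iff h4] at h3
  rw [eval_pol hu1.le, eval_mul hu1.le, eval_mul hu1.le, eval_den hu1.le]
  exact h3

/-- A conjugacy tangent to the identity yields a small solution of the equation in the Banach
algebra. -/
lemma eventually_small_solution {m k : ℕ} {c : ℝ} (hk : 1 ≤ k) (hc : c ≠ 0)
    {φ : ℝ × (Fin m → ℝ) → ℝ} {X : Family m} {y : (Fin m → ℝ) → (Fin k → ℝ)}
    {μ : (Fin m → ℝ) → ℝ} (hφ : AnalyticAt ℝ φ 0) {r : ℝ → ℝ} (hr : ContinuousAt r 0)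
    (hr1 : r 0 = 1) (hφr : ∀ᶠ x in 𝓝 0, φ (x, 0) = x * r x)
    (hy : ContinuousAt y 0) (hy0 : y 0 = 0) (hμ : ContinuousAt μ 0)
    (hconj : ∀ᶠ p in 𝓝 0, normalForm k c y μ (φ p, p.2) =
      deriv (fun x => φ (x, p.2)) p.1 * X p)
    {h : ℝ → (Fin m → ℝ) → Wiener}
    (hhev : ∀ᶠ e in 𝓝[>] (0 : ℝ), ∀ᶠ l in 𝓝 0, ∀ u : ℝ, ‖u‖ ≤ 1 →
      X (e * u, l) = e ^ (k + 1) * eval u (h e l))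
    {P : ℝ × Wiener → Prop} (hP : ∀ᶠ z in 𝓝 0, P z) :
    ∀ᶠ e in 𝓝[>] (0 : ℝ), ∃ g g' : (Fin m → ℝ) → Wiener, AnalyticAt ℝ g 0 ∧
      (∀ l, IsDeriv (g l - U) (g' l - 1)) ∧
      ∀ᶠ l in 𝓝 0, (∀ u : ℝ, ‖u‖ ≤ 1 → φ (e * u, l) = e * eval u (g l)) ∧
        P (cf (k + 1) (g l - U),
          repr k c (g l - U) (g' l - 1) (scaleLow k e (y l)) (e ^ k * μ l)) ∧
        F k c ((h e l, cf (k + 1) (g l - U)),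
          repr k c (g l - U) (g' l - 1) (scaleLow k e (y l)) (e ^ k * μ l)) = 0 := by
  obtain ⟨_, -, hexp⟩ := exists_small_expansion hφ
  obtain ⟨g, g', hev, hlim, hlim'⟩ := hexp 0 r hr (by simpa using hφr)
  have hφ0 : φ 0 = 0 := by
    have := hφr.self_of_nhds
    rw [zero_mul] at this
    exact this
  simp only [hr1, one_smul, zero_add, pow_one, CharP.cast_eq_zero, mul_one, pow_zero] at hlim hlim'
  have hq : Tendsto (fun e => g e 0 - U) (𝓝[>] 0) (𝓝 0) := by
    simpa using hlim.sub_const U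
  have hq' : Tendsto (fun e => g' e 0 - 1) (𝓝[>] 0) (𝓝 0) := by
    simpa using hlim'.sub_const 1
  have hsl0 : ∀ e, scaleLow k e (y 0) = 0 := fun e => by
    funext j; simp [scaleLow, hy0]
  have hμe : Tendsto (fun e : ℝ => e ^ k * μ 0) (𝓝[>] 0) (𝓝 0) := by
    refine (Continuous.tendsto' (by fun_prop) _ _ ?_).mono_left nhdsWithin_le_nhds
    rw [zero_pow (by omega), zero_mul]
  -- Smallness is obtained at `λ = 0` as `e → 0`, where `y = 0` removes the negative powers of `e`.
  -- For a fixed `e` it extends to nearby `λ` by continuity.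
  have hz : Tendsto (fun e => (cf (k + 1) (g e 0 - U),
      repr k c (g e 0 - U) (g' e 0 - 1) (scaleLow k e (y 0)) (e ^ k * μ 0))) (𝓝[>] 0)
      (𝓝 (0, 0)) := by
    refine Tendsto.prodMk_nhds ?_ (tendsto_repr hq hq' ?_ hμe)
    · have h1 := ((cfL (k + 1)).continuous.tendsto 0).comp hq
      rw [map_zero] at h1
      exact h1
    · simp only [hsl0]; exact tendsto_const_nhds
  filter_upwards [hev, hz.eventually (eventually_eventually_nhds.2 hP), hhev,
    self_mem_nhdsWithin] with e he hPe hhe he0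
  have he0 : (0 : ℝ) < e := he0
  obtain ⟨hgan, hgan', hder, hgev⟩ := he
  simp only [zero_add, pow_one] at hgev
  have hsub : ∀ l, IsDeriv (g e l - U) (g' e l - 1) := fun l => by
    have := (hder l).add (isDeriv_U.smul (-1))
    simpa [sub_eq_add_neg] using this
  refine ⟨g e, g' e, hgan, hsub, ?_⟩
  have hcont : ContinuousAt (fun l => (cf (k + 1) (g e l - U),
      repr k c (g e l - U) (g' e l - 1) (scaleLow k e (y l)) (e ^ k * μ l))) 0 := by
    have hg := hgan.continuousAt
    have hg' := hgan'.continuousAt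
    have hyj : ∀ j, ContinuousAt (fun l => y l j) 0 := fun j => continuousAt_pi.1 hy j
    refine ContinuousAt.prodMk ((cfL (k + 1)).continuous.continuousAt.comp
      (hg.sub continuousAt_const)) ?_
    unfold repr scaleLow
    fun_prop
  have hdef := defect_eq_zero_of_conj hk hc he0 hφ.continuousAt hφ0 hμ hconj hder
    (hgev.mono fun l hl => hl.2) hhe
  filter_upwards [hgev, hcont.eventually hPe, hdef] with l h1 h2 h3
  refine ⟨h1.2, h2, ?_⟩
  rw [F_repr hc (hsub l), add_sub_cancel, add_sub_cancel]
  exact h3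

/-- `|c|^(-1/k)` solves the equation up to sign. For odd `k` the sign of `c` is absorbed by that of
`b`; for even `k` it is recorded by `s`. -/
lemma exists_scaling {k : ℕ} (hk : 1 ≤ k) {c : ℝ} (hc : c ≠ 0) :
    ∃ s b : ℝ, (s = 1 ∨ s = -1) ∧ b ≠ 0 ∧ c * b ^ k = s ^ (k + 1) := by
  have hc' : 0 < |c|⁻¹ := inv_pos.2 (abs_pos.2 hc)
  have ha : (|c|⁻¹ ^ ((k : ℝ)⁻¹)) ^ k = |c|⁻¹ := Real.rpow_inv_natCast_pow hc'.le (by omega)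
  have ha0 : |c|⁻¹ ^ ((k : ℝ)⁻¹) ≠ 0 := (Real.rpow_pos_of_pos hc' _).ne'
  set a := |c|⁻¹ ^ ((k : ℝ)⁻¹)
  rcases hc.lt_or_gt with h | h
  · rw [abs_of_neg h] at ha
    rcases Nat.even_or_odd k with hp | hp
    · exact ⟨-1, a, Or.inr rfl, ha0, by rw [ha, hp.add_one.neg_one_pow]; field_simp⟩
    · refine ⟨-1, -a, Or.inr rfl, neg_ne_zero.2 ha0, ?_⟩
      rw [hp.neg_pow, ha, hp.add_one.neg_one_pow]; field_simp
  · rw [abs_of_pos h] at ha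
    exact ⟨1, a, Or.inl rfl, ha0, by rw [ha, one_pow]; field_simp⟩

/-! ### Universality of the standard deformation. -/

lemma analyticAt_scaled {m k : ℕ} {β : ℝ} {w : (Fin m → ℝ) → Wiener} (hw : AnalyticAt ℝ w 0) :
    AnalyticAt ℝ (fun l (j : Fin k) => β ^ (k + 1 - (j : ℕ)) * lowCf k (w l) j) 0 :=
  AnalyticAt.pi fun j => analyticAt_const.fun_mul (analyticAt_cf j hw)

lemma analyticAt_standardDeformation {k : ℕ} (hk : 1 ≤ k) {c : ℝ} (hc : c ≠ 0) (μ : ℝ) :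
    AnalyticAt ℝ (standardDeformation k c μ) 0 := by
  have hfst : AnalyticAt ℝ (fun p : ℝ × (Fin (k + 1) → ℝ) => p.1) 0 := analyticAt_fst
  have hproj : ∀ j, AnalyticAt ℝ (fun p : ℝ × (Fin (k + 1) → ℝ) => p.2 j) 0 := fun j =>
    ((ContinuousLinearMap.proj (R := ℝ) (φ := fun _ : Fin (k + 1) => ℝ) j).comp
      (ContinuousLinearMap.snd ℝ ℝ (Fin (k + 1) → ℝ))).analyticAt 0
  refine AnalyticAt.fun_div ((hfst.fun_pow _).fun_add
    (Finset.analyticAt_fun_sum _ fun j _ => (hproj _).fun_mul (hfst.fun_pow _)))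
    (analyticAt_const.fun_add ((analyticAt_const.fun_add (hproj _)).fun_mul (hfst.fun_pow _))) ?_
  simpa [show k ≠ 0 by omega] using hc

/-- The inducing map is read off from `W (h e λ)`, which depends on the family alone. Any other
equivalence is a solution of the same equation with possibly another `τ`, and the parameters are
independent of `τ`. -/
theorem isUniversalDeformation_standardDeformation {k : ℕ} (hk : 1 ≤ k) {c : ℝ} (hc : c ≠ 0)
    (μ : ℝ) : IsUniversalDeformation (standardDeformation k c μ) := by
  refine ⟨analyticAt_standardDeformation hk hc μ, fun m X hX hXZ => ?_⟩
  have hk0 : k ≠ 0 := by omega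
  set r : ℝ → ℝ := fun x => (c + μ * x ^ k)⁻¹ with hrdef
  have hden0 : ∀ᶠ x in 𝓝 (0 : ℝ), c + μ * x ^ k ≠ 0 := by
    have : ContinuousAt (fun x : ℝ => c + μ * x ^ k) 0 := by fun_prop
    exact this.eventually_ne (by simpa [hk0] using hc)
  have hr : ContinuousAt r 0 := by
    refine ContinuousAt.inv₀ (by fun_prop) ?_
    simpa [hk0] using hc
  have hr0 : r 0 = c⁻¹ := by simp [hrdef, hk0]
  have hord : ∀ᶠ x in 𝓝 0, X (x, 0) = x ^ (k + 1) * r x := by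
    filter_upwards [hXZ] with x hx
    rw [hx]
    simp [standardDeformation, ratForm, hrdef, div_eq_mul_inv]
  obtain ⟨_, -, h, W, hlim, huniq, hev⟩ := exists_reduction hc hX hr hr0 hord
  constructor
  · have hz : Tendsto (fun e : ℝ => ((h e 0, (0 : ℝ)), repr k c 0 0 0 (e ^ k * μ))) (𝓝[>] 0)
        (𝓝 ((model k c, 0), 0)) := by
      refine (hlim.prodMk_nhds tendsto_const_nhds).prodMk_nhds
        (tendsto_repr tendsto_const_nhds tendsto_const_nhds tendsto_const_nhds ?_)
      refine (Continuous.tendsto' (by fun_prop) _ _ ?_).mono_left nhdsWithin_le_nhds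
      rw [zero_pow hk0, zero_mul]
    obtain ⟨e, ⟨-, hWan, hlow, heval0, hl⟩, he0, hu⟩ :=
      (hev.and ((eventually_mem_nhdsWithin).and (hz.eventually huniq))).exists
    have he0 : (0 : ℝ) < e := he0
    -- The undeformed field is already normal, so the identity solves the equation with `τ = 0`; by
    -- uniqueness it is the solution chosen by `W`. This yields `φ(x;0) = x`.
    have hw0 : W (h e 0) = repr k c 0 0 0 (e ^ k * μ) := by
      refine (hu ?_).2.2 rfl
      have hF := F_repr (k := k) hc isDeriv_zero 0 (e ^ k * μ) (h e 0)
      rw [map_zero, add_zero, add_zero] at hF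
      rw [hF]
      refine sub_eq_zero.2 (eq_of_eventually_eval_eq ?_)
      have ht : Tendsto (fun u : ℝ => e * u) (𝓝 0) (𝓝 0) :=
        Continuous.tendsto' (by fun_prop) _ _ (by simp)
      filter_upwards [ht.eventually hord, ht.eventually hden0, eventually_norm_le_one ℝ]
        with u hu hd hu1
      have h1 := hl.self_of_nhds.2.2.2.2 u hu1
      rw [hu, mul_pow, mul_assoc] at h1
      have h2 := mul_left_cancel₀ (pow_ne_zero _ he0.ne') h1
      rw [pol_zero, one_mul, eval_mul hu1, eval_den hu1, eval_pow hu1, eval_U, ← h2, hrdef]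
      rw [mul_pow] at hd
      simp only [RCLike.ofReal_real_eq_id, id, mul_pow]
      rw [show c + e ^ k * μ * u ^ k = c + μ * (e ^ k * u ^ k) by ring, mul_assoc,
        inv_mul_cancel₀ hd, mul_one]
    have hphi : phi k 0 (W (h e 0)) = U := by
      have := phi_repr (k := k) (c := c) isDeriv_zero 0 (e ^ k * μ)
      rwa [map_zero, add_zero, ← hw0] at this
    have hres : resCf k c (W (h e 0)) = e ^ k * μ := by
      rw [hw0, resCf_repr hc isDeriv_zero]
    refine ⟨fun l => Fin.snoc (α := fun _ => ℝ)
      (fun j : Fin k => e ^ (k + 1 - (j : ℕ)) * lowCf k (W (h e l)) j)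
      (resCf k c (W (h e l)) / e ^ k - μ), ?_, ?_, ?_⟩
    · refine AnalyticAt.pi fun j => ?_
      induction j using Fin.lastCases with
      | last =>
        simp only [Fin.snoc_last]
        exact (AnalyticAt.fun_div (analyticAt_resCf hWan) analyticAt_const
          (pow_ne_zero _ he0.ne')).fun_sub analyticAt_const
      | cast j =>
        simp only [Fin.snoc_castSucc]
        exact analyticAt_const.fun_mul (analyticAt_cf j hWan)
    · funext j
      induction j using Fin.lastCases with
      | last =>
        simp only [Fin.snoc_last, hres, Pi.zero_apply]
        field_simp
        ring
      | cast j => simp [hlow]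
    · refine ⟨fun p => e * eval (e⁻¹ * p.1) (phi k 0 (W (h e p.2))), ?_, ?_⟩
      · have := conjugates_of_slice (β := e) he0 he0.ne' (X := X) hWan heval0
          (hl.mono fun l hl => ⟨hl.1, hl.2.1, hl.2.2.1, hl.2.2.2.2⟩)
        rw [div_self he0.ne', one_pow, mul_one] at this
        convert this using 2 with p
        simp [standardDeformation, normalForm]
      · refine Eventually.of_forall fun x => ?_
        simp only [hphi, eval_U]
        rw [mul_inv_cancel_left₀ he0.ne']
  · have key : ∀ ψ : (Fin m → ℝ) → (Fin (k + 1) → ℝ), AnalyticAt ℝ ψ 0 → ψ 0 = 0 →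
        AreEquivalent X (fun p => standardDeformation k c μ (p.1, ψ p.2)) →
        ∀ᶠ e in 𝓝[>] (0 : ℝ), ∀ᶠ l in 𝓝 0,
          lowCf k (W (h e l)) = scaleLow k e (fun j => ψ l j.castSucc) ∧
          resCf k c (W (h e l)) = e ^ k * (μ + ψ l (Fin.last k)) := by
      rintro ψ hψ hψ0 ⟨φ, ⟨⟨hφ, -, -⟩, hconj⟩, hφid⟩
      have hψj : ∀ j, ContinuousAt (fun l => ψ l j) 0 := fun j =>
        continuousAt_pi.1 hψ.continuousAt j
      -- The neighbourhood is split because `h` is close to the model by the choice of `e` and `λ`,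
      -- while `(τ, w)` is made small by `eventually_small_solution`.
      obtain ⟨pa, hpa, pb, hpb, hp⟩ := eventually_prod_iff.1 (nhds_prod_eq (X := Wiener)
        (Y := ℝ × Wiener) ▸ (Continuous.tendsto (f := fun z : Wiener × ℝ × Wiener =>
          ((z.1, z.2.1), z.2.2)) (by fun_prop) (model k c, (0, 0))).eventually huniq)
      have hsmall := eventually_small_solution (c := c) hk hc (X := X)
        (y := fun l j => ψ l j.castSucc) (μ := fun l => μ + ψ l (Fin.last k)) hφ
        (r := fun _ => 1) continuousAt_const rfl
        (hφid.mono fun x hx => by rw [hx, mul_one]) (continuousAt_pi.2 fun j => hψj _)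
        (by funext j; simp [hψ0]) (continuousAt_const.add (hψj _)) hconj
        (hev.mono fun e he => he.2.2.2.2.mono fun l hl => hl.2.2.2.2) hpb
      filter_upwards [hsmall, hev, hlim.eventually (eventually_eventually_nhds.2 hpa)]
        with e he1 he2 he3
      obtain ⟨g, g', -, hder, hl⟩ := he1
      filter_upwards [hl, he2.1.continuousAt.eventually he3] with l h1 h2
      obtain ⟨h3, h4, -⟩ := hp h2 h1.2.1 h1.2.2
      rw [lowCf_repr] at h3
      rw [resCf_repr hc (hder l)] at h4
      exact ⟨h3, h4⟩
    intro ψ₁ ψ₂ h1 h10 hc1 h2 h20 hc2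
    obtain ⟨e, hk1, hk2, he0⟩ :=
      ((key ψ₁ h1 h10 hc1).and ((key ψ₂ h2 h20 hc2).and eventually_mem_nhdsWithin)).exists
    have he0 : (0 : ℝ) < e := he0
    filter_upwards [hk1, hk2] with l hl1 hl2
    funext j
    induction j using Fin.lastCases with
    | last =>
      have := mul_left_cancel₀ (pow_ne_zero _ he0.ne') (hl1.2.symm.trans hl2.2)
      linarith
    | cast j =>
      have := congrFun (hl1.1.symm.trans hl2.1) j
      simp only [scaleLow] at this
      exact (div_left_inj' (pow_ne_zero _ he0.ne')).1 this

/-! ### Uniqueness for linear families. -/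

/-- Comparing coefficients in `c' φ = c x φ'` gives `c' a_n = n c a_n`. From `a_1 ≠ 0` follows `c' =
c`, and then `a_n = 0` for `n ≠ 1`; the sign of `a_1` is split off so that its logarithm is defined.
-/
theorem linear_family_unique {m : ℕ} {c c' : (Fin m → ℝ) → ℝ} {φ : ℝ × (Fin m → ℝ) → ℝ}
    (hc : AnalyticAt ℝ c 0) (hc0 : c 0 ≠ 0)
    (h : Conjugates φ (fun p => c p.2 * p.1) (fun p => c' p.2 * p.1)) :
    c' =ᶠ[𝓝 0] c ∧
      ∃ (ε : ℝ) (t : (Fin m → ℝ) → ℝ), (ε = 1 ∨ ε = -1) ∧ AnalyticAt ℝ t 0 ∧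
        ∀ᶠ p : ℝ × (Fin m → ℝ) in 𝓝 0, φ p = ε * Real.exp (t p.2) * p.1 := by
  obtain ⟨⟨hφ, hφ0, hφ1⟩, hconj⟩ := h
  obtain ⟨r, hr, hr0, hφr⟩ := exists_eq_mul hφ hφ0
  obtain ⟨_, -, hexp⟩ := exists_small_expansion hφ
  obtain ⟨g, g', hev, hlim, -⟩ := hexp 0 r hr (Eventually.of_forall (by simpa using hφr))
  have hlim1 : Tendsto (fun e => cf 1 (g e 0)) (𝓝[>] 0) (𝓝 (r 0)) := by
    have h1 := ((cfL 1).continuous.tendsto _).comp hlim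
    rw [cfL_apply, map_smul, cf_U_pow] at h1
    rw [zero_add, if_pos rfl, smul_eq_mul, mul_one] at h1
    exact h1
  rw [← hr0] at hφ1
  obtain ⟨e, ⟨hgan, -, hder, hgev⟩, hne, he0⟩ :=
    (hev.and ((hlim1.eventually_ne hφ1).and eventually_mem_nhdsWithin)).exists
  have he0 : (0 : ℝ) < e := he0
  simp only [zero_add, pow_one] at hgev
  have hg1 : AnalyticAt ℝ (fun l => cf 1 (g e l)) 0 := analyticAt_cf 1 hgan
  have hcoef : ∀ᶠ l in 𝓝 0, ∀ n, c' l * cf n (g e l) = c l * (n * cf n (g e l)) := by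
    filter_upwards [eventually_eventually_mul e hconj, hgev] with l hl hgl n
    have hW : c' l • g e l = c l • (U * g' e l) := by
      refine eq_of_eventually_eval_eq ?_
      filter_upwards [hl, Metric.ball_mem_nhds (0 : ℝ) one_pos] with u hu hu1
      have hu1 : ‖u‖ < 1 := mem_ball_zero_iff.1 hu1
      rw [(hasDerivAt_of_eval he0 (f := fun x => φ (x, l)) (hder l) hgl.2 hu1).deriv,
        hgl.2 u hu1.le] at hu
      rw [eval_smul, eval_smul, eval_mul hu1.le, eval_U]
      refine mul_left_cancel₀ he0.ne' ?_
      simp only [RCLike.ofReal_real_eq_id, id]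
      linear_combination hu
    have h1 := congrArg (cf n) hW
    rw [map_smul, map_smul, smul_eq_mul, smul_eq_mul] at h1
    rw [h1]
    congr 1
    have h2 := cf_U_pow_mul 1 n (g' e l)
    rw [pow_one] at h2
    rw [h2]
    rcases n with _ | n
    · simp
    · rw [if_pos (by omega), Nat.add_sub_cancel, isDeriv_iff.1 (hder l) n]
      push_cast; rfl
  have hcc : c' =ᶠ[𝓝 0] c := by
    filter_upwards [hcoef, hg1.continuousAt.eventually_ne hne] with l h1 h2
    have := h1 1
    rw [Nat.cast_one, one_mul] at this
    exact mul_right_cancel₀ h2 this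
  refine ⟨hcc, ?_⟩
  have hlin : ∀ᶠ l in 𝓝 0, g e l = cf 1 (g e l) • U ^ 1 := by
    filter_upwards [hcoef, hcc, hc.continuousAt.eventually_ne hc0] with l h1 h2 h3
    refine ext_cf fun n => ?_
    rw [map_smul, cf_U_pow]
    split_ifs with hn
    · rw [hn, smul_eq_mul, mul_one]
    · rw [smul_zero]
      have h4 := h1 n
      rw [h2] at h4
      have h5 := mul_left_cancel₀ h3 h4
      have h6 : ((n : ℝ) - 1) * cf n (g e l) = 0 := by linear_combination -h5
      refine (mul_eq_zero.1 h6).resolve_left (sub_ne_zero.2 ?_)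
      exact_mod_cast hn
  have hφlin : ∀ᶠ p : ℝ × (Fin m → ℝ) in 𝓝 0, φ p = cf 1 (g e p.2) * p.1 := by
    have hsnd : Tendsto (fun p : ℝ × (Fin m → ℝ) => p.2) (𝓝 0) (𝓝 0) :=
      Continuous.tendsto' (by fun_prop) _ _ rfl
    have hfst : ∀ᶠ p : ℝ × (Fin m → ℝ) in 𝓝 0, ‖e⁻¹ * p.1‖ < 1 := by
      have : ContinuousAt (fun p : ℝ × (Fin m → ℝ) => ‖e⁻¹ * p.1‖) 0 := by fun_prop
      exact this.eventually_lt_const (by simp)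
    filter_upwards [hsnd.eventually hlin, hsnd.eventually hgev, hfst] with p h1 h2 h3
    have h4 := h2.2 _ h3.le
    rw [mul_inv_cancel_left₀ he0.ne', h1, eval_U_pow_smul] at h4
    rw [show φ p = φ (p.1, p.2) from rfl, h4]
    simp only [RCLike.ofReal_real_eq_id, id]
    field_simp
  obtain ⟨ε, hε, hpos⟩ : ∃ ε : ℝ, (ε = 1 ∨ ε = -1) ∧ 0 < ε * cf 1 (g e 0) := by
    rcases hne.lt_or_gt with h | h
    · exact ⟨-1, Or.inr rfl, by linarith⟩
    · exact ⟨1, Or.inl rfl, by linarith⟩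
  have han : AnalyticAt ℝ (fun l => ε * cf 1 (g e l)) 0 := analyticAt_const.fun_mul hg1
  refine ⟨ε, fun l => Real.log (ε * cf 1 (g e l)), hε, 
    AnalyticAt.fun_comp (g := Real.log) (analyticAt_log hpos) han, ?_⟩
  have hsnd : Tendsto (fun p : ℝ × (Fin m → ℝ) => p.2) (𝓝 0) (𝓝 0) :=
    Continuous.tendsto' (by fun_prop) _ _ rfl
  filter_upwards [hφlin, hsnd.eventually (han.continuousAt.eventually_const_lt hpos)] with p h1 h2
  rw [h1, Real.exp_log h2]
  have : ε * ε = 1 := by rcases hε with rfl | rfl <;> norm_num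
  linear_combination -(cf 1 (g e p.2) * p.1) * this

/-! ### Rotations and uniqueness of the normal form. -/

section Rotation

variable {k : ℕ} {c ρ : ℝ}

/-- The denominator depends on `x^k` only and is unchanged, while the exponents are chosen so that
every term of the numerator is multiplied by `ρ`. -/
lemma ratForm_rotate (hk : 1 ≤ k) (hρ : ρ ^ k = 1) (y : Fin k → ℝ) (μ x : ℝ) :
    ratForm k c (fun j => ρ ^ (-((j : ℤ) - 1)) * y j) μ (ρ * x) = ρ * ratForm k c y μ x := by
  have hρ0 : ρ ≠ 0 := by
    rintro rfl
    rw [zero_pow (by omega)] at hρ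
    exact zero_ne_one hρ
  have e1 : ∀ j : Fin k, ρ ^ (-((j : ℤ) - 1)) * y j * (ρ * x) ^ (j : ℕ) =
      ρ * (y j * x ^ (j : ℕ)) := fun j => by
    have : ρ ^ (-((j : ℤ) - 1)) * ρ ^ (j : ℕ) = ρ := by
      rw [← zpow_natCast ρ, ← zpow_add₀ hρ0]
      simp
    rw [mul_pow]
    linear_combination (y j * x ^ (j : ℕ)) * this
  simp only [ratForm, e1, ← Finset.mul_sum]
  rw [mul_pow, mul_pow, pow_succ ρ, hρ, one_mul, one_mul, ← mul_add, mul_div_assoc]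

theorem conjugates_rotate {m : ℕ} (hk : 1 ≤ k) (hρ : ρ ^ k = 1) (y : (Fin m → ℝ) → (Fin k → ℝ))
    (μ : (Fin m → ℝ) → ℝ) :
    Conjugates (fun p => ρ * p.1) (normalForm k c y μ)
      (normalForm k c (fun l j => ρ ^ (-((j : ℤ) - 1)) * y l j) μ) := by
  have hd : ∀ x : ℝ, deriv (fun x : ℝ => ρ * x) x = ρ := fun x => by
    simp
  refine ⟨⟨analyticAt_const.fun_mul analyticAt_fst, by simp, ?_⟩,
    Eventually.of_forall fun p => ?_⟩
  · simp only [hd]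
    rintro rfl
    rw [zero_pow (by omega)] at hρ
    exact zero_ne_one hρ
  · simp only [hd]
    exact ratForm_rotate hk hρ _ _ _

end Rotation

lemma ratForm_zero {k : ℕ} (c μ x : ℝ) :
    ratForm k c (0 : Fin k → ℝ) μ x = x ^ (k + 1) / (c + μ * x ^ k) := by
  simp [ratForm]

/-- At `λ = 0`, with `a` the linear coefficient of `φ`, the coefficients of `x^(k+1)` on both sides
give `a^(k+1)/c' = a/c`. -/
lemma deriv_pow_mul_eq {m k : ℕ} (hk : 1 ≤ k) {c c' : ℝ} (hc : c ≠ 0) (hc' : c' ≠ 0)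
    {y y' : (Fin m → ℝ) → (Fin k → ℝ)} {μ μ' : (Fin m → ℝ) → ℝ} {φ : ℝ × (Fin m → ℝ) → ℝ}
    (hy0 : y 0 = 0) (hy0' : y' 0 = 0)
    (h : Conjugates φ (normalForm k c y μ) (normalForm k c' y' μ')) :
    deriv (fun x => φ (x, 0)) 0 ^ k * c = c' := by
  obtain ⟨⟨hφ, hφ0, hφ1⟩, hconj⟩ := h
  obtain ⟨r, hr, hr0, hφr⟩ := exists_eq_mul hφ hφ0
  have hk0 : k ≠ 0 := by omega
  have hf : AnalyticAt ℝ (fun x : ℝ => φ (x, 0)) 0 :=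
    AnalyticAt.fun_comp (g := φ) (f := fun x : ℝ => (x, (0 : Fin m → ℝ))) hφ
      (analyticAt_id.prod analyticAt_const)
  have hd : ContinuousAt (deriv fun x : ℝ => φ (x, 0)) 0 := hf.deriv.continuousAt
  set d := deriv fun x : ℝ => φ (x, 0) with hddef
  have ht : Tendsto (fun x : ℝ => (x, (0 : Fin m → ℝ))) (𝓝 0) (𝓝 0) :=
    Continuous.tendsto' (by fun_prop) _ _ rfl
  have h1 : ContinuousAt (fun x => r x ^ (k + 1) / (c' + μ' 0 * (x * r x) ^ k)) 0 := by
    refine (hr.pow _).div (by fun_prop) ?_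
    simpa [hk0] using hc'
  have h2 : ContinuousAt (fun x => d x / (c + μ 0 * x ^ k)) 0 := by
    refine hd.div (by fun_prop) ?_
    simpa [hk0] using hc
  have h3 : r 0 ^ (k + 1) / (c' + μ' 0 * (0 * r 0) ^ k) = d 0 / (c + μ 0 * 0 ^ k) := by
    refine tendsto_nhds_unique (h1.tendsto.mono_left (nhdsWithin_le_nhds (s := {0}ᶜ)))
      ((h2.tendsto.mono_left nhdsWithin_le_nhds).congr' ?_)
    filter_upwards [nhdsWithin_le_nhds (ht.eventually hconj), self_mem_nhdsWithin] with x hx hx0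
    have hx0 : x ≠ 0 := hx0
    simp only [normalForm, hy0, hy0', ratForm_zero, hφr] at hx
    rw [mul_pow x _ (k + 1)] at hx
    have h4 : (fun x : ℝ => x * r x) = fun x => φ (x, 0) := funext fun x => (hφr x).symm
    rw [h4, ← hddef] at hx
    refine mul_left_cancel₀ (pow_ne_zero (k + 1) hx0) ?_
    linear_combination -hx
  rw [zero_mul, zero_pow hk0, mul_zero, mul_zero, add_zero, add_zero, hr0,
    div_eq_div_iff hc' hc] at h3
  refine mul_left_cancel₀ hφ1 ?_
  rw [← h3]; ring

/-- For odd `k` both signs are `1`; for even `k` the factor `a^k` is positive. -/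
lemma sign_eq_of_pow {k : ℕ} {s s' a : ℝ} (hs : s = 1 ∨ s = -1) (hs' : s' = 1 ∨ s' = -1)
    (ha : a ≠ 0) (h : a ^ k * s ^ (k + 1) = s' ^ (k + 1)) : s' ^ (k + 1) = s ^ (k + 1) := by
  rcases Nat.even_or_odd k with hp | hp
  · have hpos := hp.pow_pos ha
    have hodd := hp.add_one
    rcases hs with rfl | rfl <;> rcases hs' with rfl | rfl <;>
      simp only [one_pow, hodd.neg_one_pow] at h ⊢ <;> linarith
  · have hev := hp.add_one
    rcases hs with rfl | rfl <;> rcases hs' with rfl | rfl <;>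
      simp [hev.neg_one_pow]

/-- The parameters of a normal form after the substitution `x = e u`. -/
def scaleParam (k : ℕ) (e : ℝ) (y : Fin k → ℝ) (μ : ℝ) : Fin (k + 1) → ℝ :=
  Fin.snoc (α := fun _ => ℝ) (scaleLow k e y) (e ^ k * μ)

lemma scaleParam_last (k : ℕ) (e : ℝ) (y : Fin k → ℝ) (μ : ℝ) :
    scaleParam k e y μ (Fin.last k) = e ^ k * μ := by simp [scaleParam]

lemma scaleParam_castSucc (k : ℕ) (e : ℝ) (y : Fin k → ℝ) (μ : ℝ) (j : Fin k) :
    scaleParam k e y μ j.castSucc = scaleLow k e y j := by simp [scaleParam]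

lemma analyticAt_scaleParam {m k : ℕ} {y : (Fin m → ℝ) → (Fin k → ℝ)} {μ : (Fin m → ℝ) → ℝ}
    (hy : AnalyticAt ℝ y 0) (hμ : AnalyticAt ℝ μ 0) (e : ℝ) (he : e ≠ 0) :
    AnalyticAt ℝ (fun l => scaleParam k e (y l) (μ l)) 0 := by
  refine AnalyticAt.pi fun j => ?_
  induction j using Fin.lastCases with
  | last =>
    simp only [scaleParam_last]
    exact analyticAt_const.fun_mul hμ
  | cast j =>
    simp only [scaleParam_castSucc]
    have : AnalyticAt ℝ (fun l => y l j) 0 :=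
      ((ContinuousLinearMap.proj (R := ℝ) (φ := fun _ : Fin k => ℝ) j).analyticAt _).fun_comp hy
    exact AnalyticAt.fun_div this analyticAt_const (pow_ne_zero _ he)

lemma tendsto_scaleParam_zero {k : ℕ} (hk : 1 ≤ k) (μ : ℝ) :
    Tendsto (fun e => scaleParam k e 0 μ) (𝓝[>] 0) (𝓝 0) := by
  refine tendsto_pi_nhds.2 fun j => ?_
  induction j using Fin.lastCases with
  | last =>
    simp only [scaleParam_last]
    refine (Continuous.tendsto' (by fun_prop) _ _ ?_).mono_left nhdsWithin_le_nhds
    simp [show k ≠ 0 by omega]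
  | cast j =>
    simp only [scaleParam_castSucc, scaleLow, Pi.zero_apply, zero_div]
    exact tendsto_const_nhds

lemma eval_mul_inverse {a b : Wiener} (hb : IsUnit b) {u : ℝ} (hu : ‖u‖ ≤ 1) :
    eval u (a * Ring.inverse b) = eval u a / eval u b := by
  rw [eq_div_iff (eval_ne_zero_of_isUnit hu hb), ← eval_mul hu, mul_assoc,
    Ring.inverse_mul_cancel _ hb, mul_one]

lemma eval_quotient {k : ℕ} {c e : ℝ} (he : e ≠ 0) {y : Fin k → ℝ} {μ : ℝ} {f : Wiener}
    (hf : IsUnit (den k c (e ^ k * μ) f)) {u : ℝ} (hu : ‖u‖ ≤ 1) :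
    e ^ (k + 1) * eval u (pol (scaleLow k e y) f * Ring.inverse (den k c (e ^ k * μ) f)) =
      ratForm k c y μ (e * eval u f) := by
  rw [ratForm_scale he, eval_mul_inverse hf hu, eval_pol hu, eval_den hu]
  rfl

section Uniqueness

variable {m k : ℕ} {c : ℝ} {y y' : (Fin m → ℝ) → (Fin k → ℝ)} {μ μ' : (Fin m → ℝ) → ℝ}

lemma nf_scaleParam (e : ℝ) (y : Fin k → ℝ) (μ : ℝ) : nf k c (scaleParam k e y μ) =
    pol (scaleLow k e y) U * Ring.inverse (den k c (e ^ k * μ) U) := by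
  simp only [nf, scaleParam_last, scaleParam_castSucc]

lemma eventually_scaleParam (hk : 1 ≤ k) (hy : AnalyticAt ℝ y 0) (hy0 : y 0 = 0)
    (hμ : AnalyticAt ℝ μ 0) {P : (Fin (k + 1) → ℝ) → Prop} (hP : ∀ᶠ Y in 𝓝 0, P Y) :
    ∀ᶠ e in 𝓝[>] (0 : ℝ), ∀ᶠ l in 𝓝 0, P (scaleParam k e (y l) (μ l)) := by
  have h := (tendsto_scaleParam_zero hk (μ 0)).eventually (eventually_eventually_nhds.2 hP)
  filter_upwards [h, self_mem_nhdsWithin] with e he he0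
  have he0 : (0 : ℝ) < e := he0
  have hc := (analyticAt_scaleParam hy hμ e he0.ne').continuousAt
  refine hc.eventually ?_
  change ∀ᶠ Y in 𝓝 (scaleParam k e (y 0) (μ 0)), P Y
  rw [hy0]
  exact he

lemma normalForm_eval (hk : 1 ≤ k) (hc : c ≠ 0) (hy : AnalyticAt ℝ y 0) (hy0 : y 0 = 0)
    (hμ : AnalyticAt ℝ μ 0) :
    ∀ᶠ e in 𝓝[>] (0 : ℝ), ∀ᶠ l in 𝓝 0, ∀ u : ℝ, ‖u‖ ≤ 1 →
      normalForm k c y μ (e * u, l) =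
        e ^ (k + 1) * eval u (nf k c (scaleParam k e (y l) (μ l))) := by
  filter_upwards [eventually_scaleParam hk hy hy0 hμ (eventually_isUnit_den_U k hc),
    self_mem_nhdsWithin] with e he he0
  have he0 : (0 : ℝ) < e := he0
  filter_upwards [he] with l hl u hu
  rw [scaleParam_last] at hl
  rw [nf_scaleParam, eval_quotient he0.ne' hl hu, eval_U]
  rfl

/-- Composing with `ρ⁻¹` makes `φ` tangent to the identity at `λ = 0`. On a small disc it is then a
small solution for `h = nf k c Y`, and `exists_flow` identifies both its parameters and its position
on the flow. -/
theorem normalForm_unique (hk : 1 ≤ k) (hc : c ≠ 0) (hy : AnalyticAt ℝ y 0) (hy0 : y 0 = 0)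
    (hμ : AnalyticAt ℝ μ 0) (hy' : AnalyticAt ℝ y' 0) (hy0' : y' 0 = 0) (hμ' : AnalyticAt ℝ μ' 0)
    {φ : ℝ × (Fin m → ℝ) → ℝ} {ρ : ℝ} (hρ : ρ ^ k = 1)
    (hφρ : deriv (fun x => φ (x, 0)) 0 = ρ)
    (h : Conjugates φ (normalForm k c y μ) (normalForm k c y' μ')) :
    μ' =ᶠ[𝓝 0] μ ∧ ∃ t : (Fin m → ℝ) → ℝ, AnalyticAt ℝ t 0 ∧
      (∀ᶠ l in 𝓝 0, ∀ j : Fin k, y' l j = ρ ^ (-((j : ℤ) - 1)) * y l j) ∧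
      IsScaledFlow φ ρ t (normalForm k c y μ) := by
  obtain ⟨⟨hφ, hφ0, -⟩, hconj⟩ := h
  obtain ⟨r, hr, hr0, hφr⟩ := exists_eq_mul hφ hφ0
  have hρ0 : ρ ≠ 0 := by
    rintro rfl
    rw [zero_pow (by omega)] at hρ
    exact zero_ne_one hρ
  -- normalisation of the linear part
  set y'' : (Fin m → ℝ) → (Fin k → ℝ) := fun l j => ρ ^ ((j : ℤ) - 1) * y' l j with hy''def
  have hyy : ∀ l, y' l = fun j : Fin k => ρ ^ (-((j : ℤ) - 1)) * y'' l j := fun l => by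
    funext j
    rw [hy''def, ← mul_assoc, ← zpow_add₀ hρ0]
    simp
  have hconj' : ∀ᶠ p in 𝓝 0, normalForm k c y'' μ' (ρ⁻¹ * φ p, p.2) =
      deriv (fun x => ρ⁻¹ * φ (x, p.2)) p.1 * normalForm k c y μ p := by
    filter_upwards [hconj] with p hp
    rw [deriv_const_mul_field, mul_assoc, ← hp]
    simp only [normalForm, hyy]
    have := ratForm_rotate (c := c) hk hρ (y'' p.2) (μ' p.2) (ρ⁻¹ * φ p)
    rw [mul_inv_cancel_left₀ hρ0] at this
    rw [this, inv_mul_cancel_left₀ hρ0]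
  -- the flow
  obtain ⟨G, Fl, hG, hG0, hFl, hFl0, hFlu⟩ := exists_flow k hc
  obtain ⟨ε, hε, hball⟩ := Metric.eventually_nhds_iff.1 hFl
  have hGsmall : ∀ᶠ p in 𝓝 (0 : ℝ × (Fin (k + 1) → ℝ)), |G p| < ε / 2 := by
    refine hG.continuousAt.abs.eventually_lt_const ?_
    change |G 0| < ε / 2
    rw [hG0, abs_zero]; positivity
  have hfst : Tendsto (fun z : (ℝ × (Fin (k + 1) → ℝ)) × Wiener => z.1) (𝓝 0) (𝓝 0) :=
    Continuous.tendsto' (by fun_prop) _ _ rfl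
  have hre : Tendsto (fun z : (Fin (k + 1) → ℝ) × (ℝ × Wiener) => ((z.2.1, z.1), z.2.2))
      (𝓝 (0, 0)) (𝓝 0) := Continuous.tendsto' (by fun_prop) _ _ rfl
  have hall := hre.eventually (hFlu.and ((hfst.eventually hG.eventually_analyticAt).and
    (hfst.eventually hGsmall)))
  rw [nhds_prod_eq] at hall
  obtain ⟨pa, hpa, pb, hpb, hp⟩ := eventually_prod_iff.1 hall
  have hYsmall : ∀ᶠ Y in 𝓝 (0 : Fin (k + 1) → ℝ), pa Y ∧ dist Y 0 < ε ∧ Fl (0, Y) = U :=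
    hpa.and ((show ∀ᶠ Y in 𝓝 (0 : Fin (k + 1) → ℝ), dist Y 0 < ε from Metric.ball_mem_nhds _ hε).and hFl0)
  have hyc : ContinuousAt y'' 0 := continuousAt_pi.2 fun j =>
    continuousAt_const.mul (continuousAt_pi.1 hy'.continuousAt j)
  have hsol := eventually_small_solution (c := c) hk hc (φ := fun p => ρ⁻¹ * φ p)
    (analyticAt_const.fun_mul hφ) (r := fun x => ρ⁻¹ * r x) (continuousAt_const.mul hr)
    (by rw [hr0, hφρ, inv_mul_cancel₀ hρ0])
    (Eventually.of_forall fun x => by rw [hφr]; ring) hyc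
    (by funext j; simp [hy''def, hy0']) hμ'.continuousAt hconj'
    (normalForm_eval hk hc hy hy0 hμ) hpb
  obtain ⟨e, ⟨g, g', hgan, hder, hl⟩, hYe, he0⟩ := (hsol.and
    ((eventually_scaleParam hk hy hy0 hμ hYsmall).and eventually_mem_nhdsWithin)).exists
  have he0 : (0 : ℝ) < e := he0
  have hek : e ^ k ≠ 0 := pow_ne_zero _ he0.ne'
  set Y : (Fin m → ℝ) → (Fin (k + 1) → ℝ) := fun l => scaleParam k e (y l) (μ l) with hYdef
  have hYan : AnalyticAt ℝ Y 0 := analyticAt_scaleParam hy hμ e he0.ne'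
  set T : (Fin m → ℝ) → ℝ := fun l => G (cf (k + 1) (g l - U), Y l) with hTdef
  have hmain : ∀ᶠ l in 𝓝 0, (lowCf k (repr k c (g l - U) (g' l - 1) (scaleLow k e (y'' l))
        (e ^ k * μ' l)) = fun j => Y l j.castSucc) ∧ e ^ k * μ' l = Y l (Fin.last k) ∧
      Fl (T l, Y l) = g l ∧ AnalyticAt ℝ G (cf (k + 1) (g l - U), Y l) ∧ |T l| < ε / 2 ∧
      dist (Y l) 0 < ε ∧ Fl (0, Y l) = U ∧
      ∀ u : ℝ, ‖u‖ ≤ 1 → ρ⁻¹ * φ (e * u, l) = e * eval u (g l) := by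
    filter_upwards [hl, hYe] with l h1 h2
    obtain ⟨h3, h4, h5⟩ := h1
    obtain ⟨h6, h7, h8⟩ := hp h2.1 h4
    obtain ⟨h9, h10, h11⟩ := h6 h5
    rw [resCf_repr hc (hder l)] at h10
    rw [phi_repr (hder l), add_sub_cancel] at h11
    exact ⟨h9, h10, h11, h7, h8, h2.2.1, h2.2.2, h3⟩
  -- In the coordinate `u = x/e` the field `nf` is slower by the factor `e^k`, so its time `T` is
  -- `e^k` times the time of the original family.
  refine ⟨?_, fun l => (e ^ k)⁻¹ * T l, ?_, ?_, ?_⟩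
  · filter_upwards [hmain] with l h1
    have := h1.2.1
    simp only [hYdef, scaleParam_last] at this
    exact mul_left_cancel₀ hek this
  · refine analyticAt_const.fun_mul (AnalyticAt.fun_comp (g := G)
      (f := fun l => (cf (k + 1) (g l - U), Y l)) hmain.self_of_nhds.2.2.2.1 ?_)
    exact (analyticAt_cf _ (hgan.fun_sub analyticAt_const)).prod hYan
  · filter_upwards [hmain] with l h1 j
    have h2 := h1.1
    rw [lowCf_repr] at h2
    have h3 := congrFun h2 j
    simp only [hYdef, scaleParam_castSucc, scaleLow] at h3
    rw [hyy]
    change _ * y'' l j = _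
    rw [(div_left_inj' (pow_ne_zero _ he0.ne')).1 h3]
  · intro V hV
    have hflow : ∀ s : ℝ, |s| < ε → ∀ l, dist (Y l) 0 < ε → _ := fun s hs l hYl =>
      hball (y := (s, Y l)) (by
        rw [Prod.dist_eq]
        exact max_lt (by simpa using hs) hYl)
    -- At `λ = 0` the flow fixes the origin because `y(0) = 0`; compactness of the time interval
    -- gives one neighbourhood valid for all times.
    have hstay : ∀ᶠ p in 𝓝 (0 : ℝ × (Fin m → ℝ)), ∀ s ∈ Set.Icc (-(ε / 2)) (ε / 2),
        e * eval (e⁻¹ * p.1) (Fl (s, Y p.2)) ∈ V := by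
      refine isCompact_Icc.eventually_forall_of_forall_eventually fun s hs => ?_
      have hs' : |s| < ε := (abs_le.2 hs).trans_lt (by linarith)
      obtain ⟨han, -, -, hz⟩ := hflow s hs' 0 hmain.self_of_nhds.2.2.2.2.2.1
      have h1 : AnalyticAt ℝ (fun q : (ℝ × (Fin m → ℝ)) × ℝ => (q.2, Y q.1.2)) (0, s) :=
        analyticAt_snd.prod (AnalyticAt.fun_comp (g := Y)
          (f := fun q : (ℝ × (Fin m → ℝ)) × ℝ => q.1.2) hYan
          (((ContinuousLinearMap.snd ℝ ℝ (Fin m → ℝ)).comp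
            (ContinuousLinearMap.fst ℝ (ℝ × (Fin m → ℝ)) ℝ)).analyticAt _))
      have h2 : AnalyticAt ℝ (fun q : (ℝ × (Fin m → ℝ)) × ℝ => Fl (q.2, Y q.1.2)) (0, s) :=
        AnalyticAt.fun_comp (g := Fl) (f := fun q : (ℝ × (Fin m → ℝ)) × ℝ => (q.2, Y q.1.2))
          han h1
      have h3 : AnalyticAt ℝ (fun q : (ℝ × (Fin m → ℝ)) × ℝ => e⁻¹ * q.1.1) (0, s) :=
        analyticAt_const.fun_mul (((ContinuousLinearMap.fst ℝ ℝ (Fin m → ℝ)).comp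
            (ContinuousLinearMap.fst ℝ (ℝ × (Fin m → ℝ)) ℝ)).analyticAt _)
      have h4 := (analyticAt_const (v := e)).fun_mul (h2.wienerEval h3 (by simp))
      refine h4.continuousAt.eventually_mem ?_
      have h5 : eval (0 : ℝ) (Fl (s, Y 0)) = 0 := hz fun j => by
        simp [hYdef, scaleParam_castSucc, scaleLow, hy0]
      simpa [h5] using hV
    have hsnd : Tendsto (fun p : ℝ × (Fin m → ℝ) => p.2) (𝓝 0) (𝓝 0) :=
      Continuous.tendsto' (by fun_prop) _ _ rfl
    have hx : ∀ᶠ p : ℝ × (Fin m → ℝ) in 𝓝 0, ‖e⁻¹ * p.1‖ < 1 := by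
      have : ContinuousAt (fun p : ℝ × (Fin m → ℝ) => ‖e⁻¹ * p.1‖) 0 := by fun_prop
      exact this.eventually_lt_const (by simp)
    filter_upwards [hsnd.eventually hmain, hstay, hx] with p h1 h2 h3
    obtain ⟨-, -, hT, -, hTε, hYε, hU, hev⟩ := h1
    have hmem : ∀ s ∈ Set.uIcc 0 ((e ^ k)⁻¹ * T p.2), e ^ k * s ∈ Set.Icc (-(ε / 2)) (ε / 2) := by
      intro s hs
      have h4 : |s| ≤ |(e ^ k)⁻¹ * T p.2| := by simpa using Set.abs_sub_left_of_mem_uIcc hs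
      rw [abs_mul, abs_of_pos (inv_pos.2 (pow_pos he0 k)), le_inv_mul_iff₀ (pow_pos he0 k)] at h4
      refine abs_le.1 ?_
      rw [abs_mul, abs_of_pos (pow_pos he0 k)]
      linarith
    refine ⟨fun s => e * eval (e⁻¹ * p.1) (Fl (e ^ k * s, Y p.2)), ?_, fun s hs => ?_,
      fun s hs => h2 _ (hmem s hs), ?_⟩
    · simp only [mul_zero, hU, eval_U]
      rw [mul_inv_cancel_left₀ he0.ne']
    · have hs' : |e ^ k * s| < ε := (abs_le.2 (hmem s hs)).trans_lt (by linarith)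
      obtain ⟨-, hu, hd, -⟩ := hflow _ hs' p.2 hYε
      refine HasDerivAt.hasDerivWithinAt ?_
      have hd1 : HasDerivAt (fun s => Fl (e ^ k * s, Y p.2)) _ s :=
        HasDerivAt.scomp (g₁ := fun s => Fl (s, Y p.2)) (h := fun s => e ^ k * s) s hd ((hasDerivAt_id s).const_mul (e ^ k))
      have hd2 := ((evalL (e⁻¹ * p.1)).hasFDerivAt.comp_hasDerivAt s hd1).const_mul e
      simp only [Function.comp_def, evalL_apply h3] at hd2
      refine hd2.congr_deriv ?_
      simp only [hYdef, scaleParam_last, scaleParam_castSucc] at hu ⊢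
      rw [eval_smul, mul_one]
      have hq := eval_quotient (y := y p.2) (μ := μ p.2) he0.ne' hu h3.le
      simp only [normalForm]
      rw [← hq, pow_succ]
      simp only [RCLike.ofReal_real_eq_id, id]
      ring
    · simp only
      rw [mul_inv_cancel_left₀ hek, hT, ← hev _ h3.le, mul_inv_cancel_left₀ he0.ne',
        mul_inv_cancel_left₀ hρ0]

end Uniqueness

/-! ### Residues of elementary fractions under pull-back. -/

section Residue

/-- The contour integrals of `f` over the small circles around `z` exist and equal `2πi a`. -/
def HasResidue (f : ℂ → ℂ) (z a : ℂ) : Prop :=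
  ∀ᶠ ε in 𝓝[>] (0 : ℝ), CircleIntegrable f z ε ∧
    circleIntegral f z ε = 2 * (Real.pi : ℂ) * Complex.I * a

variable {f g : ℂ → ℂ} {z a b : ℂ}

lemma HasResidue.residue_eq (h : HasResidue f z a) : residue f z = a := by
  refine Tendsto.limUnder_eq (tendsto_const_nhds.congr' (h.mono fun ε hε => ?_))
  simp only [hε.2]
  rw [inv_mul_cancel_left₀]
  exact Complex.two_pi_I_ne_zero

lemma eventually_sphere {P : ℂ → Prop} (h : ∀ᶠ w in 𝓝[≠] z, P w) :
    ∀ᶠ ε in 𝓝[>] (0 : ℝ), ∀ w ∈ Metric.sphere z ε, P w := by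
  obtain ⟨r, hr, hP⟩ := Metric.eventually_nhds_iff.1 (eventually_nhdsWithin_iff.1 h)
  filter_upwards [Ioo_mem_nhdsGT hr] with ε hε w hw
  rw [Metric.mem_sphere] at hw
  refine hP (hw.trans_lt hε.2) fun h0 => ?_
  rw [Set.mem_singleton_iff.1 h0, dist_self] at hw
  exact hε.1.ne hw

lemma HasResidue.congr (h : HasResidue f z a) (hfg : ∀ᶠ w in 𝓝[≠] z, f w = g w) :
    HasResidue g z a := by
  filter_upwards [h, eventually_sphere hfg, self_mem_nhdsWithin] with ε h1 h2 h3
  have h3 : (0 : ℝ) < ε := h3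
  refine ⟨?_, ?_⟩
  · refine (circleIntegrable_congr fun w hw => ?_).1 h1.1
    rw [abs_of_pos h3] at hw
    exact h2 w hw
  · rw [← h1.2]
    exact (circleIntegral.integral_congr h3.le h2).symm

lemma HasResidue.const_mul (h : HasResidue f z a) (c : ℂ) :
    HasResidue (fun w => c * f w) z (c * a) := by
  filter_upwards [h] with ε hε
  refine ⟨hε.1.const_smul (a := c), ?_⟩
  rw [circleIntegral.integral_const_mul, hε.2]
  ring

lemma HasResidue.sum {ι : Type*} {s : Finset ι} {f : ι → ℂ → ℂ} {a : ι → ℂ}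
    (h : ∀ i ∈ s, HasResidue (f i) z (a i)) :
    HasResidue (fun w => ∑ i ∈ s, f i w) z (∑ i ∈ s, a i) := by
  have h' : ∀ᶠ ε in 𝓝[>] (0 : ℝ), ∀ i ∈ s, CircleIntegrable (f i) z ε ∧
      circleIntegral (f i) z ε = 2 * (Real.pi : ℂ) * Complex.I * a i :=
    (Filter.eventually_all_finset s).2 h
  filter_upwards [h'] with ε hε
  refine ⟨CircleIntegrable.fun_sum s fun i hi => (hε i hi).1, ?_⟩
  rw [circleIntegral.integral_fun_sum fun i hi => (hε i hi).1, Finset.mul_sum]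
  exact Finset.sum_congr rfl fun i hi => (hε i hi).2

lemma hasResidue_simple_pole (hg : AnalyticAt ℂ g z) :
    HasResidue (fun w => (w - z)⁻¹ * g w) z (g z) := by
  obtain ⟨r, hr, hP⟩ := Metric.eventually_nhds_iff.1 hg.eventually_analyticAt
  filter_upwards [Ioo_mem_nhdsGT hr] with ε hε
  have hd : ∀ w ∈ Metric.closedBall z ε, AnalyticAt ℂ g w := fun w hw =>
    hP ((Metric.mem_closedBall.1 hw).trans_lt hε.2)
  refine ⟨ContinuousOn.circleIntegrable hε.1.le fun w hw => ?_, ?_⟩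
  · refine (ContinuousAt.mul (ContinuousAt.inv₀ (by fun_prop) ?_)
      (hd w (Metric.sphere_subset_closedBall hw)).continuousAt).continuousWithinAt
    rw [sub_ne_zero]
    rintro rfl
    rw [Metric.mem_sphere, dist_self] at hw
    exact hε.1.ne hw
  · have := DifferentiableOn.circleIntegral_sub_inv_smul (c := z) (R := ε) (w := z) (f := g)
      (fun w hw => (hd w hw).differentiableAt.differentiableWithinAt)
      (Metric.mem_ball_self hε.1)
    simpa only [smul_eq_mul] using this

lemma hasResidue_of_analyticAt (hg : AnalyticAt ℂ g z) : HasResidue g z 0 := by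
  have h1 : AnalyticAt ℂ (fun w => (w - z) * g w) z :=
    (analyticAt_id.sub analyticAt_const).mul hg
  have h2 := hasResidue_simple_pole h1
  rw [sub_self, zero_mul] at h2
  refine h2.congr ?_
  filter_upwards [self_mem_nhdsWithin] with w hw
  rw [inv_mul_cancel_left₀ (sub_ne_zero.2 hw)]

/-- An exact differential has no periods. This handles the poles `((ψ - b)^(j+1))⁻¹ dψ` with `j ≥
1`. -/
lemma hasResidue_of_primitive (h : ∀ᶠ w in 𝓝[≠] z, HasDerivAt g (f w) w ∧ ContinuousAt f w) :
    HasResidue f z 0 := by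
  filter_upwards [eventually_sphere h, self_mem_nhdsWithin] with ε hε h0
  have h0 : (0 : ℝ) < ε := h0
  refine ⟨ContinuousOn.circleIntegrable h0.le fun w hw => (hε w hw).2.continuousWithinAt, ?_⟩
  rw [mul_zero]
  exact circleIntegral.integral_eq_zero_of_hasDerivWithinAt h0.le
    fun w hw => (hε w hw).1.hasDerivWithinAt

lemma eventually_ne_of_deriv_ne_zero {ψ : ℂ → ℂ} (hψ : AnalyticAt ℂ ψ z) (hd : deriv ψ z ≠ 0)
    (b : ℂ) : ∀ᶠ w in 𝓝[≠] z, ψ w ≠ b :=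
  hψ.differentiableAt.hasDerivAt.eventually_ne hd

/-- Residues of the pull-back of the elementary fractions by an immersion. -/
lemma hasResidue_pullback {ψ : ℂ → ℂ} (hψ : AnalyticAt ℂ ψ z) (hd : deriv ψ z ≠ 0) (b : ℂ) (j : ℕ) :
    HasResidue (fun w => deriv ψ w * ((ψ w - b) ^ (j + 1))⁻¹) z
      (if j = 0 ∧ b = ψ z then 1 else 0) := by
  have hne := eventually_ne_of_deriv_ne_zero hψ hd b
  rcases Nat.eq_zero_or_pos j with rfl | hj
  · simp only [true_and, zero_add, pow_one]
    split_ifs with hb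
    · subst hb
      have hG : AnalyticAt ℂ (fun w => deriv ψ w / dslope ψ z w) z := by
        refine hψ.deriv.div ?_ (by rwa [dslope_same])
        obtain ⟨p, hp⟩ := hψ
        exact hp.has_fpower_series_dslope_fslope.analyticAt
      have h1 := hasResidue_simple_pole hG
      rw [dslope_same, div_self hd] at h1
      refine h1.congr ?_
      filter_upwards [self_mem_nhdsWithin] with w hw
      have hw : w ≠ z := hw
      rw [dslope_of_ne _ hw, slope_def_field, div_div_eq_mul_div, div_eq_mul_inv, mul_comm _ (w - z),
        mul_assoc, inv_mul_cancel_left₀ (sub_ne_zero.2 hw)]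
    · refine hasResidue_of_analyticAt (hψ.deriv.mul ((hψ.sub analyticAt_const).inv ?_))
      exact sub_ne_zero.2 (Ne.symm hb)
  · rw [if_neg (by omega)]
    refine hasResidue_of_primitive (g := fun w => -(j : ℂ)⁻¹ * ((ψ w - b) ^ j)⁻¹) ?_
    filter_upwards [hne, nhdsWithin_le_nhds hψ.eventually_analyticAt] with w h1 h2
    have h3 : ψ w - b ≠ 0 := sub_ne_zero.2 h1
    constructor
    · have h4 := (((h2.differentiableAt.hasDerivAt.sub_const b).fun_pow j).fun_inv
        (pow_ne_zero _ h3)).const_mul (-(j : ℂ)⁻¹)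
      refine h4.congr_deriv ?_
      have hj' : (j : ℂ) ≠ 0 := by exact_mod_cast hj.ne'
      obtain ⟨i, rfl⟩ : ∃ i, j = i + 1 := ⟨j - 1, by omega⟩
      rw [Nat.add_sub_cancel]
      field_simp
      ring
    · exact h2.deriv.continuousAt.mul (ContinuousAt.inv₀
        ((h2.continuousAt.sub continuousAt_const).pow _) (pow_ne_zero _ h3))

end Residue

/-! ### The sum of the residues of an inverse normal form. -/

section ResidueAtInfinity

variable {k : ℕ} (c μ : ℂ) (y : Fin k → ℂ)

lemma ratForm_inv_inv {w : ℂ} (hw : w ≠ 0) : (ratForm k c y μ w⁻¹)⁻¹ =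
    w * ((c * w ^ k + μ) / (1 + ∑ j : Fin k, y j * w ^ (k + 1 - (j : ℕ)))) := by
  have e1 : ∀ j : Fin k, y j * w⁻¹ ^ (j : ℕ) =
      (w ^ (k + 1))⁻¹ * (y j * w ^ (k + 1 - (j : ℕ))) := fun j => by
    have hj := j.2
    rw [show w ^ (k + 1) = w ^ (k + 1 - (j : ℕ)) * w ^ (j : ℕ) by
      rw [← pow_add]; congr 1; omega, inv_pow]
    field_simp
  have e2 : c + μ * w⁻¹ ^ k = (w ^ k)⁻¹ * (c * w ^ k + μ) := by
    rw [inv_pow]; field_simp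
  simp only [ratForm, e1, ← Finset.mul_sum, e2]
  rw [inv_pow, ← mul_one_add, inv_div]
  field_simp
  ring

lemma analyticAt_ratForm_infinity : AnalyticAt ℂ (fun w : ℂ => (c * w ^ k + μ) /
    (1 + ∑ j : Fin k, y j * w ^ (k + 1 - (j : ℕ)))) 0 := by
  refine AnalyticAt.fun_div (by fun_prop) (by fun_prop) ?_
  have : ∀ j : Fin k, k + 1 - (j : ℕ) ≠ 0 := fun j => by have := j.2; omega
  simp [this]

lemma ratForm_infinity (hk : 1 ≤ k) : (c * (0 : ℂ) ^ k + μ) /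
    (1 + ∑ j : Fin k, y j * (0 : ℂ) ^ (k + 1 - (j : ℕ))) = μ := by
  have : ∀ j : Fin k, k + 1 - (j : ℕ) ≠ 0 := fun j => by have := j.2; omega
  simp [this, show k ≠ 0 by omega]

lemma residueAtInfinity_ratForm_inv (hk : 1 ≤ k) :
    -residueAtInfinity (fun z => (ratForm k c y μ z)⁻¹) = μ := by
  have h := hasResidue_simple_pole (analyticAt_ratForm_infinity c μ y)
  rw [ratForm_infinity c μ y hk] at h
  rw [residueAtInfinity, neg_neg]
  refine HasResidue.residue_eq (h.congr ?_)
  filter_upwards [self_mem_nhdsWithin] with w hw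
  have hw : w ≠ 0 := hw
  rw [ratForm_inv_inv c μ y hw, sub_zero]
  field_simp

/-- In the coordinate `w = 1/x` the quantity `x/N(x)` extends analytically to `w = 0` with value
`μ`. -/
lemma tendsto_mul_ratForm_inv (hk : 1 ≤ k) :
    Tendsto (fun x : ℂ => x * (ratForm k c y μ x)⁻¹) (Bornology.cobounded ℂ) (𝓝 μ) := by
  have h := (analyticAt_ratForm_infinity c μ y).continuousAt.tendsto.comp
    (tendsto_inv₀_cobounded (α := ℂ))
  rw [ratForm_infinity c μ y hk] at h
  refine h.congr' ?_
  filter_upwards [Bornology.isBounded_def.1 (Bornology.isBounded_singleton (x := (0 : ℂ)))]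
    with x hx
  have hx : x ≠ 0 := hx
  have h1 := ratForm_inv_inv c μ y (inv_ne_zero hx)
  rw [inv_inv] at h1
  rw [h1, mul_inv_cancel_left₀ hx]
  rfl

-- The remainders modulo the linear factors `X - a` are constants, and over `ℂ` the monic polynomial
-- `P` is the product of the powers of these factors.
open Polynomial in
lemma exists_partial_fractions {P : ℂ[X]} (hP : P.Monic) (Q : ℂ[X]) :
    ∃ (ι : Type) (T : Finset ι) (b : ι → ℂ) (m : ι → ℕ) (A : ι → ℂ) (q : ℂ[X]),
      (∀ i ∈ T, b i ∈ P.roots.toFinset) ∧ ∀ x, P.eval x ≠ 0 →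
        Q.eval x / P.eval x = q.eval x + ∑ i ∈ T, A i * ((x - b i) ^ (m i + 1))⁻¹ := by
  set S := P.roots.toFinset
  set n : ℂ → ℕ := fun a => P.rootMultiplicity a
  obtain ⟨q, r, hr, hQ⟩ := eq_quo_mul_prod_pow_add_sum_rem_mul_prod_pow (s := S) Q
    (g := fun a => X - C a) (fun a _ => monic_X_sub_C a)
    (fun a _ b _ hab => isCoprime_X_sub_C_of_isUnit_sub (sub_ne_zero.2 hab).isUnit) n
  have hprod : P = ∏ a ∈ S, (X - C a) ^ n a := by
    rw [← prod_multiset_root_eq_finset_root]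
    exact ((IsAlgClosed.splits P).eq_prod_roots_of_monic hP)
  refine ⟨(Σ a : ℂ, Fin (n a)), S.sigma fun _ => Finset.univ, fun i => i.1,
    fun i => n i.1 - 1 - i.2, fun i => (r i.1 i.2).coeff 0, q,
    fun i hi => (Finset.mem_sigma.1 hi).1, fun x hx => ?_⟩
  rw [Finset.sum_sigma, div_eq_iff hx, add_mul, hQ, ← hprod, Polynomial.eval_add, Polynomial.eval_mul,
    eval_finsetSum, Finset.sum_mul]
  congr 1
  refine Finset.sum_congr rfl fun a ha => ?_
  rw [eval_finsetSum, Finset.sum_mul]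
  refine Finset.sum_congr rfl fun j _ => ?_
  have hrj : r a j = C ((r a j).coeff 0) := eq_C_of_degree_le_zero (by
    have := hr a ha j
    rw [degree_X_sub_C] at this
    exact Nat.WithBot.lt_one_iff_le_zero.1 this)
  have hPa : P.eval x = (x - a) ^ n a * (∏ b ∈ S.erase a, (X - C b) ^ n b).eval x := by
    conv_lhs => rw [hprod, ← Finset.mul_prod_erase S _ ha]
    simp
  have hxa : x - a ≠ 0 := by
    intro h0
    rw [hPa, h0, zero_pow, zero_mul] at hx
    · exact hx rfl
    · have := j.2
      omega
  have hpow : (x - a) ^ n a = (x - a) ^ (j : ℕ) * (x - a) ^ (n a - 1 - j + 1) := by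
    rw [← pow_add]
    congr 1
    have := j.2
    omega
  rw [hPa, hpow, Polynomial.eval_mul, Polynomial.eval_mul, Polynomial.eval_pow, eval_sub, eval_X, eval_C]
  conv_lhs => rw [hrj]
  rw [eval_C]
  field_simp

lemma tendsto_fraction (b : ℂ) (m : ℕ) :
    Tendsto (fun x : ℂ => x * ((x - b) ^ (m + 1))⁻¹) (Bornology.cobounded ℂ)
      (𝓝 (if m = 0 then 1 else 0)) := by
  have h1 : Tendsto (fun x : ℂ => (x - b)⁻¹) (Bornology.cobounded ℂ) (𝓝 0) :=
    (tendsto_inv₀_cobounded (α := ℂ)).comp (tendsto_sub_const_cobounded b)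
  have h2 : Tendsto (fun x : ℂ => (1 + b * (x - b)⁻¹) * (x - b)⁻¹ ^ m) (Bornology.cobounded ℂ)
      (𝓝 ((1 + b * 0) * 0 ^ m)) :=
    ((h1.const_mul b).const_add 1).mul (h1.pow m)
  have h3 : (1 + b * 0) * 0 ^ m = if m = 0 then (1 : ℂ) else 0 := by
    split_ifs with h
    · simp [h]
    · simp [h]
  rw [h3] at h2
  refine h2.congr' ?_
  filter_upwards [Bornology.isBounded_def.1 (Bornology.isBounded_singleton (x := b))] with x hx
  have hx : x - b ≠ 0 := sub_ne_zero.2 hx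
  rw [inv_pow, pow_succ]
  field_simp
  ring

/-- The residues of the inverse of a normal form at its poles: they sum to `μ`, and they are
invariant under pull-back. -/
theorem exists_residues (hk : 1 ≤ k) : ∃ B : ℂ → ℂ,
    ∑ a ∈ (numPoly y).roots.toFinset, B a = μ ∧
    ∀ (ψ : ℂ → ℂ) (z : ℂ), AnalyticAt ℂ ψ z → deriv ψ z ≠ 0 →
      HasResidue (fun w => deriv ψ w * (ratForm k c y μ (ψ w))⁻¹) z (B (ψ z)) := by
  set P := numPoly y
  have hP : P.Monic := monic_numPoly y
  obtain ⟨ι, T, b, m, A, q, hb, hpf⟩ := exists_partial_fractions hP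
    (Polynomial.C c + Polynomial.C μ * Polynomial.X ^ k)
  have hpf' : ∀ x, P.eval x ≠ 0 → (ratForm k c y μ x)⁻¹ =
      q.eval x + ∑ i ∈ T, A i * ((x - b i) ^ (m i + 1))⁻¹ := fun x hx => by
    rw [← hpf x hx, ratForm, inv_div, eval_numPoly]
    simp
  have hfin : ∀ᶠ x in Bornology.cobounded ℂ, P.eval x ≠ 0 := by
    have h1 : (P.rootSet ℂ).Finite := Polynomial.rootSet_finite P ℂ
    filter_upwards [Bornology.isBounded_def.1 h1.isBounded] with x hx h0
    exact hx (by simp [Polynomial.mem_rootSet, hP.ne_zero, h0])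
  have hzero : Tendsto (fun x : ℂ => x⁻¹) (Bornology.cobounded ℂ) (𝓝 0) :=
    tendsto_inv₀_cobounded
  have hne : ∀ᶠ x in Bornology.cobounded ℂ, x ≠ 0 := by
    filter_upwards [Bornology.isBounded_def.1 (Bornology.isBounded_singleton (x := (0 : ℂ)))]
      with x hx
    exact hx
  have hsum : Tendsto (fun x : ℂ => ∑ i ∈ T, A i * (x * ((x - b i) ^ (m i + 1))⁻¹))
      (Bornology.cobounded ℂ) (𝓝 (∑ i ∈ T, A i * if m i = 0 then 1 else 0)) :=
    tendsto_finsetSum _ fun i _ => (tendsto_fraction (b i) (m i)).const_mul (A i)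
  have hrat := tendsto_mul_ratForm_inv c μ y hk
  -- Both `x/N(x)` and `x` times the fractional part have finite limits at infinity, so the
  -- polynomial part tends to zero and hence vanishes.
  have hq0 : Tendsto (fun x => q.eval x) (Bornology.cobounded ℂ) (𝓝 0) := by
    have h1 := hzero.mul (hrat.sub hsum)
    rw [zero_mul] at h1
    refine h1.congr' ?_
    filter_upwards [hfin, hne] with x h2 h3
    have e : ∑ i ∈ T, A i * (x * ((x - b i) ^ (m i + 1))⁻¹) =
        x * ∑ i ∈ T, A i * ((x - b i) ^ (m i + 1))⁻¹ := by
      rw [Finset.mul_sum]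
      exact Finset.sum_congr rfl fun i _ => by ring
    rw [e, hpf' x h2, ← mul_sub, inv_mul_cancel_left₀ h3]
    ring
  have hq : q = 0 := by
    have hdeg : q.degree ≤ 0 := by
      by_contra hcon
      exact not_tendsto_nhds_of_tendsto_atTop
        (q.tendsto_norm_atTop (not_le.1 hcon) tendsto_norm_cobounded_atTop) _ hq0.norm
    rw [Polynomial.eq_C_of_degree_le_zero hdeg] at hq0 ⊢
    simp only [Polynomial.eval_C] at hq0
    rw [tendsto_nhds_unique tendsto_const_nhds hq0, Polynomial.C_0]
  have hμ : ∑ i ∈ T, A i * (if m i = 0 then 1 else 0) = μ := by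
    refine tendsto_nhds_unique (hsum.congr' ?_) hrat
    filter_upwards [hfin] with x h2
    rw [hpf' x h2, hq, Polynomial.eval_zero, zero_add, Finset.mul_sum]
    exact Finset.sum_congr rfl fun i _ => by ring
  -- Only the fractions with a simple pole at `a` contribute to the residue there, and the same
  -- fractions determine the limit of `x/N(x)`.
  refine ⟨fun a => ∑ i ∈ T, A i * if m i = 0 ∧ b i = a then 1 else 0, ?_, ?_⟩
  · rw [Finset.sum_comm, ← hμ]
    refine Finset.sum_congr rfl fun i hi => ?_
    rw [← Finset.mul_sum]
    congr 1
    rw [Finset.sum_eq_single (b i)]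
    · simp
    · intro a _ ha
      rw [if_neg]
      exact fun h => ha h.2.symm
    · exact fun h => absurd (hb i hi) h
  · intro ψ z hψ hd
    have h1 : HasResidue (fun w => ∑ i ∈ T, A i * (deriv ψ w * ((ψ w - b i) ^ (m i + 1))⁻¹)) z
        (∑ i ∈ T, A i * if m i = 0 ∧ b i = ψ z then 1 else 0) :=
      HasResidue.sum fun i _ => (hasResidue_pullback hψ hd (b i) (m i)).const_mul (A i)
    refine h1.congr ?_
    have hPne : ∀ᶠ w in 𝓝[≠] z, P.eval (ψ w) ≠ 0 := by
      have h2 : ∀ᶠ w in 𝓝[≠] z, ∀ a ∈ P.roots.toFinset, ψ w ≠ a :=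
        (Filter.eventually_all_finset _).2 fun a _ => eventually_ne_of_deriv_ne_zero hψ hd a
      filter_upwards [h2] with w hw h0
      exact hw (ψ w) (by simp [hP.ne_zero, h0]) rfl
    filter_upwards [hPne] with w hw
    rw [hpf' _ hw, hq, Polynomial.eval_zero, zero_add, Finset.mul_sum]
    exact Finset.sum_congr rfl fun i _ => by ring

end ResidueAtInfinity

/-! ### Matching the local poles of the family with those of its normal form. -/

section LocalResidue

variable {k : ℕ} {c : ℝ}

/-- At a root with `‖x‖ ≥ δ` the leading term would have to be balanced by the lower ones, which are
at most `‖x‖^(k+1) Σ |y_j| / δ^(k+1-j)`; for small `y` this is too little. -/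
lemma eventually_roots_small (k : ℕ) {δ : ℝ} (hδ : 0 < δ) : ∀ᶠ y : Fin k → ℝ in 𝓝 0, ∀ x : ℂ,
    (numPoly fun j => (y j : ℂ)).eval x = 0 → ‖x‖ < δ := by
  have hcont : ContinuousAt (fun y : Fin k → ℝ => ∑ j : Fin k, ‖y j‖ / δ ^ (k + 1 - (j : ℕ))) 0 :=
    (continuous_finsetSum _ fun j _ => (continuous_apply j).norm.div_const _).continuousAt
  have h1 := hcont.eventually_lt_const (u := 1) (by simp)
  filter_upwards [h1] with y hy x hx
  by_contra hcon
  have hxδ : δ ≤ ‖x‖ := not_lt.1 hcon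
  have hx0 : 0 < ‖x‖ := hδ.trans_le hxδ
  rw [eval_numPoly, add_eq_zero_iff_eq_neg] at hx
  have h2 : ‖x‖ ^ (k + 1) ≤ ‖x‖ ^ (k + 1) * ∑ j : Fin k, ‖y j‖ / δ ^ (k + 1 - (j : ℕ)) := by
    calc ‖x‖ ^ (k + 1) = ‖∑ j : Fin k, (y j : ℂ) * x ^ (j : ℕ)‖ := by
          rw [← norm_pow, hx, norm_neg]
      _ ≤ ∑ j : Fin k, ‖(y j : ℂ) * x ^ (j : ℕ)‖ := norm_sum_le _ _
      _ ≤ ∑ j : Fin k, ‖x‖ ^ (k + 1) * (‖y j‖ / δ ^ (k + 1 - (j : ℕ))) := by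
          refine Finset.sum_le_sum fun j _ => ?_
          have hj := j.2
          rw [norm_mul, norm_pow, Complex.norm_real,
            show ‖x‖ ^ (k + 1) = ‖x‖ ^ (j : ℕ) * ‖x‖ ^ (k + 1 - (j : ℕ)) by
              rw [← pow_add]; congr 1; omega, mul_comm ‖y j‖, mul_assoc]
          refine mul_le_mul_of_nonneg_left ?_ (by positivity)
          rw [mul_div_left_comm]
          refine le_mul_of_one_le_right (norm_nonneg _) ?_
          rw [one_le_div (by positivity)]
          exact pow_le_pow_left₀ hδ.le hxδ _
      _ = _ := by rw [Finset.mul_sum]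
  have h3 : (1 : ℝ) ≤ ∑ j : Fin k, ‖y j‖ / δ ^ (k + 1 - (j : ℕ)) :=
    le_of_mul_le_mul_left (by simpa using h2) (pow_pos hx0 (k + 1))
  exact absurd hy (not_lt.2 h3)

/-- The coordinate change minus the identity has derivative `dxi k w`, bounded by `1/2` on the disc,
so the mean value inequality applies. -/
lemma approximatesLinearOn_phi {w : Wiener} (hw : ‖dxi k w‖ < 1 / 2) :
    ApproximatesLinearOn (fun u : ℂ => eval u (phi k 0 w))
      ((ContinuousLinearEquiv.refl ℂ ℂ : ℂ ≃L[ℂ] ℂ) : ℂ →L[ℂ] ℂ) (Metric.ball 0 1) (1 / 2) := by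
  intro u hu v hv
  have hu1 : ‖u‖ < 1 := mem_ball_zero_iff.1 hu
  have hv1 : ‖v‖ < 1 := mem_ball_zero_iff.1 hv
  have e : ∀ x : ℂ, ‖x‖ ≤ 1 → eval x (phi k 0 w) = x + eval x (xi k w) := fun x hx => by
    rw [phi, zero_smul, add_zero, eval_add hx, eval_U]
  have h1 := Convex.norm_image_sub_le_of_norm_hasDerivWithin_le (𝕜 := ℂ) (C := 1 / 2)
    (f := fun x : ℂ => eval x (xi k w)) (f' := fun x => eval x (dxi k w)) (s := Metric.ball 0 1)
    (fun x hx => (hasDerivAt_eval (isDeriv_xi k w) (mem_ball_zero_iff.1 hx)).hasDerivWithinAt)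
    (fun x hx => (norm_eval_le (mem_ball_zero_iff.1 hx).le _).trans hw.le) (convex_ball 0 1) hv hu
  simp only [e u hu1.le, e v hv1.le]
  refine le_trans (le_of_eq ?_) (h1.trans (le_of_eq ?_))
  · congr 1
    simp only [ContinuousLinearEquiv.coe_coe, ContinuousLinearEquiv.refl_apply]
    ring
  · simp

lemma injOn_phi {w : Wiener} (hw : ‖dxi k w‖ < 1 / 2) :
    Set.InjOn (fun u : ℂ => eval u (phi k 0 w)) (Metric.ball 0 1) := by
  intro u hu v hv huv
  have h1 := approximatesLinearOn_phi hw u hu v hv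
  simp only at huv
  beta_reduce at h1
  rw [huv, sub_self, zero_sub, norm_neg] at h1
  simp only [ContinuousLinearEquiv.coe_coe, ContinuousLinearEquiv.refl_apply, NNReal.coe_div,
    NNReal.coe_one, NNReal.coe_ofNat] at h1
  have h2 : ‖u - v‖ = 0 := by linarith [norm_nonneg (u - v)]
  exact sub_eq_zero.1 (norm_eq_zero.1 h2)

/-- Quantitative inverse function theorem: a perturbation of the identity with Lipschitz constant
`1/2` covers half the radius. -/
lemma surjOn_phi {w : Wiener} (hw : ‖dxi k w‖ < 1 / 2) {ρ : ℝ} (hρ : 0 ≤ ρ) (hρ1 : ρ < 1) :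
    Set.SurjOn (fun u : ℂ => eval u (phi k 0 w)) (Metric.closedBall 0 ρ)
      (Metric.closedBall (eval (0 : ℂ) (phi k 0 w)) (ρ / 2)) := by
  have h := (approximatesLinearOn_phi hw).surjOn_closedBall_of_nonlinearRightInverse
    (ContinuousLinearEquiv.refl ℂ ℂ).toNonlinearRightInverse hρ
    (Metric.closedBall_subset_ball hρ1)
  have h1 : (ContinuousLinearEquiv.refl ℂ ℂ).toNonlinearRightInverse.nnnorm = 1 := by
    change ‖((ContinuousLinearEquiv.refl ℂ ℂ).symm : ℂ →L[ℂ] ℂ)‖₊ = 1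
    exact ContinuousLinearMap.nnnorm_id
  rw [h1] at h
  have h2 : (((1 : NNReal) : ℝ)⁻¹ - ((1 / 2 : NNReal) : ℝ)) * ρ = ρ / 2 := by
    norm_num
    ring
  rwa [h2] at h

/-- The residue parameter of the reduction is the local residue sum of the family. -/
theorem isLocalResidueSum_of_slice {m : ℕ} {e : ℝ} (hk : 1 ≤ k) (he : 0 < e) {X : Family m}
    {Fc : ℂ × (Fin m → ℂ) → ℂ} (hFc : IsComplexification Fc X) {h w : (Fin m → ℝ) → Wiener}
    (hw : ContinuousAt w 0) (hlow : lowCf k (w 0) = 0) (h0 : eval (0 : ℝ) (phi k 0 (w 0)) = 0)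
    (hl : ∀ᶠ l in 𝓝 0, ‖dxi k (w l)‖ < 1 / 2 ∧ F k c ((h l, 0), w l) = 0 ∧
      IsUnit (den k c (resCf k c (w l)) (phi k 0 (w l))) ∧
      ∀ u : ℂ, ‖u‖ ≤ 1 → Fc (e * u, fun i => (l i : ℂ)) = (e : ℂ) ^ (k + 1) * eval u (h l)) :
    IsLocalResidueSum X (fun l => resCf k c (w l) / e ^ k) := by
  refine ⟨Fc, hFc, ?_⟩
  filter_upwards [Ioo_mem_nhdsGT he] with r hr
  have heC : (e : ℂ) ≠ 0 := by exact_mod_cast he.ne'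
  -- The disc `‖u‖ ≤ ρ` corresponds to `‖z‖ ≤ r/2 < r`. Its image contains the disc of radius `ρ/2`
  -- about `φ(0)`; as `φ(0)` and all roots have norm below `ρ/4`, every root is attained.
  set ρ := r / (2 * e) with hρdef
  have hρ0 : 0 < ρ := div_pos hr.1 (by linarith)
  have hρ1 : ρ < 1 := by
    rw [hρdef, div_lt_one (by linarith)]; linarith [hr.2]
  have hroots : ∀ᶠ l in 𝓝 0, ∀ x : ℂ,
      (numPoly fun j => (lowCf k (w l) j : ℂ)).eval x = 0 → ‖x‖ < ρ / 4 := by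
    have hc : ContinuousAt (fun l => lowCf k (w l)) 0 :=
      continuousAt_pi.2 fun j => (cfL j).continuous.continuousAt.comp hw
    refine hc.eventually (p := fun y : Fin k → ℝ => ∀ x : ℂ,
      (numPoly fun j => (y j : ℂ)).eval x = 0 → ‖x‖ < ρ / 4) ?_
    beta_reduce
    rw [hlow]
    exact eventually_roots_small k (by positivity)
  have hcenter : ∀ᶠ l in 𝓝 0, ‖eval (0 : ℂ) (phi k 0 (w l))‖ < ρ / 4 := by
    have hc : ContinuousAt (fun l => cf 0 (phi k 0 (w l))) 0 := by
      have h1 : ContinuousAt (fun l => phi k 0 (w l)) 0 := by unfold phi; fun_prop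
      exact (cfL 0).continuous.continuousAt.comp h1
    have h1 : ContinuousAt (fun l => ‖cf 0 (phi k 0 (w l))‖) 0 := hc.norm
    have h2 := h1.eventually_lt_const (u := ρ / 4) (by
      beta_reduce
      rw [← eval_zero, h0, norm_zero]; positivity)
    filter_upwards [h2] with l hl
    have h3 := eval_ofReal (𝕜 := ℂ) 0 (phi k 0 (w l))
    rw [eval_zero] at h3
    rw [show (0 : ℂ) = ((0 : ℝ) : ℂ) by simp]
    refine lt_of_eq_of_lt ?_ hl
    exact (congrArg norm h3).trans (Complex.norm_real _)
  filter_upwards [hl, hroots, hcenter] with l hl hroot hcen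
  obtain ⟨hd, hF, hu, hFev⟩ := hl
  set f : ℂ → ℂ := fun z => Fc (z, fun i => (l i : ℂ)) with hfdef
  set φ := phi k 0 (w l)
  set y : Fin k → ℂ := fun j => (lowCf k (w l) j : ℂ)
  set μ : ℂ := (resCf k c (w l) : ℂ)
  set ψ : ℂ → ℂ := fun z => eval ((e : ℂ)⁻¹ * z) φ with hψdef
  have hnorm : ∀ z : ℂ, ‖(e : ℂ)⁻¹ * z‖ = ‖z‖ / e := fun z => by
    rw [norm_mul, norm_inv, Complex.norm_real, Real.norm_of_nonneg he.le, div_eq_inv_mul]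
  have hlt : ∀ z : ℂ, ‖z‖ < e → ‖(e : ℂ)⁻¹ * z‖ < 1 := fun z hz => by
    rw [hnorm, div_lt_one he]; exact hz
  have hf : ∀ z : ℂ, ‖z‖ < e → f z = (e : ℂ) ^ (k + 1) * eval ((e : ℂ)⁻¹ * z) (h l) := fun z hz => by
    have := hFev _ (hlt z hz).le
    rwa [mul_inv_cancel_left₀ heC] at this
  have hrat : ∀ z : ℂ, ‖z‖ < e → ratForm k (c : ℂ) y μ (ψ z) =
      eval ((e : ℂ)⁻¹ * z) (dphi k 0 (w l)) * eval ((e : ℂ)⁻¹ * z) (h l) := fun z hz =>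
    ratForm_eval_of_defect (𝕜 := ℂ) hF hu (hlt z hz).le
  have hden : ∀ z : ℂ, ‖z‖ < e → (c : ℂ) + μ * ψ z ^ k ≠ 0 := fun z hz => by
    have h1 := eval_ne_zero_of_isUnit (hlt z hz).le hu
    rw [eval_den (hlt z hz).le] at h1
    exact h1
  have hzero : ∀ z : ℂ, ‖z‖ < e → (f z = 0 ↔ (numPoly y).eval (ψ z) = 0) := fun z hz => by
    rw [hf z hz, mul_eq_zero, or_iff_right (pow_ne_zero _ heC), eval_numPoly]
    have h1 := hrat z hz
    have h2 := eval_dphi_ne_zero hd (hlt z hz).le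
    rw [ratForm, div_eq_iff (hden z hz)] at h1
    rw [h1, mul_eq_zero, or_iff_left (hden z hz), mul_eq_zero, or_iff_right h2]
  have hmem : ∀ x : ℂ, x ∈ (numPoly y).roots.toFinset ↔ (numPoly y).eval x = 0 := fun x => by
    rw [Multiset.mem_toFinset, Polynomial.mem_roots (monic_numPoly y).ne_zero, Polynomial.IsRoot.def]
  have hbij : Set.BijOn ψ {z : ℂ | ‖z‖ < r ∧ f z = 0} ((numPoly y).roots.toFinset : Set ℂ) := by
    refine ⟨fun z hz => ?_, fun z hz z' hz' hzz => ?_, fun x hx => ?_⟩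
    · exact (hmem _).2 ((hzero z (hz.1.trans hr.2)).1 hz.2)
    · have h1 := injOn_phi hd (mem_ball_zero_iff.2 (hlt z (hz.1.trans hr.2)))
        (mem_ball_zero_iff.2 (hlt z' (hz'.1.trans hr.2))) hzz
      exact mul_left_cancel₀ (inv_ne_zero heC) h1
    · have hx0 := (hmem x).1 hx
      have h1 : x ∈ Metric.closedBall (eval (0 : ℂ) φ) (ρ / 2) := by
        rw [mem_closedBall_iff_norm]
        have := hroot x hx0
        have h2 := norm_sub_le x (eval (0 : ℂ) φ)
        linarith
      obtain ⟨u, hu1, hu2⟩ := surjOn_phi hd hρ0.le hρ1 h1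
      have hu1 : ‖u‖ ≤ ρ := mem_closedBall_zero_iff.1 hu1
      have h3 : ψ (e * u) = x := by
        rw [hψdef, ← hu2]
        simp only [inv_mul_cancel_left₀ heC]
        rfl
      have h4 : ‖(e : ℂ) * u‖ < r := by
        rw [norm_mul, Complex.norm_real, Real.norm_of_nonneg he.le]
        calc e * ‖u‖ ≤ e * ρ := mul_le_mul_of_nonneg_left hu1 he.le
          _ = r / 2 := by rw [hρdef]; field_simp
          _ < r := by linarith [hr.1]
      exact ⟨e * u, ⟨h4, (hzero _ (h4.trans hr.2)).2 (by rw [h3]; exact hx0)⟩, h3⟩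
  obtain ⟨B, hB, hres⟩ := exists_residues (c : ℂ) μ y hk
  have hψd : ∀ z : ℂ, ‖z‖ < e →
      HasDerivAt ψ (eval ((e : ℂ)⁻¹ * z) (dphi k 0 (w l)) * (e : ℂ)⁻¹) z := fun z hz => by
    have h1 := (hasDerivAt_eval (isDeriv_phi k 0 (w l)) (hlt z hz)).comp z
      ((hasDerivAt_id z).const_mul (e : ℂ)⁻¹)
    rwa [mul_one] at h1
  have hopen : ∀ z : ℂ, ‖z‖ < e → ∀ᶠ v in 𝓝 z, ‖v‖ < e := fun z hz =>
    continuous_norm.continuousAt.eventually_lt_const hz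
  refine ⟨hbij.finite_iff_finite.2 (Finset.finite_toSet _), ?_⟩
  change ((resCf k c (w l) / e ^ k : ℝ) : ℂ) =
    ∑ᶠ z ∈ {z : ℂ | ‖z‖ < r ∧ f z = 0}, residue (fun v => (f v)⁻¹) z
  rw [finsum_mem_eq_of_bijOn (g := fun a => ((e : ℂ) ^ k)⁻¹ * B a) ψ hbij fun z hz => ?_]
  · rw [finsum_mem_coe_finset, ← Finset.mul_sum, hB]
    push_cast
    rw [div_eq_inv_mul]
  · have hze := hz.1.trans hr.2
    have han : AnalyticAt ℂ ψ z := by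
      refine DifferentiableOn.analyticAt (s := {v : ℂ | ‖v‖ < e})
        (fun v hv => (hψd v hv).differentiableAt.differentiableWithinAt) (hopen z hze)
    have hd0 : deriv ψ z ≠ 0 := by
      rw [(hψd z hze).deriv]
      exact mul_ne_zero (eval_dphi_ne_zero hd (hlt z hze).le) (inv_ne_zero heC)
    -- From `N(ψ) = φ' h`, `ψ' = φ'/e` and `f = e^(k+1) h` follows `1/f = e^(-k) ψ'/N(ψ)`.
    refine HasResidue.residue_eq (((hres ψ z han hd0).const_mul ((e : ℂ) ^ k)⁻¹).congr ?_)
    filter_upwards [nhdsWithin_le_nhds (hopen z hze)] with v hv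
    have h1 := eval_dphi_ne_zero hd (hlt v hv).le
    change _ = (f v)⁻¹
    rw [(hψd v hv).deriv, hrat v hv, hf v hv, mul_inv, mul_inv, pow_succ, mul_inv]
    generalize eval ((e : ℂ)⁻¹ * v) (dphi k 0 (w l)) = d at h1
    field_simp

end LocalResidue

/-! ### Existence of normal forms and assembly of the theorem. -/

/-- A family unfolding a simple zero is conjugate to a linear family. -/
theorem IsUnfolding.exists_linear_form {m : ℕ} {X : Family m} (hX : IsUnfolding 0 X) :
    ∃ c : (Fin m → ℝ) → ℝ, AnalyticAt ℝ c 0 ∧ c 0 ≠ 0 ∧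
      AreConjugate X (fun p => c p.2 * p.1) := by
  obtain ⟨hXan, ω, hω, hω0, hXω⟩ := hX
  obtain ⟨Fc, -, h, W, -, -, hev⟩ := exists_reduction (k := 0) hω0 hXan (r := fun x => 1 / ω x)
    (continuousAt_const.div hω.continuousAt hω0) (one_div _) hXω
  obtain ⟨e, ⟨-, hW, -, h0, hl⟩, he⟩ := (hev.and self_mem_nhdsWithin).exists
  have he : 0 < e := he
  set w := fun l => W (h e l) with hw
  have hconj := conjugates_of_slice (X := X) (h := h e) (w := w) (c := ω 0) he he.ne' hW h0
    (hl.mono fun l hl => ⟨hl.1, hl.2.1, hl.2.2.1, hl.2.2.2.2⟩)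
  -- For `k = 0` the denominator `c + μ x^0` does not depend on `x`, so the normal form is already
  -- linear once it is known to be nonzero.
  have hne : ω 0 + resCf 0 (ω 0) (w 0) ≠ 0 := by
    have h1 := eval_ne_zero_of_isUnit (𝕜 := ℝ) (u := 0) (by simp) hl.self_of_nhds.2.2.1
    rw [eval_den (by simp), pow_zero, mul_one] at h1
    exact h1
  have hr := analyticAt_resCf (k := 0) (c := ω 0) hW
  refine ⟨fun l => (ω 0 + resCf 0 (ω 0) (w l))⁻¹, (analyticAt_const.fun_add hr).fun_inv hne,
    inv_ne_zero hne, _, hconj.1, hconj.2.mono fun p hp => ?_⟩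
  rw [← hp, normalForm, ratForm]
  simp [div_eq_inv_mul]

/-- A family unfolding a multiple zero is conjugate to a normal form, whose parameter `μ` is the
local residue sum of the family. -/
theorem IsUnfolding.exists_normalForm {m k : ℕ} {X : Family m} (hk : 1 ≤ k)
    (hX : IsUnfolding k X) :
    ∃ (s : ℝ) (y : (Fin m → ℝ) → (Fin k → ℝ)) (μ : (Fin m → ℝ) → ℝ),
      (s = 1 ∨ s = -1) ∧ AnalyticAt ℝ y 0 ∧ y 0 = 0 ∧ AnalyticAt ℝ μ 0 ∧
      AreConjugate X (normalForm k (s ^ (k + 1)) y μ) ∧ IsLocalResidueSum X μ := by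
  obtain ⟨hXan, ω, hω, hω0, hXω⟩ := hX
  obtain ⟨Fc, hFc, h, W, -, -, hev⟩ := exists_reduction hω0 hXan (r := fun x => 1 / ω x)
    (continuousAt_const.div hω.continuousAt hω0) (one_div _) hXω
  obtain ⟨e, ⟨-, hW, hlow, h0, hl⟩, he⟩ := (hev.and self_mem_nhdsWithin).exists
  have he : 0 < e := he
  obtain ⟨s, b, hs, hb, hsb⟩ := exists_scaling hk hω0
  have hconj := conjugates_of_slice (X := X) (h := h e) (w := fun l => W (h e l)) (c := ω 0) he
    (mul_ne_zero hb he.ne') hW h0 (hl.mono fun l hl => ⟨hl.1, hl.2.1, hl.2.2.1, hl.2.2.2.2⟩)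
  rw [mul_div_cancel_right₀ b he.ne', hsb] at hconj
  refine ⟨s, _, _, hs, analyticAt_scaled hW, ?_,
    (analyticAt_resCf hW).fun_div analyticAt_const (pow_ne_zero _ he.ne'), ⟨_, hconj⟩,
    isLocalResidueSum_of_slice hk he hFc hW.continuousAt hlow h0
      (hl.mono fun l hl => ⟨hl.1, hl.2.1, hl.2.2.1, hl.2.2.2.1⟩)⟩
  funext j
  simp [hlow]

/-- A conjugacy between normal forms is a rotation composed with the flow. -/
theorem normalForm_unique_of_sign {m k : ℕ} {s s' : ℝ} {y y' : (Fin m → ℝ) → (Fin k → ℝ)}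
    {μ μ' : (Fin m → ℝ) → ℝ} {φ : ℝ × (Fin m → ℝ) → ℝ} (hk : 1 ≤ k)
    (hs : s = 1 ∨ s = -1) (hy : AnalyticAt ℝ y 0) (hy0 : y 0 = 0) (hμ : AnalyticAt ℝ μ 0)
    (hs' : s' = 1 ∨ s' = -1) (hy' : AnalyticAt ℝ y' 0) (hy0' : y' 0 = 0)
    (hμ' : AnalyticAt ℝ μ' 0)
    (h : Conjugates φ (normalForm k (s ^ (k + 1)) y μ) (normalForm k (s' ^ (k + 1)) y' μ')) :
    s' ^ (k + 1) = s ^ (k + 1) ∧ μ' =ᶠ[𝓝 0] μ ∧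
      ∃ (ρ : ℝ) (t : (Fin m → ℝ) → ℝ), ρ ^ k = 1 ∧ AnalyticAt ℝ t 0 ∧
        (∀ᶠ l : Fin m → ℝ in 𝓝 0, ∀ j : Fin k, y' l j = ρ ^ (-((j : ℤ) - 1)) * y l j) ∧
        IsScaledFlow φ ρ t (normalForm k (s ^ (k + 1)) y μ) := by
  have ne : ∀ {a : ℝ}, a = 1 ∨ a = -1 → a ^ (k + 1) ≠ 0 := fun ha =>
    pow_ne_zero _ (by rcases ha with rfl | rfl <;> norm_num)
  -- The leading coefficients first force the two signs to agree; with equal constants the same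
  -- identity says that the linear part is a `k`-th root of unity.
  have h1 := deriv_pow_mul_eq hk (ne hs) (ne hs') hy0 hy0' h
  have h2 := sign_eq_of_pow hs hs' h.1.2.2 h1
  rw [h2] at h h1
  have hρ := mul_eq_right₀ (ne hs) |>.1 h1
  obtain ⟨h3, t, ht, h4, h5⟩ := normalForm_unique hk (ne hs) hy hy0 hμ hy' hy0' hμ' hρ rfl h
  exact ⟨h2, h3, _, t, hρ, ht, h4, h5⟩

end KostovReal

end

theorem mainTheorem4 :
    -- existence, `k = 0`
    (∀ (m : ℕ) (X : KostovReal.Family m), KostovReal.IsUnfolding 0 X →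
      ∃ c : (Fin m → ℝ) → ℝ, AnalyticAt ℝ c 0 ∧ c 0 ≠ 0 ∧
        KostovReal.AreConjugate X (fun p => c p.2 * p.1)) ∧
    -- existence, `k ≥ 1`
    (∀ (m k : ℕ) (X : KostovReal.Family m), 1 ≤ k → KostovReal.IsUnfolding k X →
      ∃ (s : ℝ) (y : (Fin m → ℝ) → (Fin k → ℝ)) (μ : (Fin m → ℝ) → ℝ),
        (s = 1 ∨ s = -1) ∧ AnalyticAt ℝ y 0 ∧ y 0 = 0 ∧ AnalyticAt ℝ μ 0 ∧
        KostovReal.AreConjugate X (KostovReal.normalForm k (s ^ (k + 1)) y μ) ∧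
        KostovReal.IsLocalResidueSum X μ ∧
        ∀ᶠ l : Fin m → ℝ in 𝓝 0, (μ l : ℂ) =
          -KostovReal.residueAtInfinity (fun z =>
            (KostovReal.ratForm k ((s : ℂ) ^ (k + 1)) (fun j => (y l j : ℂ)) (μ l : ℂ) z)⁻¹)) ∧
    -- uniqueness, `k = 0`
    (∀ (m : ℕ) (c c' : (Fin m → ℝ) → ℝ) (φ : ℝ × (Fin m → ℝ) → ℝ),
      AnalyticAt ℝ c 0 → c 0 ≠ 0 → AnalyticAt ℝ c' 0 → c' 0 ≠ 0 →
      KostovReal.Conjugates φ (fun p => c p.2 * p.1) (fun p => c' p.2 * p.1) →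
      c' =ᶠ[𝓝 0] c ∧
      ∃ (ε : ℝ) (t : (Fin m → ℝ) → ℝ), (ε = 1 ∨ ε = -1) ∧ AnalyticAt ℝ t 0 ∧
        ∀ᶠ p : ℝ × (Fin m → ℝ) in 𝓝 0, φ p = ε * Real.exp (t p.2) * p.1) ∧
    -- uniqueness up to the real rotations `x ↦ ρ x`, `ρ ^ k = 1`, for `k ≥ 1`
    (∀ (m k : ℕ) (s s' : ℝ) (y y' : (Fin m → ℝ) → (Fin k → ℝ)) (μ μ' : (Fin m → ℝ) → ℝ)
        (φ : ℝ × (Fin m → ℝ) → ℝ), 1 ≤ k →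
      (s = 1 ∨ s = -1) → AnalyticAt ℝ y 0 → y 0 = 0 → AnalyticAt ℝ μ 0 →
      (s' = 1 ∨ s' = -1) → AnalyticAt ℝ y' 0 → y' 0 = 0 → AnalyticAt ℝ μ' 0 →
      KostovReal.Conjugates φ (KostovReal.normalForm k (s ^ (k + 1)) y μ)
        (KostovReal.normalForm k (s' ^ (k + 1)) y' μ') →
      s' ^ (k + 1) = s ^ (k + 1) ∧ μ' =ᶠ[𝓝 0] μ ∧
      ∃ (ρ : ℝ) (t : (Fin m → ℝ) → ℝ), ρ ^ k = 1 ∧ AnalyticAt ℝ t 0 ∧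
        (∀ᶠ l : Fin m → ℝ in 𝓝 0, ∀ j : Fin k, y' l j = ρ ^ (-((j : ℤ) - 1)) * y l j) ∧
        KostovReal.IsScaledFlow φ ρ t (KostovReal.normalForm k (s ^ (k + 1)) y μ)) ∧
    -- the real rotations do act on the normal forms in this way
    (∀ (m k : ℕ) (s ρ : ℝ) (y : (Fin m → ℝ) → (Fin k → ℝ)) (μ : (Fin m → ℝ) → ℝ), 1 ≤ k →
      (s = 1 ∨ s = -1) → AnalyticAt ℝ y 0 → y 0 = 0 → AnalyticAt ℝ μ 0 → ρ ^ k = 1 →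
      KostovReal.Conjugates (fun p => ρ * p.1) (KostovReal.normalForm k (s ^ (k + 1)) y μ)
        (KostovReal.normalForm k (s ^ (k + 1))
          (fun l j => ρ ^ (-((j : ℤ) - 1)) * y l j) μ)) ∧
    -- universality of the standard deformation
    (∀ (k : ℕ) (s μ : ℝ), 1 ≤ k → (s = 1 ∨ s = -1) →
      KostovReal.IsUniversalDeformation (KostovReal.standardDeformation k (s ^ (k + 1)) μ)) := by
  refine ⟨fun _ _ hX => hX.exists_linear_form, fun m k X hk hX => ?_,
    fun _ _ _ _ hc hc0 _ _ h => KostovReal.linear_family_unique hc hc0 h,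
    fun _ _ _ _ _ _ _ _ _ hk hs hy hy0 hμ hs' hy' hy0' hμ' h =>
      KostovReal.normalForm_unique_of_sign hk hs hy hy0 hμ hs' hy' hy0' hμ' h,
    fun _ _ _ _ y μ hk _ _ _ _ hρ => KostovReal.conjugates_rotate hk hρ y μ,
    fun _ _ μ hk hs => KostovReal.isUniversalDeformation_standardDeformation hk
      (pow_ne_zero _ (by rcases hs with rfl | rfl <;> norm_num)) μ⟩
  obtain ⟨s, y, μ, hs, hy, hy0, hμ, hconj, hres⟩ := hX.exists_normalForm hk
  exact ⟨s, y, μ, hs, hy, hy0, hμ, hconj, hres, Eventually.of_forall fun l =>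
    (KostovReal.residueAtInfinity_ratForm_inv _ _ _ hk).symm⟩
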